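/- Let $(M,g)$ be a connected, oriented and time-oriented smooth Lorentzian four-manifold of signature $(-,+,+,+)$ with a spin structure, and let $S$ be the associated bundle of irreducible real Clifford modules (rank four, Clifford multiplication normalized by $v\cdot v\cdot\varepsilon=g(v,v)\,\varepsilon$), with the connection $\nabla^g$ induced by the Levi-Civita connection. Let $\varepsilon$ be a smooth section of $S$, not identically zero, such that for some real constant $\lambda\neq 0$ $$\nabla^g_v\varepsilon=\tfrac{\lambda}{2}\,v\cdot\varepsilon\qquad\text{for all tangent vectors } v .$$ Then $(M,g)$ is locally isometric to an open subset of $\mathbb{R}^4$ with a metric of the following form. For every $p\in M$ there are smooth families, parametrized by $x_u\in\mathbb{R}$, of functions $\mathcal{H}_{x_u},\mathcal{F}_{x_u},\mathcal{G}_{x_u}$ and of one-forms $\beta_{x_u}$ on $X=\mathbb{R}^2$, such that $\mathrm{d}_X\mathcal{F}_{x_u}$ and $\mathrm{d}_X\mathcal{G}_{x_u}$ are everywhere linearly independent and $$\mathrm{d}_X\beta_{x_u}=\frac{e^{-\mathcal{F}_{x_u}}}{4\lambda^2}\,\big\langle\partial_{x_u}{\ast_{q_{x_u}}}\mathrm{d}_X\mathcal{F}_{x_u}+\ast_{q_{x_u}}\partial_{x_u}\mathrm{d}_X\mathcal{F}_{x_u},\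 \mathrm{d}_X\mathcal{F}_{x_u}\big\rangle_{q_{x_u}}\,\nu_{q_{x_u}},\qquad q_{x_u}=\frac{1}{4\lambda^2}\,\mathrm{d}_X\mathcal{F}_{x_u}\otimes\mathrm{d}_X\mathcal{F}_{x_u}+e^{\mathcal{F}_{x_u}}\,\mathrm{d}_X\mathcal{G}_{x_u}\otimes\mathrm{d}_X\mathcal{G}_{x_u},$$ and there is a diffeomorphism from an open neighbourhood of $p$ onto an open subset of $\mathbb{R}^4=\mathbb{R}^2\times X$, with coordinates $(x_u,x_v)$ on the first factor, under which $g$ becomes $$\mathcal{H}_{x_u}\,\mathrm{d}x_u\otimes\mathrm{d}x_u+e^{\mathcal{F}_{x_u}}\,\mathrm{d}x_u\odot(\mathrm{d}x_v+\beta_{x_u})+\frac{1}{4\lambda^2}\,\mathrm{d}_X\mathcal{F}_{x_u}\otimes\mathrm{d}_X\mathcal{F}_{x_u}+e^{\mathcal{F}_{x_u}}\,\mathrm{d}_X\mathcal{G}_{x_u}\otimes\mathrm{d}_X\mathcal{G}_{x_u}.$$ Here $\mathrm{d}_X$ is the exterior derivative on $X$, $a\odot b=a\otimes b+b\otimes a$,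 and $\ast_q,\langle\cdot,\cdot\rangle_q,\nu_q$ are the Hodge star, inner product and volume form of $q$ for the standard orientation of $X$. -/

import Mathlib

open scoped ContDiff Manifold

noncomputable section

namespace SusyKundt

/-! ### The Clifford algebra of signature `(-,+,+,+)` and its real spinor module -/

/-- The diagonal entries of the Minkowski form `diag(-1,1,1,1)`. -/
def eta (a : Fin 4) : ℝ := if a = 0 then -1 else 1

/-- The Minkowski quadratic form `-w₀² + w₁² + w₂² + w₃²` on `ℝ⁴`. -/
def minkowski : QuadraticForm ℝ (Fin 4 → ℝ) := QuadraticMap.weightedSumSquares ℝ eta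

/-- Real gamma matrices: `γ₀² = -1`, `γ₁² = γ₂² = γ₃² = 1`, pairwise anticommuting. -/
def gammaMat : Fin 4 → Matrix (Fin 4) (Fin 4) ℝ :=
  ![!![0, 1, 0, 0; -1, 0, 0, 0; 0, 0, 0, -1; 0, 0, 1, 0],
    !![0, 0, 1, 0; 0, 0, 0, 1; 1, 0, 0, 0; 0, 1, 0, 0],
    !![0, 1, 0, 0; 1, 0, 0, 0; 0, 0, 0, -1; 0, 0, -1, 0],
    !![1, 0, 0, 0; 0, -1, 0, 0; 0, 0, -1, 0; 0, 0, 0, 1]]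

/-- Clifford multiplication by `w = ∑ wᵃ eₐ` on the spinor module `ℝ⁴`. -/
def gamma : (Fin 4 → ℝ) →ₗ[ℝ] Matrix (Fin 4) (Fin 4) ℝ :=
  Fintype.linearCombination ℝ gammaMat

/-- The Clifford relation `γ(w)² = ⟨w, w⟩`. -/
theorem gamma_mul_self (w : Fin 4 → ℝ) :
    gamma w * gamma w = algebraMap ℝ (Matrix (Fin 4) (Fin 4) ℝ) (minkowski w) := by
  ext i j
  fin_cases i <;> fin_cases j <;>
    simp [gamma, Fintype.linearCombination_apply, gammaMat, minkowski, eta, Fin.sum_univ_four,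
      Matrix.mul_apply, QuadraticMap.weightedSumSquares_apply, Matrix.algebraMap_matrix_apply] <;>
    ring

/-- The representation of the Clifford algebra `Cl(3,1)` on `ℝ⁴`. -/
def spinRep : CliffordAlgebra minkowski →ₐ[ℝ] Matrix (Fin 4) (Fin 4) ℝ :=
  CliffordAlgebra.lift minkowski ⟨gamma, gamma_mul_self⟩

/-- The spinor module is irreducible: a subspace preserved by Clifford multiplication is trivial. -/
theorem spinorModule_irreducible (W : Submodule ℝ (Fin 4 → ℝ))
    (hW : ∀ a, ∀ s ∈ W, (gammaMat a).mulVec s ∈ W) : W = ⊥ ∨ W = ⊤ := by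
  have h0 := hW 0
  have h1 := hW 1
  have h2 := hW 2
  have h3 := hW 3
  by_cases hb : W = ⊥
  · exact Or.inl hb
  right
  obtain ⟨s, hs, hs0⟩ := W.ne_bot_iff.1 hb
  -- every component of an element of `W` sits in `W` as a multiple of the first basis vector
  have key : ∀ t ∈ W, t 0 • (Pi.single 0 1 : Fin 4 → ℝ) ∈ W := by
    intro t ht
    have e : t 0 • (Pi.single 0 1 : Fin 4 → ℝ) = (1 / 4 : ℝ) • (t + (gammaMat 3).mulVec t
        + (gammaMat 0).mulVec ((gammaMat 2).mulVec t)
        + (gammaMat 0).mulVec ((gammaMat 2).mulVec ((gammaMat 3).mulVec t))) := by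
      ext i
      fin_cases i <;>
        (simp [gammaMat, dotProduct, Fin.sum_univ_four, Matrix.vecHead, Matrix.vecTail]; try ring)
    rw [e]
    exact W.smul_mem _ (W.add_mem (W.add_mem (W.add_mem ht (h3 t ht)) (h0 _ (h2 t ht)))
      (h0 _ (h2 _ (h3 t ht))))
  have k1 : s 1 • (Pi.single 0 1 : Fin 4 → ℝ) ∈ W := by
    have := key _ (h2 s hs)
    simpa [gammaMat, Matrix.mulVec, dotProduct, Fin.sum_univ_four, Matrix.vecHead,
      Matrix.vecTail] using this
  have k2 : s 2 • (Pi.single 0 1 : Fin 4 → ℝ) ∈ W := by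
    have := key _ (h1 s hs)
    simpa [gammaMat, Matrix.mulVec, dotProduct, Fin.sum_univ_four, Matrix.vecHead,
      Matrix.vecTail] using this
  have k3 : s 3 • (Pi.single 0 1 : Fin 4 → ℝ) ∈ W := by
    have := key _ (h2 _ (h1 s hs))
    simpa [gammaMat, Matrix.mulVec, dotProduct, Fin.sum_univ_four, Matrix.vecHead,
      Matrix.vecTail] using this
  have hE : (Pi.single 0 1 : Fin 4 → ℝ) ∈ W := by
    by_contra hne
    apply hs0
    have z : ∀ c : ℝ, c • (Pi.single 0 1 : Fin 4 → ℝ) ∈ W → c = 0 := fun c hc => by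
      by_contra hc0
      exact hne ((W.smul_mem_iff hc0).1 hc)
    ext i
    fin_cases i
    · exact z _ (key s hs)
    · exact z _ k1
    · exact z _ k2
    · exact z _ k3
  rw [eq_top_iff]
  intro t _
  have e : t = t 0 • (Pi.single 0 1 : Fin 4 → ℝ)
      + t 1 • (gammaMat 2).mulVec (Pi.single 0 1)
      + t 2 • (gammaMat 1).mulVec (Pi.single 0 1)
      + t 3 • (gammaMat 1).mulVec ((gammaMat 2).mulVec (Pi.single 0 1)) := by
    ext i
    fin_cases i <;>
      simp [gammaMat, dotProduct, Fin.sum_univ_four]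
  rw [e]
  exact W.add_mem (W.add_mem (W.add_mem (W.smul_mem _ hE) (W.smul_mem _ (h2 _ hE)))
    (W.smul_mem _ (h1 _ hE))) (W.smul_mem _ (h1 _ (h2 _ hE)))

/-- The group `Spin₀(3,1)` acting on the spinor module. The elements of Mathlib's `spinGroup` are
the even products `x` of vectors with `reverse x * x = 1`; in signature `(-,+,+,+)` these are the
even products of unit vectors with an even number of timelike factors, that is, the identity
component of the spin group. -/
def spinZero : Submonoid (Matrix (Fin 4) (Fin 4) ℝ) :=
  (spinGroup minkowski).map (spinRep : CliffordAlgebra minkowski →* Matrix (Fin 4) (Fin 4) ℝ)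

/-! ### Lorentzian four-manifolds, spin structures and Killing spinors -/

section Manifold

variable (M : Type*) [TopologicalSpace M] [ChartedSpace (EuclideanSpace ℝ (Fin 4)) M]
  [IsManifold (𝓡 4) ∞ M]

/-- A smooth metric of signature `(-,+,+,+)`. -/
structure LorentzianMetric where
  /-- The scalar product on each tangent space. -/
  inner (x : M) : TangentSpace (𝓡 4) x →L[ℝ] TangentSpace (𝓡 4) x →L[ℝ] ℝ
  symm (x : M) (v w : TangentSpace (𝓡 4) x) : inner x v w = inner x w v
  lorentzian (x : M) : ∃ b : Fin 4 → TangentSpace (𝓡 4) x,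
    ∀ a c, inner x (b a) (b c) = if a = c then eta a else 0
  contMDiff : ContMDiff (𝓡 4)
    ((𝓡 4).prod 𝓘(ℝ, EuclideanSpace ℝ (Fin 4) →L[ℝ] EuclideanSpace ℝ (Fin 4) →L[ℝ] ℝ)) ∞
    (fun x ↦ Bundle.TotalSpace.mk'
      (EuclideanSpace ℝ (Fin 4) →L[ℝ] EuclideanSpace ℝ (Fin 4) →L[ℝ] ℝ) x (inner x))

variable {M}

/-- The derivative of a function in the direction of a tangent vector. -/
def dirDeriv (f : M → ℝ) (x : M) (v : TangentSpace (𝓡 4) x) : ℝ :=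
  mfderiv (𝓡 4) 𝓘(ℝ, ℝ) f x v

/-- The Levi-Civita connection of `g`, through the Koszul formula:
`g(∇_X Y, Z)` at the point `x`, for vector fields `X`, `Y`, `Z` that are smooth near `x`. -/
def koszul (g : LorentzianMetric M) (X Y Z : (x : M) → TangentSpace (𝓡 4) x) (x : M) : ℝ :=
  (1 / 2) *
    (dirDeriv (fun y ↦ g.inner y (Y y) (Z y)) x (X x)
      + dirDeriv (fun y ↦ g.inner y (X y) (Z y)) x (Y x)
      - dirDeriv (fun y ↦ g.inner y (X y) (Y y)) x (Z x)
      + g.inner x (VectorField.mlieBracket (𝓡 4) X Y x) (Z x)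
      - g.inner x (VectorField.mlieBracket (𝓡 4) X Z x) (Y x)
      - g.inner x (VectorField.mlieBracket (𝓡 4) Y Z x) (X x))

/-- A spin structure on `(M, g)`, given by an open cover with smooth orthonormal frames and a
`Spin₀(3,1)`-valued cocycle that lifts the transition functions of the frames. The frames then
change by elements of `SO₀(3,1)`, so they orient and time-orient `M`; conversely, the frames of
a spin structure of an oriented and time-oriented `(M, g)` are of this kind. -/
structure SpinStructure (g : LorentzianMetric M) (ι : Type*) where
  /-- The members of the cover. -/
  dom : ι → Set M
  isOpen_dom : ∀ i, IsOpen (dom i)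
  cover : ∀ x, ∃ i, x ∈ dom i
  /-- The frames. -/
  frame : ι → Fin 4 → (x : M) → TangentSpace (𝓡 4) x
  frame_smooth : ∀ i a, ContMDiffOn (𝓡 4) (𝓡 4).tangent ∞
    (fun x ↦ (⟨x, frame i a x⟩ : TangentBundle (𝓡 4) M)) (dom i)
  frame_orthonormal : ∀ i, ∀ x ∈ dom i, ∀ a c,
    g.inner x (frame i a x) (frame i c x) = if a = c then eta a else 0
  /-- The lifts of the transition functions. -/
  trans : ι → ι → M → Matrix (Fin 4) (Fin 4) ℝ
  trans_smooth : ∀ i j a b,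
    ContMDiffOn (𝓡 4) 𝓘(ℝ, ℝ) ∞ (fun x ↦ trans i j x a b) (dom i ∩ dom j)
  trans_mem : ∀ i j, ∀ x ∈ dom i ∩ dom j, trans i j x ∈ spinZero
  trans_cocycle : ∀ i j k, ∀ x ∈ dom i ∩ dom j ∩ dom k,
    trans i j x * trans j k x = trans i k x
  /-- If `frame j b = ∑ c, Λ c b • frame i c` then `trans i j` conjugates `γ_b` to
  `∑ c, Λ c b • γ_c`. -/
  trans_lift : ∀ i j, ∀ x ∈ dom i ∩ dom j, ∀ b,
    trans i j x * gammaMat b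
      = (∑ c, (eta c * g.inner x (frame i c x) (frame j b x)) • gammaMat c) * trans i j x

namespace SpinStructure

variable {g : LorentzianMetric M} {ι : Type*} (P : SpinStructure g ι)

/-- The components of a tangent vector in the `i`-th frame. -/
def coord (i : ι) (x : M) (v : TangentSpace (𝓡 4) x) (a : Fin 4) : ℝ :=
  eta a * g.inner x (P.frame i a x) v

/-- The components `g(∇_v e_b, e_a)` of the Levi-Civita connection in the `i`-th frame. -/
def connection (i : ι) (x : M) (v : TangentSpace (𝓡 4) x) (a b : Fin 4) : ℝ :=
  ∑ c, P.coord i x v c * koszul g (P.frame i c) (P.frame i b) (P.frame i a) x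

/-- A spinor: a smooth section of the vector bundle associated to the spin structure through the
representation of `Spin₀(3,1)` on the irreducible Clifford module `ℝ⁴`. -/
structure Spinor where
  /-- The components of the section over each member of the cover. -/
  comp : ι → M → (Fin 4 → ℝ)
  smooth : ∀ i, ContMDiffOn (𝓡 4) 𝓘(ℝ, Fin 4 → ℝ) ∞ (comp i) (P.dom i)
  compat : ∀ i j, ∀ x ∈ P.dom i ∩ P.dom j,
    comp i x = (P.trans i j x).mulVec (comp j x)

variable {P}

/-- Clifford multiplication `v · ε` over the `i`-th member of the cover. -/
def Spinor.cliffordMul (ε : P.Spinor) (i : ι) (x : M) (v : TangentSpace (𝓡 4) x) :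
    Fin 4 → ℝ :=
  (gamma (P.coord i x v)).mulVec (ε.comp i x)

/-- The spinorial Levi-Civita connection over the `i`-th member of the cover,
`∇_v ε = v(ε) + (1/4) ∑ g(∇_v e_b, e_a) γᵃ γᵇ ε`, with `γᵃ = η^{aa} γ_a`. -/
def Spinor.covDeriv (ε : P.Spinor) (i : ι) (x : M) (v : TangentSpace (𝓡 4) x) :
    Fin 4 → ℝ :=
  let dε : Fin 4 → ℝ := mfderiv (𝓡 4) 𝓘(ℝ, Fin 4 → ℝ) (ε.comp i) x v
  dε + ((1 / 4 : ℝ) • ∑ a, ∑ b, (P.connection i x v a b * eta a * eta b) •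
        (gammaMat a * gammaMat b)).mulVec (ε.comp i x)

/-- `ε` is a real Killing spinor with Killing constant `lam`: it is not identically zero,
`lam ≠ 0`, and `∇_v ε = (lam/2) v · ε` for all tangent vectors `v`. -/
structure Spinor.IsKilling (ε : P.Spinor) (lam : ℝ) : Prop where
  const_ne_zero : lam ≠ 0
  nontrivial : ∃ i, ∃ x ∈ P.dom i, ε.comp i x ≠ 0
  killing : ∀ i, ∀ x ∈ P.dom i, ∀ v : TangentSpace (𝓡 4) x,
    ε.covDeriv i x v = (lam / 2) • ε.cliffordMul i x v

end SpinStructure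

end Manifold

/-! ### Families of tensors on the plane `X = ℝ²`, in Cartesian coordinates -/

/-- The differential `d_X f`, as the list of its components. -/
def dX (f : (Fin 2 → ℝ) → ℝ) (y : Fin 2 → ℝ) : Fin 2 → ℝ :=
  fun i ↦ fderiv ℝ f y (Pi.single i 1)

/-- The component along `dy₀ ∧ dy₁` of the exterior derivative `d_X β` of a one-form. -/
def dXOneForm (β : (Fin 2 → ℝ) → (Fin 2 → ℝ)) (y : Fin 2 → ℝ) : ℝ :=
  dX (fun z ↦ β z 1) y 0 - dX (fun z ↦ β z 0) y 1

/-- The inner product of covectors with respect to a metric with matrix `q`. -/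
def coInner (q : Matrix (Fin 2) (Fin 2) ℝ) (α β : Fin 2 → ℝ) : ℝ :=
  dotProduct α (q⁻¹.mulVec β)

/-- The component along `dy₀ ∧ dy₁` of the Riemannian volume form. -/
def volumeCoeff (q : Matrix (Fin 2) (Fin 2) ℝ) : ℝ := Real.sqrt q.det

/-- The Hodge star on covectors, `∗α = ι_{α♯} ν`, for the orientation `dy₀ ∧ dy₁`. -/
def hodge (q : Matrix (Fin 2) (Fin 2) ℝ) (α : Fin 2 → ℝ) : Fin 2 → ℝ :=
  ![-(volumeCoeff q * q⁻¹.mulVec α 1), volumeCoeff q * q⁻¹.mulVec α 0]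

/-- The matrix of `q_{x_u} = (1/4λ²) d_X F ⊗ d_X F + e^F d_X G ⊗ d_X G` at `y`. -/
def planeMetric (lam : ℝ) (F G : ℝ → (Fin 2 → ℝ) → ℝ) (u : ℝ) (y : Fin 2 → ℝ) :
    Matrix (Fin 2) (Fin 2) ℝ :=
  Matrix.of fun i j ↦ 1 / (4 * lam ^ 2) * (dX (F u) y i * dX (F u) y j)
    + Real.exp (F u y) * (dX (G u) y i * dX (G u) y j)

/-- The equation
`d_X β = (e^{-F}/4λ²) ⟨∂_{x_u} ∗ d_X F + ∗ ∂_{x_u} d_X F, d_X F⟩_q ν_q`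
for the family of one-forms `β`, where `q` is the family `planeMetric lam F G`. -/
def BetaEquation (lam : ℝ) (F G : ℝ → (Fin 2 → ℝ) → ℝ) (β : ℝ → (Fin 2 → ℝ) → (Fin 2 → ℝ)) :
    Prop :=
  ∀ u y, dXOneForm (β u) y =
    Real.exp (-F u y) / (4 * lam ^ 2) *
      coInner (planeMetric lam F G u y)
        (deriv (fun t ↦ hodge (planeMetric lam F G t y) (dX (F t) y)) u
          + hodge (planeMetric lam F G u y) (deriv (fun t ↦ dX (F t) y) u))
        (dX (F u) y) *
      volumeCoeff (planeMetric lam F G u y)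

/-- The metric
`H dx_u ⊗ dx_u + e^F dx_u ⊙ (dx_v + β) + (1/4λ²) d_X F ⊗ d_X F + e^F d_X G ⊗ d_X G`
on `ℝ⁴` with coordinates `(x_u, x_v, y₀, y₁)`, where `a ⊙ b = a ⊗ b + b ⊗ a`. -/
def kundtMetric (lam : ℝ) (H F G : ℝ → (Fin 2 → ℝ) → ℝ) (β : ℝ → (Fin 2 → ℝ) → (Fin 2 → ℝ))
    (p v w : EuclideanSpace ℝ (Fin 4)) : ℝ :=
  let u := p 0
  let y : Fin 2 → ℝ := ![p 2, p 3]
  let v' : Fin 2 → ℝ := ![v 2, v 3]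
  let w' : Fin 2 → ℝ := ![w 2, w 3]
  H u y * (v 0 * w 0)
    + Real.exp (F u y) * (v 0 * (w 1 + dotProduct (β u y) w') + (v 1 + dotProduct (β u y) v') * w 0)
    + 1 / (4 * lam ^ 2) * (dotProduct (dX (F u) y) v' * dotProduct (dX (F u) y) w')
    + Real.exp (F u y) * (dotProduct (dX (G u) y) v' * dotProduct (dX (G u) y) w')

end SusyKundt

end

open SusyKundt

/-! A real Killing spinor solves a linear first-order equation, so it vanishes near each of its
zeros; by connectedness it has no zeros (`SpinStructure.Spinor.IsKilling.comp_ne_zero`). Its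
bilinears then give a null coframe at every point: the Dirac current $\kappa$, two unit screen forms
$l,m$, and a transverse null form $n$, with $g=\kappa\odot n+l\otimes l+m\otimes m$
(`minkowski_eq_forms`). The Killing equation determines their covariant derivatives up to two
one-forms. Antisymmetrizing gives $d\kappa=2\lambda\,l\wedge\kappa$, $dl=\alpha\wedge\kappa$,
$dm=\lambda\,l\wedge m+\beta\wedge\kappa$, $dn=-\alpha\wedge l-\beta\wedge m$
(`adaptedCoframe_of_isKillingFrame`).

These equations can be integrated. Since $\kappa$ is integrable, $\kappa=e^F du$; then
$d\kappa=dF\wedge\kappa$ forces $dF=2\lambda(l+A\kappa)$. On the leaves of $\kappa$ the form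
$e^{-F/2}m$ is closed, whence $e^{F/2}dG=m+B\kappa$. The null rotation with parameters $A,B$
preserves the metric and replaces $n$ by a form $n'$ with $dn'=\kappa\wedge(c\,l+d\,m)$
(`extD_rotatedNull`). So $n'$ is closed on the leaves and $n'=dv+H\,du$; the absence of a
$\kappa\wedge n'$ term says that $H$ does not depend on $v$.

Using $u,v,F,G$ themselves as coordinates (`exists_siklos_coordinates`, `exists_kundt_chart`) brings
the metric to Siklos form $2e^FH\,du^2+e^F du\odot dv+\frac{1}{4\lambda^2}dF^2+e^F dG^2$. This is
the required Kundt form with $\mathcal F,\mathcal G$ the Cartesian coordinates of $X$ and zero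
one-form, so both sides of the equation for $d_X\beta$ vanish.

The analytic tool is `exists_leaf_primitive`: a form closed on the leaves of an integrable
hyperplane field is exact modulo the defining form. It rests on a Frobenius theorem with smooth
parameters (`exists_solution_totalDifferential`), obtained from the implicit function theorem in a
Banach space of curves. -/

noncomputable section

open Filter Topology Set

universe u

namespace SusyKundt

/-! ### Functions smooth near a point -/

section SmoothNear

variable {E F G : Type*} [NormedAddCommGroup E] [NormedSpace ℝ E]
  [NormedAddCommGroup F] [NormedSpace ℝ F] [NormedAddCommGroup G] [NormedSpace ℝ G]

/-- `f` is smooth on a neighbourhood of `a`. -/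
def SmoothNear (f : E → F) (a : E) : Prop := ∀ᶠ x in 𝓝 a, ContDiffAt ℝ ∞ f x

/-- The converse fails: `ContDiffAt` of order `∞` allows the neighbourhood to shrink with each
finite order, so it need not persist at nearby points. The neighbourhood version is the one that
passes to local constructions. -/
theorem SmoothNear.contDiffAt {f : E → F} {a : E} (h : SmoothNear f a) : ContDiffAt ℝ ∞ f a :=
  h.self_of_nhds

theorem SmoothNear.continuousAt {f : E → F} {a : E} (h : SmoothNear f a) : ContinuousAt f a :=
  h.contDiffAt.continuousAt

theorem ContDiff.smoothNear {f : E → F} (h : ContDiff ℝ ∞ f) (a : E) : SmoothNear f a :=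
  Eventually.of_forall fun _ => h.contDiffAt

protected theorem SmoothNear.comp {g : F → G} {f : E → F} {a : E} (hg : SmoothNear g (f a))
    (hf : SmoothNear f a) : SmoothNear (fun x => g (f x)) a := by
  filter_upwards [hf, hf.continuousAt.eventually hg] with x hx hgx
  exact hgx.comp x hx

theorem SmoothNear.prodMk {f : E → F} {g : E → G} {a : E} (hf : SmoothNear f a)
    (hg : SmoothNear g a) : SmoothNear (fun x => (f x, g x)) a := by
  filter_upwards [hf, hg] with x hx hgx
  exact hx.prodMk hgx

protected theorem SmoothNear.fderiv {f : E → F} {a : E} (hf : SmoothNear f a) :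
    SmoothNear (fderiv ℝ f) a := by
  filter_upwards [hf] with x hx
  exact hx.fderiv_right (m := ∞) (by simp)

theorem SmoothNear.differentiableAt {f : E → F} {a : E} (hf : SmoothNear f a) :
    DifferentiableAt ℝ f a := hf.contDiffAt.differentiableAt (by simp)

theorem SmoothNear.clm_apply {f : E → F →L[ℝ] G} {g : E → F} {a : E} (hf : SmoothNear f a)
    (hg : SmoothNear g a) : SmoothNear (fun x => f x (g x)) a := by
  filter_upwards [hf, hg] with x hx hgx
  exact hx.clm_apply hgx

/-- A function smooth near `a` agrees near `a` with a globally smooth one. -/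
theorem SmoothNear.exists_contDiff [FiniteDimensional ℝ E] {f : E → F} {a : E}
    (hf : SmoothNear f a) : ∃ g : E → F, ContDiff ℝ ∞ g ∧ g =ᶠ[𝓝 a] f := by
  obtain ⟨r, hr, hb⟩ := Metric.eventually_nhds_iff_ball.1 hf
  -- The outer radius `r / 2` is less than `r`, so the ball of radius `r` and the complement of the
  -- support of `χ` form an open cover.
  let χ : ContDiffBump a := ⟨r / 4, r / 2, by positivity, by linarith⟩
  refine ⟨fun x => χ x • f x, contDiff_iff_contDiffAt.2 fun x => ?_, ?_⟩
  · by_cases hx : x ∈ Metric.ball a r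
    · exact χ.contDiff.contDiffAt.smul (hb x hx)
    · have hx' : x ∈ (Metric.closedBall a (r / 2))ᶜ := by
        simp only [Metric.mem_ball, not_lt] at hx
        simp only [mem_compl_iff, Metric.mem_closedBall, not_le]
        linarith
      have : (fun x => χ x • f x) =ᶠ[𝓝 x] fun _ => 0 := by
        filter_upwards [Metric.isClosed_closedBall.isOpen_compl.mem_nhds hx'] with y hy
        have : χ y = 0 := χ.zero_of_le_dist (by
          simp only [mem_compl_iff, Metric.mem_closedBall, not_le] at hy
          exact hy.le)
        simp [this]
      exact contDiffAt_const.congr_of_eventuallyEq this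
  · filter_upwards [χ.eventuallyEq_one] with x hx
    simp [hx]

/-- The inverse function theorem, with smoothness on a full neighbourhood. -/
theorem SmoothNear.exists_openPartialHomeomorph [CompleteSpace E] {f : E → F} {a : E}
    (hf : SmoothNear f a) (f' : E ≃L[ℝ] F) (hf' : HasFDerivAt f (f' : E →L[ℝ] F) a) :
    ∃ Θ : OpenPartialHomeomorph E F, (Θ : E → F) = f ∧ a ∈ Θ.source ∧
      (∀ x ∈ Θ.source, ContDiffAt ℝ ∞ f x) ∧ ∀ y ∈ Θ.target, ContDiffAt ℝ ∞ Θ.symm y := by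
  have hn : (∞ : WithTop ℕ∞) ≠ 0 := by simp
  let Θ₀ := hf.contDiffAt.toOpenPartialHomeomorph f hf' hn
  -- Invertible maps form an open set, so the derivative stays invertible near `a`; shrinking the
  -- source to such points makes the inverse smooth on the whole target.
  have hinv : ∀ᶠ x in 𝓝 a, ∃ e : E ≃L[ℝ] F, (e : E →L[ℝ] F) = fderiv ℝ f x := by
    have h1 : Tendsto (fderiv ℝ f) (𝓝 a) (𝓝 (f' : E →L[ℝ] F)) := by
      have := hf.fderiv.continuousAt.tendsto
      rwa [hf'.fderiv] at this
    exact h1.eventually (ContinuousLinearEquiv.nhds f')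
  obtain ⟨W, hW, hWo, haW⟩ := eventually_nhds_iff.1 (hf.and hinv)
  let Θ := Θ₀.restrOpen W hWo
  have hsrc : Θ.source = Θ₀.source ∩ W := Θ₀.restrOpen_source W hWo
  have hcoe : (Θ : E → F) = f := rfl
  refine ⟨Θ, hcoe, ?_, ?_, ?_⟩
  · rw [hsrc]
    exact ⟨hf.contDiffAt.mem_toOpenPartialHomeomorph_source hf' hn, haW⟩
  · intro x hx
    rw [hsrc] at hx
    exact (hW x hx.2).1
  · intro y hy
    have hx : Θ.symm y ∈ Θ.source := Θ.map_target hy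
    rw [hsrc] at hx
    obtain ⟨h1, e, he⟩ := hW _ hx.2
    refine Θ.contDiffAt_symm hy (f₀' := e) ?_ ?_
    · rw [hcoe, he]
      exact (h1.differentiableAt (by simp)).hasFDerivAt
    · rw [hcoe]; exact h1

/-- The implicit function theorem, with smoothness on a full neighbourhood. -/
theorem SmoothNear.exists_implicit [CompleteSpace E] [CompleteSpace F] {N : E × F → G}
    {p : E} {z : F} (hN : SmoothNear N (p, z)) (h0 : N (p, z) = 0) (e : F ≃L[ℝ] G)
    (he : ∀ h, fderiv ℝ N (p, z) (0, h) = e h) :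
    ∃ γ : E → F, SmoothNear γ p ∧ γ p = z ∧ ∀ᶠ q in 𝓝 p, N (q, γ q) = 0 := by
  let D := fderiv ℝ N (p, z)
  -- The differential of `(q, w) ↦ (q, N (q, w))` is triangular with diagonal blocks `id` and `e`,
  -- hence invertible.
  let T : (E × F) ≃L[ℝ] (E × G) :=
    (ContinuousLinearEquiv.refl ℝ E).skewProd e (D.comp (ContinuousLinearMap.inl ℝ E F))
  have hΨ : SmoothNear (fun w : E × F => (w.1, N w)) (p, z) :=
    (ContDiff.smoothNear contDiff_fst _).prodMk hN
  have hD : HasFDerivAt (fun w : E × F => (w.1, N w)) (T : E × F →L[ℝ] E × G) (p, z) := by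
    have h1 : HasFDerivAt (fun w : E × F => (w.1, N w))
        ((ContinuousLinearMap.fst ℝ E F).prod D) (p, z) :=
      hasFDerivAt_fst.prodMk hN.differentiableAt.hasFDerivAt
    convert h1 using 1
    ext w
    · simp [T]
    · simp [T]
    · simp [T]
    · simp [T, D, he]
  obtain ⟨Θ, hcoe, hsrc, -, hsymm⟩ := hΨ.exists_openPartialHomeomorph T hD
  have hp : Θ (p, z) = (p, 0) := by rw [hcoe]; simp [h0]
  have htgt : (p, (0 : G)) ∈ Θ.target := hp ▸ Θ.map_source hsrc
  have hev : ∀ᶠ q in 𝓝 p, (q, (0 : G)) ∈ Θ.target :=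
    (Continuous.prodMk_left (0 : G)).continuousAt.eventually (Θ.open_target.mem_nhds htgt)
  refine ⟨fun q => (Θ.symm (q, 0)).2, ?_, ?_, ?_⟩
  · filter_upwards [hev] with q hq
    have h2 : ContDiffAt ℝ ∞ (fun q : E => (q, (0 : G))) q := contDiffAt_id.prodMk contDiffAt_const
    exact contDiffAt_snd.comp q (ContDiffAt.comp q (hsymm _ hq) h2)
  · simp only [← hp, Θ.left_inv hsrc]
  · filter_upwards [hev] with q hq
    have h3 := Θ.right_inv hq
    rw [hcoe] at h3
    have h4 : (Θ.symm (q, 0)).1 = q := congrArg Prod.fst h3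
    have h5 : N (Θ.symm (q, 0)) = 0 := congrArg Prod.snd h3
    have h6 : (q, (Θ.symm (q, 0)).2) = Θ.symm (q, 0) := Prod.ext h4.symm rfl
    rw [h6, h5]

end SmoothNear

/-! ### The superposition operator on spaces of continuous functions -/

section Superposition

variable {K : Type*} [TopologicalSpace K] [CompactSpace K]

/-- Pointwise application of continuous families of linear maps. -/
def pointwiseApply (K : Type*) [TopologicalSpace K] [CompactSpace K]
    (E F : Type*) [NormedAddCommGroup E] [NormedSpace ℝ E] [NormedAddCommGroup F]
    [NormedSpace ℝ F] : C(K, E →L[ℝ] F) →L[ℝ] C(K, E) →L[ℝ] C(K, F) :=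
  LinearMap.mkContinuous₂
    (LinearMap.mk₂ ℝ (fun (A : C(K, E →L[ℝ] F)) (h : C(K, E)) =>
        (⟨fun t => A t (h t), A.continuous.clm_apply h.continuous⟩ : C(K, F)))
      (fun _ _ _ => by ext; simp) (fun _ _ _ => by ext; simp)
      (fun _ _ _ => by ext; simp) (fun _ _ _ => by ext; simp)) 1
    (fun A h => by
      rw [ContinuousMap.norm_le _ (by positivity), one_mul]
      intro t
      exact ((A t).le_opNorm _).trans
        (mul_le_mul (A.norm_coe_le_norm t) (h.norm_coe_le_norm t) (norm_nonneg _) (by positivity)))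

@[simp] theorem pointwiseApply_apply {E F : Type*} [NormedAddCommGroup E] [NormedSpace ℝ E]
    [NormedAddCommGroup F] [NormedSpace ℝ F] (A : C(K, E →L[ℝ] F)) (h : C(K, E)) (t : K) :
    pointwiseApply K E F A h t = A t (h t) := rfl

variable {E F : Type u} [NormedAddCommGroup E] [NormedSpace ℝ E]
    [NormedAddCommGroup F] [NormedSpace ℝ F]

/-- The range of `γ` is compact, so `f'` is uniformly continuous along it; the mean value estimate
for `f` then holds with one constant for all `t`, which is the remainder estimate in the sup norm.
-/
theorem hasFDerivAt_superposition {f : C(E, F)} {f' : C(E, E →L[ℝ] F)}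
    (hf : ∀ x, HasFDerivAt f (f' x) x) (γ : C(K, E)) :
    HasFDerivAt (fun γ : C(K, E) => f.comp γ) (pointwiseApply K E F (f'.comp γ)) γ := by
  rw [hasFDerivAt_iff_isLittleO_nhds_zero, Asymptotics.isLittleO_iff]
  intro c hc
  have hcomp : IsCompact (range γ) := isCompact_range γ.continuous
  have hu := hcomp.uniformContinuousAt_of_continuousAt f'
    (fun a _ => f'.continuous.continuousAt) (Metric.dist_mem_uniformity hc)
  obtain ⟨δ, hδ, hδ'⟩ := Metric.mem_uniformity_dist.1 hu
  filter_upwards [Metric.ball_mem_nhds (0 : C(K, E)) hδ] with h hh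
  rw [ContinuousMap.norm_le _ (by positivity)]
  intro t
  have hht : ‖h t‖ < δ := lt_of_le_of_lt (h.norm_coe_le_norm t) (by simpa using hh)
  have key := (convex_ball (γ t) δ).norm_image_sub_le_of_norm_hasFDerivWithin_le'
    (f := f) (f' := f') (φ := f' (γ t)) (C := c) (x := γ t) (y := γ t + h t)
    (fun x _ => (hf x).hasFDerivWithinAt)
    (fun x hx => by
      have := hδ' (a := γ t) (b := x) (by rw [dist_comm]; exact hx) (mem_range_self t)
      rw [← dist_eq_norm, dist_comm]
      exact le_of_lt this)
    (Metric.mem_ball_self hδ) (by simpa [dist_eq_norm] using hht)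
  simp only [add_sub_cancel_left] at key
  calc ‖(f.comp (γ + h) - f.comp γ - pointwiseApply K E F (f'.comp γ) h) t‖
      = ‖f (γ t + h t) - f (γ t) - f' (γ t) (h t)‖ := by simp
    _ ≤ c * ‖h t‖ := key
    _ ≤ c * ‖h‖ := by gcongr; exact h.norm_coe_le_norm t

/-- The superposition operator of a smooth function is smooth. -/
theorem contDiff_superposition_nat (n : ℕ) :
    ∀ {F : Type u} [NormedAddCommGroup F] [NormedSpace ℝ F] (f : C(E, F)), ContDiff ℝ n f →
      ContDiff ℝ n (fun γ : C(K, E) => f.comp γ) := by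
  induction n with
  | zero =>
    intro F _ _ f _
    simp only [Nat.cast_zero, contDiff_zero]
    exact f.continuous_postcomp
  | succ n ih =>
    -- The derivative is the superposition operator of `f'`, whose codomain is `E →L[ℝ] F`; hence
    -- the induction runs over all codomains in one universe.
    intro F _ _ f hf
    obtain ⟨f', hf', hd⟩ := contDiff_succ_iff_hasFDerivAt.1 (by exact_mod_cast hf)
    push_cast
    refine contDiff_succ_iff_hasFDerivAt.2
      ⟨fun γ => pointwiseApply K E F ((⟨f', hf'.continuous⟩ : C(E, E →L[ℝ] F)).comp γ), ?_, ?_⟩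
    · exact (pointwiseApply K E F).contDiff.comp (ih ⟨f', hf'.continuous⟩ hf')
    · intro γ
      exact hasFDerivAt_superposition (f' := ⟨f', hf'.continuous⟩) hd γ

theorem contDiff_superposition (f : C(E, F)) (hf : ContDiff ℝ ∞ f) :
    ContDiff ℝ ∞ (fun γ : C(K, E) => f.comp γ) :=
  contDiff_infty.2 fun n => contDiff_superposition_nat n f (contDiff_infty.1 hf n)

end Superposition

end SusyKundt

end

noncomputable section

open Filter Topology Set

universe u

namespace SusyKundt

/-! ### Completely integrable total differential equations -/

section TotalDifferential

open unitInterval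

variable {X Y : Type u} [NormedAddCommGroup X] [NormedSpace ℝ X]
  [NormedAddCommGroup Y] [NormedSpace ℝ Y]

theorem continuous_comp_projIcc {Y : Type*} [TopologicalSpace Y] (f : C(I, Y)) :
    Continuous fun s : ℝ => f (projIcc 0 1 zero_le_one s) :=
  f.continuous.comp continuous_projIcc

/-- The primitive `t ↦ ∫₀ᵗ f` of a continuous curve on the unit interval. -/
def primitive [CompleteSpace Y] : C(I, Y) →L[ℝ] C(I, Y) :=
  LinearMap.mkContinuous
    { toFun := fun f => ⟨fun t => ∫ s in (0 : ℝ)..t, f (projIcc 0 1 zero_le_one s),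
        (intervalIntegral.continuous_primitive
          (fun a b => (continuous_comp_projIcc f).intervalIntegrable a b) 0).comp
          continuous_subtype_val⟩
      map_add' := fun f g => by
        ext t
        exact intervalIntegral.integral_add ((continuous_comp_projIcc f).intervalIntegrable _ _)
          ((continuous_comp_projIcc g).intervalIntegrable _ _)
      map_smul' := fun c f => by
        ext t
        exact intervalIntegral.integral_smul c _ } 1
    (fun f => by
      rw [ContinuousMap.norm_le _ (by positivity), one_mul]
      intro t
      refine (intervalIntegral.norm_integral_le_of_norm_le_const
        (C := ‖f‖) fun s _ => f.norm_coe_le_norm _).trans ?_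
      have h1 : |(t : ℝ) - 0| ≤ 1 := by
        rw [sub_zero, abs_of_nonneg t.2.1]; exact t.2.2
      exact mul_le_of_le_one_right (norm_nonneg _) h1)

/-- The curve `t ↦ (t x, x, γ t)`. -/
def rayCurve : X × C(I, Y) →L[ℝ] C(I, X × X × Y) :=
  LinearMap.mkContinuous
    { toFun := fun w => ⟨fun t => ((t : ℝ) • w.1, w.1, w.2 t), by fun_prop⟩
      map_add' := fun w w' => by ext t <;> simp
      map_smul' := fun c w => by ext t <;> simp [smul_comm (t : ℝ) c] } 1
    (fun w => by
      rw [ContinuousMap.norm_le _ (by positivity), one_mul]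
      intro t
      simp only [LinearMap.coe_mk, AddHom.coe_mk, ContinuousMap.coe_mk]
      refine max_le ?_ (max_le (le_max_left _ _) ?_)
      · rw [norm_smul, Real.norm_of_nonneg t.2.1]
        exact (mul_le_of_le_one_left (norm_nonneg _) t.2.2).trans (le_max_left _ _)
      · exact (w.2.norm_coe_le_norm t).trans (le_max_right _ _))

@[simp] theorem rayCurve_apply (w : X × C(I, Y)) (t : I) :
    rayCurve w t = ((t : ℝ) • w.1, w.1, w.2 t) := rfl

/-- The speed `(x', x, y) ↦ a (x', y) x` of the solutions along rays. -/
def raySpeed (a : X × Y → X →L[ℝ] Y) (w : X × X × Y) : Y := a (w.1, w.2.2) w.2.1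

theorem contDiff_raySpeed {a : X × Y → X →L[ℝ] Y} (ha : ContDiff ℝ ∞ a) :
    ContDiff ℝ ∞ (raySpeed a) := by
  unfold raySpeed
  fun_prop

theorem hasFDerivAt_raySpeed {a : X × Y → X →L[ℝ] Y} (ha : ContDiff ℝ ∞ a) (w : X × X × Y) :
    HasFDerivAt (raySpeed a)
      ((a (w.1, w.2.2)).comp ((ContinuousLinearMap.fst ℝ X Y).comp
          (ContinuousLinearMap.snd ℝ X (X × Y))) +
        (((fderiv ℝ a (w.1, w.2.2)).comp
          ((ContinuousLinearMap.fst ℝ X (X × Y)).prod ((ContinuousLinearMap.snd ℝ X Y).comp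
            (ContinuousLinearMap.snd ℝ X (X × Y))))).flip w.2.1)) w := by
  have h1 : HasFDerivAt (fun w : X × X × Y => (w.1, w.2.2))
      ((ContinuousLinearMap.fst ℝ X (X × Y)).prod ((ContinuousLinearMap.snd ℝ X Y).comp
            (ContinuousLinearMap.snd ℝ X (X × Y)))) w :=
    ((ContinuousLinearMap.fst ℝ X (X × Y)).prod ((ContinuousLinearMap.snd ℝ X Y).comp
            (ContinuousLinearMap.snd ℝ X (X × Y)))).hasFDerivAt
  have h2 : HasFDerivAt (fun w : X × X × Y => w.2.1)
      ((ContinuousLinearMap.fst ℝ X Y).comp (ContinuousLinearMap.snd ℝ X (X × Y))) w :=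
    ((ContinuousLinearMap.fst ℝ X Y).comp (ContinuousLinearMap.snd ℝ X (X × Y))).hasFDerivAt
  have h3 : HasFDerivAt a (fderiv ℝ a (w.1, w.2.2)) (w.1, w.2.2) :=
    (ha.differentiable (by simp) _).hasFDerivAt
  exact (h3.comp w h1).clm_apply h2

/-- Along a ray, the derivative of the solution in a transverse direction is the prescribed one. -/
theorem eq_of_linearized_ray {a : X × Y → X →L[ℝ] Y} (ha : ContDiff ℝ ∞ a) {x ξ : X}
    {γ δ : ℝ → Y}
    (hγ : ∀ t ∈ Icc (0 : ℝ) 1, HasDerivAt γ (a (t • x, γ t) x) t)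
    (hδ0 : δ 0 = 0)
    (hδ : ∀ t ∈ Icc (0 : ℝ) 1,
      HasDerivAt δ (a (t • x, γ t) ξ + fderiv ℝ a (t • x, γ t) (t • ξ, δ t) x) t)
    (hint : ∀ t ∈ Icc (0 : ℝ) 1, fderiv ℝ a (t • x, γ t) (x, a (t • x, γ t) x) ξ =
      fderiv ℝ a (t • x, γ t) (ξ, a (t • x, γ t) ξ) x) :
    δ 1 = a (x, γ 1) ξ := by
  -- Integrability makes the defect `e` solve a homogeneous linear equation with zero initial value,
  -- so Grönwall's inequality forces it to vanish.
  let e : ℝ → Y := fun t => δ t - t • a (t • x, γ t) ξ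
  have hγc : ContinuousOn γ (Icc 0 1) := fun t ht => (hγ t ht).continuousAt.continuousWithinAt
  have hpt : ContinuousOn (fun t : ℝ => (t • x, γ t)) (Icc 0 1) :=
    (by fun_prop : Continuous fun t : ℝ => t • x).continuousOn.prodMk hγc
  have hda : Continuous (fderiv ℝ a) := ha.continuous_fderiv (by simp)
  have hcD : ContinuousOn (fun t : ℝ => ‖fderiv ℝ a (t • x, γ t)‖) (Icc 0 1) :=
    ((continuous_norm (E := X × Y →L[ℝ] X →L[ℝ] Y)).comp hda).comp_continuousOn hpt
  obtain ⟨C, hC⟩ := isCompact_Icc.exists_bound_of_continuousOn hcD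
  have he : ∀ t ∈ Icc (0 : ℝ) 1, HasDerivAt e (fderiv ℝ a (t • x, γ t) (0, e t) x) t := by
    intro t ht
    have h1 : HasDerivAt (fun t : ℝ => (t • x, γ t)) (x, a (t • x, γ t) x) t := by
      have := (hasDerivAt_id t).smul_const x
      simp only [one_smul, id] at this
      exact this.prodMk (hγ t ht)
    have h2 : HasDerivAt (fun t : ℝ => a (t • x, γ t))
        (fderiv ℝ a (t • x, γ t) (x, a (t • x, γ t) x)) t :=
      (ha.differentiable (by simp) (t • x, γ t)).hasFDerivAt.comp_hasDerivAt t h1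
    have h3 : HasDerivAt (fun t : ℝ => a (t • x, γ t) ξ)
        (fderiv ℝ a (t • x, γ t) (x, a (t • x, γ t) x) ξ) t := by
      simpa using h2.clm_apply (hasDerivAt_const t ξ)
    have h4 := (hδ t ht).sub ((hasDerivAt_id t).smul h3)
    refine HasDerivAt.congr_deriv (f := e) h4 ?_
    simp only [id, one_smul, hint t ht]
    have h5 : ((t • ξ, δ t) : X × Y) = (0, e t) + t • (ξ, a (t • x, γ t) ξ) := by
      ext <;> simp [e]
    rw [h5, map_add, map_smul]
    simp only [add_apply, smul_apply]
    abel
  have hz := eq_zero_of_abs_deriv_le_mul_abs_self_of_eq_zero_right (f := e)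
    (K := C * ‖x‖) (a := 0) (b := 1)
    (fun t ht => (he t ht).continuousAt.continuousWithinAt)
    (fun t ht => (he t (Ico_subset_Icc_self ht)).hasDerivWithinAt) (by simp [e, hδ0])
    (fun t ht => by
      have h1 : ‖fderiv ℝ a (t • x, γ t)‖ ≤ C :=
        (le_abs_self _).trans (hC t (Ico_subset_Icc_self ht))
      have hC0 : 0 ≤ C := (norm_nonneg (fderiv ℝ a (t • x, γ t))).trans h1
      calc ‖fderiv ℝ a (t • x, γ t) (0, e t) x‖
          ≤ ‖fderiv ℝ a (t • x, γ t) (0, e t)‖ * ‖x‖ := ContinuousLinearMap.le_opNorm _ _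
        _ ≤ (‖fderiv ℝ a (t • x, γ t)‖ * ‖((0, e t) : X × Y)‖) * ‖x‖ := by
            gcongr; exact ContinuousLinearMap.le_opNorm _ _
        _ ≤ (C * ‖e t‖) * ‖x‖ := by
            gcongr
            simp [Prod.norm_mk]
        _ = C * ‖x‖ * ‖e t‖ := by ring) 1 (by simp)
  have : δ 1 - (1 : ℝ) • a ((1 : ℝ) • x, γ 1) ξ = 0 := hz
  simpa [sub_eq_zero] using this

/-- The constant curves. -/
def constCurve : Y →L[ℝ] C(I, Y) :=
  LinearMap.mkContinuous
    { toFun := fun y => ContinuousMap.const I y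
      map_add' := fun _ _ => rfl
      map_smul' := fun _ _ => rfl } 1
    (fun y => by
      rw [ContinuousMap.norm_le _ (by positivity), one_mul]
      intro t
      rfl)

@[simp] theorem constCurve_apply (y : Y) (t : I) : constCurve y t = y := rfl

/-- The right-hand side of the integral equation for the solutions along rays. -/
def rayIntegral [CompleteSpace Y] (A : C(X × X × Y, Y)) (w : (X × Y) × C(I, Y)) : C(I, Y) :=
  constCurve w.1.2 + primitive (A.comp (rayCurve (w.1.1, w.2)))

theorem contDiff_rayIntegral [CompleteSpace Y] {A : C(X × X × Y, Y)} (hA : ContDiff ℝ ∞ A) :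
    ContDiff ℝ ∞ (rayIntegral A) := by
  unfold rayIntegral
  have h1 : ContDiff ℝ ∞ (fun w : (X × Y) × C(I, Y) => A.comp (rayCurve (w.1.1, w.2))) :=
    (contDiff_superposition A hA).comp
      ((rayCurve (X := X) (Y := Y)).contDiff.comp (contDiff_fst.fst.prodMk contDiff_snd))
  exact (constCurve.contDiff.comp contDiff_fst.snd).add (primitive.contDiff.comp h1)

theorem hasDerivAt_integral_projIcc [CompleteSpace Y] (f : C(I, Y)) (t : ℝ) :
    HasDerivAt (fun t : ℝ => ∫ s in (0 : ℝ)..t, f (projIcc 0 1 zero_le_one s))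
      (f (projIcc 0 1 zero_le_one t)) t :=
  ((continuous_comp_projIcc f).integral_hasStrictDerivAt 0 t).hasDerivAt

/-- Restricted to rays `t ↦ t • x`, the system is an ordinary equation on the unit interval with
parameters `(x, y)`. The implicit function theorem in `C(I, Y)` gives a solution depending smoothly
on them, and its value at `t = 1` is `Φ`. Integrability upgrades the radial equation to all
directions by `eq_of_linearized_ray`. -/
theorem exists_solution_of_contDiff [CompleteSpace X] [CompleteSpace Y]
    {a : X × Y → X →L[ℝ] Y} {y₀ : Y} (ha : ContDiff ℝ ∞ a)
    (hint : ∀ᶠ z in 𝓝 ((0, y₀) : X × Y), ∀ ξ η,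
      fderiv ℝ a z (η, a z η) ξ = fderiv ℝ a z (ξ, a z ξ) η) :
    ∃ Φ : X × Y → Y, SmoothNear Φ (0, y₀) ∧ (∀ᶠ y in 𝓝 y₀, Φ (0, y) = y) ∧
      ∀ᶠ z in 𝓝 ((0, y₀) : X × Y), ∀ ξ, fderiv ℝ Φ z (ξ, 0) = a (z.1, Φ z) ξ := by
  have hA := contDiff_raySpeed ha
  let A : C(X × X × Y, Y) := ⟨raySpeed a, hA.continuous⟩
  let A' : C(X × X × Y, X × X × Y →L[ℝ] Y) :=
    ⟨fderiv ℝ (raySpeed a), hA.continuous_fderiv (by simp)⟩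
  let N : (X × Y) × C(I, Y) → C(I, Y) := fun w => w.2 - rayIntegral A w
  have hN : ContDiff ℝ ∞ N := contDiff_snd.sub (contDiff_rayIntegral hA)
  have hzero : ∀ (y : Y) (γ : C(I, Y)), rayIntegral A ((0, y), γ) = constCurve y := by
    intro y γ
    have : A.comp (rayCurve ((0 : X), γ)) = 0 := by
      ext t
      simp [A, raySpeed]
    simp [rayIntegral, this]
  -- At `x = 0` the speed vanishes and the integral equation reads `γ = const y`, so its
  -- linearization in `γ` is the identity.
  have he : ∀ h, fderiv ℝ N ((0, y₀), constCurve y₀) (0, h)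
      = ContinuousLinearEquiv.refl ℝ C(I, Y) h := by
    intro h
    have h1 := ((hN.differentiable (by simp)
      ((0, y₀), constCurve y₀)).hasFDerivAt).comp (constCurve y₀)
      (hasFDerivAt_prodMk_right ((0, y₀) : X × Y) (constCurve y₀ : C(I, Y)))
    have h2 : HasFDerivAt (N ∘ fun γ => (((0, y₀) : X × Y), γ))
        (ContinuousLinearMap.id ℝ C(I, Y)) (constCurve y₀) := by
      have : (N ∘ fun γ => (((0, y₀) : X × Y), γ)) = fun γ => γ - constCurve y₀ := by
        ext γ : 1
        simp [N, hzero]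
      rw [this]
      exact (hasFDerivAt_id _).sub_const _
    have h3 := congrArg (fun T => T h) (h1.unique h2)
    simpa using h3
  obtain ⟨γ, hγ, hγ0, hsol⟩ := (ContDiff.smoothNear hN _).exists_implicit
    (by simp [N, hzero]) (ContinuousLinearEquiv.refl ℝ C(I, Y)) he
  have hsol' : ∀ᶠ p in 𝓝 ((0, y₀) : X × Y), γ p = rayIntegral A (p, γ p) := by
    filter_upwards [hsol] with p hp
    exact sub_eq_zero.1 hp
  let ev : C(I, Y) →L[ℝ] Y := ContinuousMap.evalCLM ℝ (1 : I)
  refine ⟨fun p => γ p 1, ?_, ?_, ?_⟩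
  · exact (ContDiff.smoothNear ev.contDiff _).comp hγ
  · have : Tendsto (fun y : Y => ((0 : X), y)) (𝓝 y₀) (𝓝 (0, y₀)) :=
      (Continuous.prodMk_right (0 : X)).continuousAt
    filter_upwards [this.eventually hsol'] with y hy
    rw [hy, hzero]
    rfl
  -- Integrability is known only near `(0, y₀)`; for small parameters the whole curve stays within
  -- `r` of it.
  · obtain ⟨r, hr, hball⟩ := Metric.eventually_nhds_iff_ball.1 hint
    have hnear : ∀ᶠ p in 𝓝 ((0, y₀) : X × Y), γ p ∈ Metric.ball (constCurve y₀) r := by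
      have := hγ.continuousAt.eventually (Metric.ball_mem_nhds (γ (0, y₀)) hr)
      rwa [hγ0] at this
    have hx : ∀ᶠ p in 𝓝 ((0, y₀) : X × Y), p.1 ∈ Metric.ball (0 : X) r :=
      continuous_fst.continuousAt.eventually (Metric.ball_mem_nhds _ hr)
    filter_upwards [hnear, hx, hγ, eventually_eventually_nhds.2 hsol'] with p hpγ hpx hsm hpsol ξ
    have hdγ : HasFDerivAt γ (fderiv ℝ γ p) p := (hsm.differentiableAt (by simp)).hasFDerivAt
    set δ : C(I, Y) := fderiv ℝ γ p (ξ, 0) with hδdef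
    have hΦ : fderiv ℝ (fun p => γ p 1) p (ξ, 0) = δ 1 := by
      have h1 : HasFDerivAt (fun p => γ p 1) (ev.comp (fderiv ℝ γ p)) p :=
        ev.hasFDerivAt.comp p hdγ
      rw [h1.fderiv]
      rfl
    rw [hΦ]
    -- the linearized integral equation
    have hlin : δ = primitive (pointwiseApply I (X × X × Y) Y
        (A'.comp (rayCurve (p.1, γ p))) (rayCurve (ξ, δ))) := by
      have h1 : HasFDerivAt (fun q : X × Y => rayCurve (q.1, γ q))
          ((rayCurve : X × C(I, Y) →L[ℝ] C(I, X × X × Y)).comp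
            ((ContinuousLinearMap.fst ℝ X Y).prod (fderiv ℝ γ p))) p :=
        (rayCurve (X := X) (Y := Y)).hasFDerivAt.comp p (hasFDerivAt_fst.prodMk hdγ)
      have h2 := (hasFDerivAt_superposition (f := A) (f' := A')
        (fun w => (hA.differentiable (by simp) w).hasFDerivAt)
        (rayCurve (p.1, γ p))).comp p h1
      have h3 : HasFDerivAt (fun q : X × Y => rayIntegral A (q, γ q)) _ p :=
        (constCurve.hasFDerivAt.comp p hasFDerivAt_snd).add (primitive.hasFDerivAt.comp p h2)
      have h4 := h3.congr_of_eventuallyEq hpsol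
      have h5 := congrArg (fun T => T (ξ, 0)) (hdγ.unique h4)
      simpa using h5
    let f₁ : C(I, Y) := A.comp (rayCurve (p.1, γ p))
    let f₂ : C(I, Y) := pointwiseApply I (X × X × Y) Y
        (A'.comp (rayCurve (p.1, γ p))) (rayCurve (ξ, δ))
    -- Extending both curves to all of `ℝ` through `projIcc` gives two-sided derivatives at the ends
    -- of the unit interval.
    let γ' : ℝ → Y := fun t => p.2 + ∫ s in (0 : ℝ)..t, f₁ (projIcc 0 1 zero_le_one s)
    let δ' : ℝ → Y := fun t => ∫ s in (0 : ℝ)..t, f₂ (projIcc 0 1 zero_le_one s)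
    have hγ' : ∀ t (ht : t ∈ Icc (0 : ℝ) 1), γ' t = γ p ⟨t, ht⟩ := by
      intro t ht
      rw [hpsol.self_of_nhds]
      rfl
    have hδ' : ∀ t (ht : t ∈ Icc (0 : ℝ) 1), δ' t = δ ⟨t, ht⟩ := by
      intro t ht
      rw [hlin]
      rfl
    have key := eq_of_linearized_ray ha (x := p.1) (ξ := ξ) (γ := γ') (δ := δ')
      (fun t ht => by
        have h1 := (hasDerivAt_integral_projIcc f₁ t).const_add p.2
        rw [projIcc_of_mem zero_le_one ht] at h1
        rw [hγ' t ht]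
        exact h1)
      (by simp [δ'])
      (fun t ht => by
        have h1 := hasDerivAt_integral_projIcc f₂ t
        rw [projIcc_of_mem zero_le_one ht] at h1
        rw [hγ' t ht, hδ' t ht]
        convert h1 using 1
        simp [f₂, A', (hasFDerivAt_raySpeed ha _).fderiv])
      (fun t ht => by
        refine hball _ ?_ _ _
        rw [hγ' t ht, ← ball_prod_same]
        refine ⟨?_, ?_⟩
        · rw [mem_ball_zero_iff] at hpx ⊢
          refine lt_of_le_of_lt ?_ hpx
          rw [norm_smul, Real.norm_of_nonneg ht.1]
          exact mul_le_of_le_one_left (norm_nonneg _) ht.2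
        · exact lt_of_le_of_lt
            (ContinuousMap.dist_apply_le_dist (f := γ p) (g := constCurve y₀) ⟨t, ht⟩) hpγ)
    have e1 := hγ' 1 (by simp)
    have e2 := hδ' 1 (by simp)
    rw [e1, e2] at key
    exact key

/-- Only the germ of `a` at `(0, y₀)` matters: a globally smooth extension has the same derivative
there, and the solution stays where the two agree. -/
theorem exists_solution_of_smoothNear [FiniteDimensional ℝ X] [FiniteDimensional ℝ Y]
    {a : X × Y → X →L[ℝ] Y} {y₀ : Y} (ha : SmoothNear a (0, y₀))
    (hint : ∀ᶠ z in 𝓝 ((0, y₀) : X × Y), ∀ ξ η,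
      fderiv ℝ a z (η, a z η) ξ = fderiv ℝ a z (ξ, a z ξ) η) :
    ∃ Φ : X × Y → Y, SmoothNear Φ (0, y₀) ∧ (∀ᶠ y in 𝓝 y₀, Φ (0, y) = y) ∧
      ∀ᶠ z in 𝓝 ((0, y₀) : X × Y), ∀ ξ, fderiv ℝ Φ z (ξ, 0) = a (z.1, Φ z) ξ := by
  have : CompleteSpace X := FiniteDimensional.complete ℝ X
  have : CompleteSpace Y := FiniteDimensional.complete ℝ Y
  obtain ⟨b, hb, hba⟩ := ha.exists_contDiff
  obtain ⟨Φ, hΦ, h0, hd⟩ := exists_solution_of_contDiff (y₀ := y₀) hb (by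
    filter_upwards [hint, eventually_eventually_nhds.2 hba] with z hz hbz
    intro ξ η
    have h1 : fderiv ℝ b z = fderiv ℝ a z := Filter.EventuallyEq.fderiv_eq hbz
    rw [h1, hbz.self_of_nhds]
    exact hz ξ η)
  refine ⟨Φ, hΦ, h0, ?_⟩
  have ht : Tendsto (fun z : X × Y => (z.1, Φ z)) (𝓝 (0, y₀)) (𝓝 (0, y₀)) := by
    have h1 := (continuous_fst.continuousAt (x := ((0 : X), y₀))).prodMk hΦ.continuousAt
    have h2 := h1.tendsto
    rwa [h0.self_of_nhds] at h2
  filter_upwards [hd, ht.eventually hba] with z hz hbz ξ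
  rw [hz ξ, hbz]

/-- Existence and smooth dependence on the initial value for a completely integrable total
differential equation `D_x Φ = a(x, Φ)`, `Φ(x₀, y) = y`. -/
theorem exists_solution_totalDifferential [FiniteDimensional ℝ X] [FiniteDimensional ℝ Y]
    {a : X × Y → X →L[ℝ] Y} {x₀ : X} {y₀ : Y} (ha : SmoothNear a (x₀, y₀))
    (hint : ∀ᶠ z in 𝓝 ((x₀, y₀) : X × Y), ∀ ξ η,
      fderiv ℝ a z (η, a z η) ξ = fderiv ℝ a z (ξ, a z ξ) η) :
    ∃ Φ : X × Y → Y, SmoothNear Φ (x₀, y₀) ∧ (∀ᶠ y in 𝓝 y₀, Φ (x₀, y) = y) ∧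
      ∀ᶠ z in 𝓝 ((x₀, y₀) : X × Y), ∀ ξ, fderiv ℝ Φ z (ξ, 0) = a (z.1, Φ z) ξ := by
  have hto : Tendsto (fun z : X × Y => z + (x₀, 0)) (𝓝 (0, y₀)) (𝓝 (x₀, y₀)) := by
    have h1 : ContinuousAt (fun z : X × Y => z + (x₀, 0)) (0, y₀) := by fun_prop
    simpa using h1.tendsto
  have hback : Tendsto (fun z : X × Y => z - (x₀, 0)) (𝓝 (x₀, y₀)) (𝓝 (0, y₀)) := by
    have h1 : ContinuousAt (fun z : X × Y => z - (x₀, 0)) (x₀, y₀) := by fun_prop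
    simpa using h1.tendsto
  obtain ⟨Φ, hΦ, h0, hd⟩ := exists_solution_of_smoothNear (a := fun z => a (z + (x₀, 0)))
    (y₀ := y₀) (SmoothNear.comp (g := a) (by simpa using ha)
      (ContDiff.smoothNear (contDiff_id.add contDiff_const) _)) (by
      filter_upwards [hto.eventually hint] with z hz ξ η
      rw [fderiv_comp_add_right]
      exact hz ξ η)
  refine ⟨fun z => Φ (z - (x₀, 0)), ?_, ?_, ?_⟩
  · exact SmoothNear.comp (g := Φ) (by simpa using hΦ)
      (ContDiff.smoothNear (contDiff_id.sub contDiff_const) _)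
  · filter_upwards [h0] with y hy
    simpa using hy
  · filter_upwards [hback.eventually hd] with z hz ξ
    rw [fderiv_comp_sub, hz ξ]
    simp

end TotalDifferential

end SusyKundt

end

noncomputable section

open Filter Topology Set

namespace SusyKundt

/-! ### Forms that are closed on the leaves of an integrable hyperplane distribution -/

section Leaves

variable {E : Type} [NormedAddCommGroup E] [NormedSpace ℝ E]

/-- The exterior derivative of a one-form. -/
def extD (κ : E → E →L[ℝ] ℝ) (x v w : E) : ℝ := fderiv ℝ κ x v w - fderiv ℝ κ x w v

theorem fderiv_clm_apply_const {F G : Type*} [NormedAddCommGroup F] [NormedSpace ℝ F]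
    [NormedAddCommGroup G] [NormedSpace ℝ G] {A : E → F →L[ℝ] G} {x : E}
    (hA : DifferentiableAt ℝ A x) (c : F) (v : E) :
    fderiv ℝ (fun z => A z c) x v = fderiv ℝ A x v c := by
  have := (hA.hasFDerivAt.clm_apply (hasFDerivAt_const c x)).fderiv
  rw [this]
  simp

theorem fderiv_smul_form {f : E → ℝ} {κ : E → E →L[ℝ] ℝ} {x : E} (hf : DifferentiableAt ℝ f x)
    (hκ : DifferentiableAt ℝ κ x) (v w : E) :
    fderiv ℝ (fun z => f z • κ z) x v w = fderiv ℝ f x v * κ x w + f x * fderiv ℝ κ x v w := by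
  have := (hf.hasFDerivAt.smul hκ.hasFDerivAt).fderiv
  rw [show (fun z => f z • κ z) = f • κ from rfl, this]
  simp
  ring

theorem SmoothNear.mul {f g : E → ℝ} {x : E} (hf : SmoothNear f x) (hg : SmoothNear g x) :
    SmoothNear (fun z => f z * g z) x := by
  filter_upwards [hf, hg] with z h1 h2 using h1.mul h2

theorem SmoothNear.smul {F : Type*} [NormedAddCommGroup F] [NormedSpace ℝ F]
    {f : E → ℝ} {g : E → F} {x : E} (hf : SmoothNear f x) (hg : SmoothNear g x) :
    SmoothNear (fun z => f z • g z) x := by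
  filter_upwards [hf, hg] with z h1 h2 using h1.smul h2

theorem SmoothNear.sub {F : Type*} [NormedAddCommGroup F] [NormedSpace ℝ F]
    {f g : E → F} {x : E} (hf : SmoothNear f x) (hg : SmoothNear g x) :
    SmoothNear (fun z => f z - g z) x := by
  filter_upwards [hf, hg] with z h1 h2 using h1.sub h2

theorem SmoothNear.inv {f : E → ℝ} {x : E} (hf : SmoothNear f x) (h0 : f x ≠ 0) :
    SmoothNear (fun z => (f z)⁻¹) x := by
  filter_upwards [hf, hf.continuousAt.eventually_ne h0] with z h1 h2 using h1.inv h2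

theorem smoothNear_const {F : Type*} [NormedAddCommGroup F] [NormedSpace ℝ F] (c : F) (x : E) :
    SmoothNear (fun _ : E => c) x := ContDiff.smoothNear contDiff_const x

/-- Let `κ` define an integrable hyperplane distribution and let `μ` be closed on its leaves.
Then locally `κ` is a positive multiple of some `du`, and `μ` is some `dG` up to a multiple
of `κ`. -/
theorem exists_leaf_primitive [FiniteDimensional ℝ E] {κ μ : E → E →L[ℝ] ℝ} {p : E}
    (hκ : SmoothNear κ p) (hμ : SmoothNear μ p) (h0 : κ p ≠ 0)
    (hdκ : ∀ᶠ x in 𝓝 p, ∀ v w, κ x v = 0 → κ x w = 0 → extD κ x v w = 0)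
    (hdμ : ∀ᶠ x in 𝓝 p, ∀ v w, κ x v = 0 → κ x w = 0 → extD μ x v w = 0) :
    ∃ u G : E → ℝ, SmoothNear u p ∧ SmoothNear G p ∧
      (∀ᶠ x in 𝓝 p, ∃ h : ℝ, 0 < h ∧ κ x = h • fderiv ℝ u x) ∧
      ∀ᶠ x in 𝓝 p, ∃ f : ℝ, fderiv ℝ G x = μ x + f • κ x := by
  have : CompleteSpace E := FiniteDimensional.complete ℝ E
  obtain ⟨e, he⟩ : ∃ e, κ p e = 1 := by
    obtain ⟨v, hv⟩ : ∃ v, κ p v ≠ 0 := by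
      by_contra! h
      exact h0 (ContinuousLinearMap.ext h)
    exact ⟨(κ p v)⁻¹ • v, by simp [hv]⟩
  have hκe : SmoothNear (fun z => κ z e) p := hκ.clm_apply (smoothNear_const e p)
  have hμe : SmoothNear (fun z => μ z e) p := hμ.clm_apply (smoothNear_const e p)
  have hpos : ∀ᶠ z in 𝓝 p, 0 < κ z e :=
    hκe.continuousAt.eventually (lt_mem_nhds (by simp [he]))
  -- Normalized so that `ν e = 1` and `ρ e = 0`: `ν` has the same kernel as `κ`, and `ρ` agrees with
  -- `μ` on it.
  let ν : E → E →L[ℝ] ℝ := fun z => (κ z e)⁻¹ • κ z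
  let ρ : E → E →L[ℝ] ℝ := fun z => μ z - μ z e • ν z
  have hν : SmoothNear ν p := (hκe.inv (by rw [he]; norm_num)).smul hκ
  have hρ : SmoothNear ρ p := hμ.sub (hμe.smul hν)
  -- The total differential equation describes a leaf as a graph in the direction `e`: the first
  -- unknown is the height, with slope `-ν`, and the second is the integral of `μ` along the leaf.
  let A : E → E →L[ℝ] ℝ × ℝ := fun z =>
    (ContinuousLinearMap.inl ℝ ℝ ℝ).comp (-ν z) + (ContinuousLinearMap.inr ℝ ℝ ℝ).comp (ρ z)
  have hA : SmoothNear A p := by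
    filter_upwards [hν, hρ] with z h1 h2
    exact (contDiffAt_const.clm_comp h1.neg).add (contDiffAt_const.clm_comp h2)
  have hAapp : ∀ z w, A z w = (-ν z w, ρ z w) := fun z w => by simp [A]
  -- `A` takes the constant value `(-1, 0)` on `e`, so its derivatives vanish on `e`. This allows
  -- any vector to be replaced below by its projection to the kernel of `κ` along `e`.
  have hAe : ∀ᶠ z in 𝓝 p, ∀ v, fderiv ℝ A z v e = 0 := by
    filter_upwards [hA, eventually_eventually_nhds.2 hpos] with z hz hpz v
    have h1 : (fun z => A z e) =ᶠ[𝓝 z] fun _ => ((-1, 0) : ℝ × ℝ) := by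
      filter_upwards [hpz] with y hy
      have h2 : ν y e = 1 := by simp [ν, hy.ne']
      rw [hAapp, h2]
      simp [ρ, h2]
    rw [← fderiv_clm_apply_const (hz.differentiableAt (by simp)), h1.fderiv_eq]
    simp
  have hAker : ∀ᶠ z in 𝓝 p, ∀ v w, κ z v = 0 → κ z w = 0 →
      fderiv ℝ A z v w = fderiv ℝ A z w v := by
    filter_upwards [hA, hν, hρ, hκ, hμ, hκe, hμe, eventually_eventually_nhds.2 hpos, hdκ, hdμ]
      with z hAz hνz hρz hκz hμz hκez hμez hpz hdκz hdμz v w hv hw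
    have d : ∀ {F : Type} [NormedAddCommGroup F] [NormedSpace ℝ F] {f : E → F},
      ContDiffAt ℝ ∞ f z → DifferentiableAt ℝ f z := fun h => h.differentiableAt (by simp)
    have hcomp : ∀ v w, fderiv ℝ A z v w = (-fderiv ℝ ν z v w, fderiv ℝ ρ z v w) := by
      intro v w
      rw [← fderiv_clm_apply_const (d hAz), ← fderiv_clm_apply_const (d hνz),
        ← fderiv_clm_apply_const (d hρz)]
      have h1 : DifferentiableAt ℝ (fun z => ν z w) z := (d hνz).clm_apply (by fun_prop)
      have h2 : DifferentiableAt ℝ (fun z => ρ z w) z := (d hρz).clm_apply (by fun_prop)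
      have h3 := (h1.hasFDerivAt.neg.prodMk h2.hasFDerivAt).fderiv
      have h4 : (fun z => A z w) = fun z => (-ν z w, ρ z w) := funext fun z => hAapp z w
      rw [h4]
      exact congrArg (fun T => T v) h3
    have hκν : κ =ᶠ[𝓝 z] fun y => κ y e • ν y := by
      filter_upwards [hpz] with y hy
      simp [ν, smul_smul, hy.ne']
    have hμρ : μ = fun y => ρ y + μ y e • ν y := by
      ext y w
      simp [ρ]
    have hz0 : ∀ w, κ z w = 0 → ν z w = 0 := fun w hw => by simp [ν, hw]
    have hκ' : ∀ v w, κ z w = 0 → fderiv ℝ κ z v w = κ z e * fderiv ℝ ν z v w := by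
      intro v w hw
      rw [hκν.fderiv_eq, fderiv_smul_form (d hκez) (d hνz), hz0 w hw, mul_zero, zero_add]
    have hμ' : ∀ v w, κ z w = 0 →
        fderiv ℝ μ z v w = fderiv ℝ ρ z v w + μ z e * fderiv ℝ ν z v w := by
      intro v w hw
      have h1 : fderiv ℝ μ z = fderiv ℝ ρ z + fderiv ℝ (fun y => μ y e • ν y) z := by
        conv_lhs => rw [hμρ]
        exact fderiv_add (d hρz) ((d hμez).smul (d hνz))
      rw [h1, add_apply, add_apply, fderiv_smul_form (d hμez) (d hνz), hz0 w hw, mul_zero,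
        zero_add]
    have e1 := hdκz v w hv hw
    have e2 := hdμz v w hv hw
    have hne := hpz.self_of_nhds.ne'
    rw [extD, hκ' v w hw, hκ' w v hv, ← mul_sub] at e1
    have e3 := (mul_eq_zero.1 e1).resolve_left hne
    rw [extD, hμ' v w hw, hμ' w v hv] at e2
    rw [hcomp, hcomp]
    ext
    · simp only; linarith
    · simp only
      have : fderiv ℝ ν z v w = fderiv ℝ ν z w v := by linarith
      rw [this] at e2
      linarith
  -- `Q` sends a base point and a height to the point of the leaf above it.
  let Q : E × (ℝ × ℝ) →L[ℝ] E := ContinuousLinearMap.fst ℝ E (ℝ × ℝ) +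
    (ContinuousLinearMap.toSpanSingleton ℝ e).comp
      ((ContinuousLinearMap.fst ℝ ℝ ℝ).comp (ContinuousLinearMap.snd ℝ E (ℝ × ℝ)))
  have hQ : ∀ w, Q w = w.1 + w.2.1 • e := fun w => by simp [Q]
  have hQp : Q (p, 0) = p := by simp [hQ]
  have hQt : Tendsto Q (𝓝 (p, 0)) (𝓝 p) := by
    have := Q.continuous.continuousAt (x := (p, 0)).tendsto
    rwa [hQp] at this
  obtain ⟨Φ, hΦ, hΦ0, hΦd⟩ := exists_solution_totalDifferential (a := fun w => A (Q w))
    (x₀ := p) (y₀ := (0 : ℝ × ℝ))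
    (SmoothNear.comp (g := A) (by rwa [hQp]) (ContDiff.smoothNear Q.contDiff _)) (by
      filter_upwards [hQt.eventually hAe, hQt.eventually hAker, hQt.eventually hA,
        hQt.eventually hpos] with w he' hker hAw hpw ξ η
      have h1 : fderiv ℝ (fun w => A (Q w)) w = (fderiv ℝ A (Q w)).comp Q :=
        ((hAw.differentiableAt (by simp)).hasFDerivAt.comp w Q.hasFDerivAt).fderiv
      have h2 : ∀ η, Q (η, A (Q w) η) = η - ν (Q w) η • e := fun η => by
        rw [hQ, hAapp]; simp [sub_eq_add_neg]
      have h3 : ∀ η, κ (Q w) (η - ν (Q w) η • e) = 0 := fun η => by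
        simp only [ν, map_sub, map_smul, smul_apply, smul_eq_mul]
        field_simp
        ring
      have h4 : ∀ v ξ, fderiv ℝ A (Q w) v (ξ - ν (Q w) ξ • e) = fderiv ℝ A (Q w) v ξ := by
        intro v ξ
        rw [map_sub, map_smul, he' v, smul_zero, sub_zero]
      rw [h1, ContinuousLinearMap.comp_apply, ContinuousLinearMap.comp_apply, h2, h2,
        ← h4 _ ξ, ← h4 _ η]
      exact hker _ _ (h3 _) (h3 _))
  -- the leaf through `x` is labelled by the point where it meets the line `p + ℝ e`
  let ι : E × ℝ →L[ℝ] E × (ℝ × ℝ) := (ContinuousLinearMap.fst ℝ E ℝ).prod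
    ((ContinuousLinearMap.inl ℝ ℝ ℝ).comp (ContinuousLinearMap.snd ℝ E ℝ))
  have hι : ∀ w, ι w = (w.1, (w.2, 0)) := fun w => by simp [ι]
  have hι0 : ι (p, 0) = (p, 0) := by simp [hι]
  have hN : SmoothNear (fun w => (Φ (ι w)).1) (p, 0) := by
    have h1 : SmoothNear (fun w => Φ (ι w)) (p, 0) :=
      SmoothNear.comp (g := Φ) (by rwa [hι0]) (ContDiff.smoothNear ι.contDiff _)
    exact SmoothNear.comp (g := Prod.fst) (ContDiff.smoothNear contDiff_fst _) h1
  have hΦc : ∀ c : ℝ × ℝ, fderiv ℝ Φ (p, 0) (0, c) = c := by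
    intro c
    have h1 := hΦ.differentiableAt.hasFDerivAt.comp (0 : ℝ × ℝ)
      (hasFDerivAt_prodMk_right p (0 : ℝ × ℝ))
    have h2 : (Φ ∘ fun y => (p, y)) =ᶠ[𝓝 0] id := hΦ0
    have h3 := h1.unique ((hasFDerivAt_id (𝕜 := ℝ) (0 : ℝ × ℝ)).congr_of_eventuallyEq h2)
    simpa using congrArg (fun T => T c) h3
  obtain ⟨u, hu, hu0, hsol⟩ := hN.exists_implicit (p := p) (z := (0 : ℝ))
    (by rw [hι0, hΦ0.self_of_nhds]; rfl) (ContinuousLinearEquiv.refl ℝ ℝ) (by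
      intro h
      have h1 : HasFDerivAt Φ (fderiv ℝ Φ (p, 0)) (ι (p, 0)) := by
        rw [hι0]; exact hΦ.differentiableAt.hasFDerivAt
      have h2 := (hasFDerivAt_fst.comp (p, (0 : ℝ)) (h1.comp (p, (0 : ℝ)) ι.hasFDerivAt)).fderiv
      have h3 : fderiv ℝ (fun w => (Φ (ι w)).1) (p, 0) = _ := h2
      rw [h3]
      simp [hι, hΦc])
  let σ : E → E × (ℝ × ℝ) := fun x => (x, (u x, 0))
  have hσ : SmoothNear σ p := (ContDiff.smoothNear contDiff_id p).prodMk
    (hu.prodMk (smoothNear_const 0 p))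
  have hσp : σ p = (p, 0) := by simp [σ, hu0]
  have hσt : Tendsto σ (𝓝 p) (𝓝 (p, 0)) := by
    have := hσ.continuousAt.tendsto
    rwa [hσp] at this
  have hG : SmoothNear (fun x => (Φ (σ x)).2) p := by
    have h1 : SmoothNear (fun x => Φ (σ x)) p := SmoothNear.comp (g := Φ) (by rwa [hσp]) hσ
    exact SmoothNear.comp (g := Prod.snd) (ContDiff.smoothNear contDiff_snd _) h1
  -- Derivative of the solution in the leaf label. Differentiating the equation that defines `u`
  -- gives `ν = j.1 • du`; the second component gives `dG = ρ + j.2 • du`.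
  let j : E → ℝ × ℝ := fun x => fderiv ℝ Φ (σ x) (0, (1, 0))
  have hj : ∀ᶠ x in 𝓝 p, 0 < (j x).1 := by
    have h1 : ContinuousAt (fun w => (fderiv ℝ Φ w (0, (1, 0))).1) (p, (0 : ℝ × ℝ)) :=
      (hΦ.fderiv.clm_apply (smoothNear_const _ _)).continuousAt.fst
    have h2 : ∀ᶠ w in 𝓝 (p, (0 : ℝ × ℝ)), 0 < (fderiv ℝ Φ w (0, (1, 0))).1 :=
      h1.eventually (lt_mem_nhds (by simp [hΦc]))
    exact hσt.eventually h2
  have hmain : ∀ᶠ x in 𝓝 p, ∀ ξ, ν x ξ = (j x).1 * fderiv ℝ u x ξ ∧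
      fderiv ℝ (fun x => (Φ (σ x)).2) x ξ = ρ x ξ + (j x).2 * fderiv ℝ u x ξ := by
    filter_upwards [hσt.eventually hΦd, hσt.eventually hΦ, hu, eventually_eventually_nhds.2 hsol]
      with x hd hΦx hux hsolx ξ
    have h1 : HasFDerivAt σ ((ContinuousLinearMap.id ℝ E).prod ((fderiv ℝ u x).prod 0)) x :=
      (hasFDerivAt_id x).prodMk
        ((hux.differentiableAt (by simp)).hasFDerivAt.prodMk (hasFDerivAt_const 0 x))
    have h2 := (hΦx.differentiableAt (by simp)).hasFDerivAt.comp x h1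
    have h3 : fderiv ℝ Φ (σ x) (ξ, (fderiv ℝ u x ξ, 0))
        = A x ξ + fderiv ℝ u x ξ • j x := by
      have e1 : ((ξ, (fderiv ℝ u x ξ, 0)) : E × ℝ × ℝ)
          = (ξ, 0) + fderiv ℝ u x ξ • (0, (1, 0)) := by ext <;> simp
      have e2 : (Φ (σ x)).1 = 0 := by
        have := hsolx.self_of_nhds
        rwa [hι] at this
      rw [e1, map_add, map_smul, hd ξ, hQ, e2]
      simp [σ, j]
    have h4 : HasFDerivAt (fun x => (Φ (σ x)).1) _ x := hasFDerivAt_fst.comp x h2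
    have h5 : HasFDerivAt (fun x => (Φ (σ x)).2) _ x := hasFDerivAt_snd.comp x h2
    have h6 : (fun x => (Φ (σ x)).1) =ᶠ[𝓝 x] fun _ => (0 : ℝ) := by
      filter_upwards [hsolx] with y hy
      rwa [hι] at hy
    have h7 := h4.unique ((hasFDerivAt_const (0 : ℝ) x).congr_of_eventuallyEq h6)
    have h8 := congrArg (fun T => T ξ) h7
    simp only [ContinuousLinearMap.comp_apply, ContinuousLinearMap.prod_apply,
      ContinuousLinearMap.id_apply, zero_apply, h3, hAapp, ContinuousLinearMap.coe_fst',
      Prod.fst_add, Prod.smul_fst, smul_eq_mul] at h8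
    refine ⟨by linarith, ?_⟩
    rw [h5.fderiv]
    simp only [ContinuousLinearMap.comp_apply, ContinuousLinearMap.prod_apply,
      ContinuousLinearMap.id_apply, zero_apply, h3, hAapp, ContinuousLinearMap.coe_snd',
      Prod.snd_add, Prod.smul_snd, smul_eq_mul]
    ring
  refine ⟨u, fun x => (Φ (σ x)).2, hu, hG, ?_, ?_⟩
  · filter_upwards [hmain, hj, hpos] with x hx hjx hpx
    refine ⟨κ x e * (j x).1, mul_pos hpx hjx, ?_⟩
    ext ξ
    have := (hx ξ).1
    simp only [ν, smul_apply, smul_eq_mul] at this ⊢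
    field_simp at this
    linarith
  · filter_upwards [hmain, hj, hpos] with x hx hjx hpx
    refine ⟨((j x).2 / (j x).1 - μ x e) / κ x e, ?_⟩
    ext ξ
    obtain ⟨h1, h2⟩ := hx ξ
    rw [h2, add_apply, smul_apply, smul_eq_mul]
    have h3 : fderiv ℝ u x ξ = ν x ξ / (j x).1 := by rw [h1]; field_simp
    rw [h3]
    simp only [ρ, ν, sub_apply, smul_apply, smul_eq_mul]
    field_simp
    ring

end Leaves

end SusyKundt

end

noncomputable section

open Filter Topology Set

namespace SusyKundt

/-! ### Coordinates adapted to an integrable null coframe -/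

section Coframe

variable {E : Type} [NormedAddCommGroup E] [NormedSpace ℝ E]

theorem extD_smul {f : E → ℝ} {κ : E → E →L[ℝ] ℝ} {x : E} (hf : DifferentiableAt ℝ f x)
    (hκ : DifferentiableAt ℝ κ x) (v w : E) :
    extD (fun z => f z • κ z) x v w =
      fderiv ℝ f x v * κ x w - fderiv ℝ f x w * κ x v + f x * extD κ x v w := by
  rw [extD, fderiv_smul_form hf hκ, fderiv_smul_form hf hκ, extD]
  ring

theorem extD_add {κ μ : E → E →L[ℝ] ℝ} {x : E} (hκ : DifferentiableAt ℝ κ x)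
    (hμ : DifferentiableAt ℝ μ x) (v w : E) :
    extD (fun z => κ z + μ z) x v w = extD κ x v w + extD μ x v w := by
  have : fderiv ℝ (fun z => κ z + μ z) x = fderiv ℝ κ x + fderiv ℝ μ x := fderiv_add hκ hμ
  simp only [extD, this, add_apply]
  ring

theorem extD_congr {κ μ : E → E →L[ℝ] ℝ} {x : E} (h : κ =ᶠ[𝓝 x] μ) (v w : E) :
    extD κ x v w = extD μ x v w := by
  simp only [extD, h.fderiv_eq]

theorem extD_fderiv {f : E → ℝ} {x : E} (hf : ContDiffAt ℝ ∞ f x) (v w : E) :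
    extD (fderiv ℝ f) x v w = 0 :=
  sub_eq_zero.2 ((hf.isSymmSndFDerivAt (by
    simpa using (ENat.LEInfty.out : (2 : WithTop ℕ∞) ≤ ∞))).eq v w)

/-- Inserting a vector `e` with `κ e ≠ 0` into the second slot solves for `σ`. This turns each
equation `σ ∧ κ = 0` among the structure equations into a proportionality. -/
theorem exists_eq_smul_of_wedge_eq_zero {σ κ : E →L[ℝ] ℝ} (hκ : κ ≠ 0)
    (h : ∀ v w, σ v * κ w = σ w * κ v) : ∃ c : ℝ, σ = c • κ := by
  obtain ⟨e, he⟩ : ∃ e, κ e ≠ 0 := by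
    by_contra! h
    exact hκ (ContinuousLinearMap.ext h)
  refine ⟨σ e / κ e, ContinuousLinearMap.ext fun v => ?_⟩
  have := h v e
  simp only [smul_apply, smul_eq_mul]
  field_simp
  linarith

/-- The factor between two proportional smooth forms is smooth. -/
theorem exists_smooth_factor {σ κ : E → E →L[ℝ] ℝ} {p : E} (hσ : SmoothNear σ p)
    (hκ : SmoothNear κ p) (h0 : κ p ≠ 0) (h : ∀ᶠ x in 𝓝 p, ∃ c : ℝ, σ x = c • κ x) :
    ∃ c : E → ℝ, SmoothNear c p ∧ ∀ᶠ x in 𝓝 p, σ x = c x • κ x := by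
  obtain ⟨e, he⟩ : ∃ e, κ p e ≠ 0 := by
    by_contra! h
    exact h0 (ContinuousLinearMap.ext h)
  have hκe : SmoothNear (fun z => κ z e) p := hκ.clm_apply (smoothNear_const e p)
  refine ⟨fun z => σ z e * (κ z e)⁻¹,
    (hσ.clm_apply (smoothNear_const e p)).mul (hκe.inv he), ?_⟩
  filter_upwards [h, hκe.continuousAt.eventually_ne he] with x ⟨c, hc⟩ hx
  rw [hc]
  congr 1
  simp [mul_assoc, mul_inv_cancel₀ hx]

theorem SmoothNear.exp {f : E → ℝ} {x : E} (hf : SmoothNear f x) :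
    SmoothNear (fun z => Real.exp (f z)) x := by
  filter_upwards [hf] with z h1 using h1.exp

theorem SmoothNear.eventually_differentiableAt {F : Type*} [NormedAddCommGroup F]
    [NormedSpace ℝ F] {f : E → F} {x : E} (hf : SmoothNear f x) :
    ∀ᶠ z in 𝓝 x, DifferentiableAt ℝ f z := by
  filter_upwards [hf] with z h using h.differentiableAt (by simp)

theorem fderiv_exp_apply {f : E → ℝ} {x : E} (hf : DifferentiableAt ℝ f x) (v : E) :
    fderiv ℝ (fun z => Real.exp (f z)) x v = Real.exp (f x) * fderiv ℝ f x v := by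
  rw [fderiv_exp hf]
  simp

/-- The structure equations of a null coframe `κ, l, m, n` adapted to a Killing spinor with
Killing constant `lam`. -/
def AdaptedCoframe (lam : ℝ) (κ l m n : E → E →L[ℝ] ℝ) (x : E) : Prop :=
  ∃ α β : E →L[ℝ] ℝ, ∀ v w,
    extD κ x v w = 2 * lam * (l x v * κ x w - l x w * κ x v) ∧
    extD l x v w = α v * κ x w - α w * κ x v ∧
    extD m x v w = lam * (l x v * m x w - l x w * m x v) + (β v * κ x w - β w * κ x v) ∧
    extD n x v w = -(α v * l x w - α w * l x v) - (β v * m x w - β w * m x v)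

variable {lam : ℝ} {κ l m n : E → E →L[ℝ] ℝ} {p : E}

/-- Integration of `κ` and `l`. -/
theorem exists_null_coordinate [FiniteDimensional ℝ E] (hlam : lam ≠ 0)
    (hκ : SmoothNear κ p) (hl : SmoothNear l p)
    (h0 : κ p ≠ 0)
    (hE : ∀ᶠ x in 𝓝 p, ∀ v w, extD κ x v w = 2 * lam * (l x v * κ x w - l x w * κ x v)) :
    ∃ u F A : E → ℝ, SmoothNear u p ∧ SmoothNear F p ∧ SmoothNear A p ∧
      (∀ᶠ x in 𝓝 p, κ x = Real.exp (F x) • fderiv ℝ u x) ∧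
      ∀ᶠ x in 𝓝 p, fderiv ℝ F x = (2 * lam) • (l x + A x • κ x) := by
  have hne : ∀ᶠ x in 𝓝 p, κ x ≠ 0 := hκ.continuousAt.eventually_ne h0
  have hker : ∀ᶠ x in 𝓝 p, ∀ v w, κ x v = 0 → κ x w = 0 → extD κ x v w = 0 := by
    filter_upwards [hE] with x hx v w hv hw
    rw [hx, hv, hw]
    ring
  -- Only the label `u` of the leaves is wanted, so `κ` itself serves as the form closed on them.
  obtain ⟨u, -, hu, -, hκu, -⟩ := exists_leaf_primitive hκ hκ h0 hker hker
  have hu0 : fderiv ℝ u p ≠ 0 := by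
    obtain ⟨h, -, hh⟩ := hκu.self_of_nhds
    intro h1
    exact h0 (by rw [hh, h1, smul_zero])
  obtain ⟨h, hh, hκh⟩ := exists_smooth_factor hκ hu.fderiv hu0
    (by filter_upwards [hκu] with x ⟨c, _, hc⟩ using ⟨c, hc⟩)
  have hune : ∀ᶠ x in 𝓝 p, fderiv ℝ u x ≠ 0 := hu.fderiv.continuousAt.eventually_ne hu0
  have hhpos : ∀ᶠ x in 𝓝 p, 0 < h x := by
    filter_upwards [hκu, hκh, hune] with x ⟨c, hc, hc'⟩ hx hux
    have : (c - h x) • fderiv ℝ u x = 0 := by rw [sub_smul, ← hc', ← hx, sub_self]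
    rcases smul_eq_zero.1 this with h1 | h1
    · linarith
    · exact absurd h1 hux
  let F : E → ℝ := fun x => Real.log (h x)
  have hF : SmoothNear F p := by
    filter_upwards [hh, hhpos] with x hx hpx using hx.log hpx.ne'
  have hκF : ∀ᶠ x in 𝓝 p, κ x = Real.exp (F x) • fderiv ℝ u x := by
    filter_upwards [hκh, hhpos] with x hx hpx
    rw [hx, Real.exp_log hpx]
  -- Comparing `dκ = dF ∧ κ`, from `κ = e^F du`, with `dκ = 2λ l ∧ κ` leaves a form whose wedge with
  -- `κ` is zero.
  have hprop : ∀ᶠ x in 𝓝 p, ∃ c : ℝ, (2 * lam)⁻¹ • fderiv ℝ F x - l x = c • κ x := by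
    filter_upwards [hE, hF.eventually_differentiableAt, hu, hu.fderiv.eventually_differentiableAt,
      eventually_eventually_nhds.2 hκF, hne] with x hx hFx hux hdux hκx hnex
    refine exists_eq_smul_of_wedge_eq_zero hnex fun v w => ?_
    have h1 := hx v w
    have hexp : DifferentiableAt ℝ (fun z => Real.exp (F z)) x := hFx.exp
    rw [extD_congr hκx, extD_smul hexp hdux, extD_fderiv hux,
      fderiv_exp_apply hFx, fderiv_exp_apply hFx] at h1
    have h2 : ∀ v, κ x v = Real.exp (F x) * fderiv ℝ u x v := fun v => by
      rw [hκx.self_of_nhds]; rfl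
    have h3 : fderiv ℝ F x v * κ x w - fderiv ℝ F x w * κ x v
        = 2 * lam * (l x v * κ x w - l x w * κ x v) := by
      rw [← h1, h2, h2]; ring
    simp only [sub_apply, smul_apply, smul_eq_mul]
    field_simp
    linear_combination h3
  obtain ⟨A, hA, hAeq⟩ := exists_smooth_factor
    (((smoothNear_const (2 * lam)⁻¹ p).smul hF.fderiv).sub hl) hκ h0 hprop
  refine ⟨u, F, A, hu, hF, hA, hκF, ?_⟩
  filter_upwards [hAeq] with x hx
  rw [← hx, add_sub_cancel, smul_smul, mul_inv_cancel₀ (by simpa using hlam), one_smul]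

/-- Integration of `m`. -/
theorem exists_screen_coordinate [FiniteDimensional ℝ E] {F A : E → ℝ}
    (hκ : SmoothNear κ p) (hm : SmoothNear m p)
    (hF : SmoothNear F p) (h0 : κ p ≠ 0)
    (hdF : ∀ᶠ x in 𝓝 p, fderiv ℝ F x = (2 * lam) • (l x + A x • κ x))
    (hE : ∀ᶠ x in 𝓝 p, AdaptedCoframe lam κ l m n x) :
    ∃ G B : E → ℝ, SmoothNear G p ∧ SmoothNear B p ∧
      ∀ᶠ x in 𝓝 p, Real.exp (F x / 2) • fderiv ℝ G x = m x + B x • κ x := by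
  have hF2 : SmoothNear (fun x => -F x / 2) p := by
    filter_upwards [hF] with x hx using hx.neg.div_const 2
  have hF3 : SmoothNear (fun x => F x / 2) p := by
    filter_upwards [hF] with x hx using hx.div_const 2
  -- On the kernel of `κ` one has `dF = 2λ l` and `dm = λ l ∧ m`, so the weight `e^{-F/2}` makes `m`
  -- closed there.
  obtain ⟨-, G, -, hG, -, hdG⟩ := exists_leaf_primitive hκ (hF2.exp.smul hm) h0
    (by
      filter_upwards [hE] with x ⟨α, β, hx⟩ v w hv hw
      rw [(hx v w).1, hv, hw]
      ring)
    (by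
      filter_upwards [hE, hF2.eventually_differentiableAt, hm.eventually_differentiableAt, hdF,
        hF.eventually_differentiableAt] with x ⟨α, β, hx⟩ hF2x hmx hdFx hFx v w hv hw
      have h1 : ∀ v, fderiv ℝ (fun x => -F x / 2) x v = -(fderiv ℝ F x v) / 2 := by
        intro v
        have h2 : HasFDerivAt (fun x => -F x / 2) ((2 : ℝ)⁻¹ • -fderiv ℝ F x) x := by
          simpa [div_eq_inv_mul] using hFx.hasFDerivAt.neg.const_mul (2 : ℝ)⁻¹
        rw [h2.fderiv]
        simp
        ring
      have hexp : DifferentiableAt ℝ (fun z => Real.exp (-F z / 2)) x := hF2x.exp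
      rw [extD_smul hexp hmx, fderiv_exp_apply hF2x, fderiv_exp_apply hF2x, h1, h1, hdFx,
        (hx v w).2.2.1]
      simp only [add_apply, smul_apply, smul_eq_mul, hv, hw]
      ring)
  obtain ⟨B, hB, hBeq⟩ := exists_smooth_factor ((hF3.exp.smul hG.fderiv).sub hm) hκ h0 (by
    filter_upwards [hdG] with x ⟨f, hf⟩
    refine ⟨Real.exp (F x / 2) * f, ?_⟩
    rw [hf, smul_add, smul_smul, smul_smul, ← Real.exp_add]
    have : F x / 2 + -F x / 2 = 0 := by ring
    rw [this, Real.exp_zero, one_smul, add_sub_cancel_left])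
  refine ⟨G, B, hG, hB, ?_⟩
  filter_upwards [hBeq] with x hx
  rw [← hx, add_sub_cancel]

/-- The transverse form after the null rotation that makes the other forms integrable. -/
def rotatedNull (A B : E → ℝ) (κ l m n : E → E →L[ℝ] ℝ) (x : E) : E →L[ℝ] ℝ :=
  n x + (-A x) • l x + (-B x) • m x + (-(A x ^ 2 + B x ^ 2) / 2) • κ x

theorem SmoothNear.rotatedNull {A B : E → ℝ} (hA : SmoothNear A p) (hB : SmoothNear B p)
    (hκ : SmoothNear κ p) (hl : SmoothNear l p) (hm : SmoothNear m p) (hn : SmoothNear n p) :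
    SmoothNear (rotatedNull A B κ l m n) p := by
  filter_upwards [hA, hB, hκ, hl, hm, hn] with x h1 h2 h3 h4 h5 h6
  unfold SusyKundt.rotatedNull
  fun_prop

/-- The equations `d(dF) = 0` and `d(dG) = 0` determine `α` and `β` modulo `κ` in terms of `dA` and
`dB`. After substitution all derivatives of `A` and `B` cancel, and only `κ ∧ l` and `κ ∧ m`
survive. Both the vanishing on the leaves of `κ` and the missing `κ ∧ n` term are used later. -/
theorem extD_rotatedNull {F G A B : E → ℝ}
    (hκ : SmoothNear κ p) (hl : SmoothNear l p)
    (hm : SmoothNear m p) (hn : SmoothNear n p) (hF : SmoothNear F p) (hG : SmoothNear G p)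
    (hA : SmoothNear A p) (hB : SmoothNear B p) (hlam : lam ≠ 0) (h0 : κ p ≠ 0)
    (hdF : ∀ᶠ x in 𝓝 p, fderiv ℝ F x = (2 * lam) • (l x + A x • κ x))
    (hdG : ∀ᶠ x in 𝓝 p, Real.exp (F x / 2) • fderiv ℝ G x = m x + B x • κ x)
    (hE : ∀ᶠ x in 𝓝 p, AdaptedCoframe lam κ l m n x) :
    ∀ᶠ x in 𝓝 p, ∃ c d : ℝ, ∀ v w, extD (rotatedNull A B κ l m n) x v w =
      κ x v * (c * l x w + d * m x w) - κ x w * (c * l x v + d * m x v) := by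
  have hF3 : SmoothNear (fun x => F x / 2) p := by
    filter_upwards [hF] with x hx using hx.div_const 2
  filter_upwards [hκ.eventually_differentiableAt, hl.eventually_differentiableAt,
    hm.eventually_differentiableAt, hn.eventually_differentiableAt, hF, hG,
    hA.eventually_differentiableAt, hB.eventually_differentiableAt,
    eventually_eventually_nhds.2 hdF, eventually_eventually_nhds.2 hdG, hE,
    hκ.continuousAt.eventually_ne h0, hF.fderiv.eventually_differentiableAt,
    hG.fderiv.eventually_differentiableAt, hF3.eventually_differentiableAt]
    with x hκx hlx hmx hnx hFx hGx hAx hBx hdFx hdGx ⟨α, β, hx⟩ hne hdFx' hdGx' hF3x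
  have hFd : DifferentiableAt ℝ F x := hFx.differentiableAt (by simp)
  -- the derivative of `l`
  have hl2 : ∀ v w, 0 = extD l x v w + (fderiv ℝ A x v * κ x w - fderiv ℝ A x w * κ x v
      + A x * extD κ x v w) := by
    intro v w
    have h1 : (fun z => (2 * lam)⁻¹ • fderiv ℝ F z) =ᶠ[𝓝 x] fun z => l z + A z • κ z := by
      filter_upwards [hdFx] with z hz
      rw [hz, smul_smul, inv_mul_cancel₀ (by simpa using hlam), one_smul]
    have h2 := extD_congr h1 v w
    rw [extD_add hlx (hAx.fun_smul hκx), extD_smul hAx hκx, extD_smul (by fun_prop) hdFx',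
      extD_fderiv hFx] at h2
    simpa using h2
  have hm2 : ∀ v w, (1 / 2) * (fderiv ℝ F x v * (m x w + B x * κ x w)
      - fderiv ℝ F x w * (m x v + B x * κ x v)) = extD m x v w + (fderiv ℝ B x v * κ x w
      - fderiv ℝ B x w * κ x v + B x * extD κ x v w) := by
    intro v w
    have h2 := extD_congr hdGx v w
    have hexp : DifferentiableAt ℝ (fun z => Real.exp (F z / 2)) x := hF3x.exp
    have h1 : ∀ v, fderiv ℝ (fun x => F x / 2) x v = (fderiv ℝ F x v) / 2 := by
      intro v
      have h2 : HasFDerivAt (fun x => F x / 2) ((2 : ℝ)⁻¹ • fderiv ℝ F x) x := by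
        simpa [div_eq_inv_mul] using hFd.hasFDerivAt.const_mul (2 : ℝ)⁻¹
      rw [h2.fderiv]
      simp
      ring
    rw [extD_add hmx (hBx.fun_smul hκx), extD_smul hBx hκx, extD_smul hexp hdGx',
      extD_fderiv hGx, fderiv_exp_apply hF3x, fderiv_exp_apply hF3x, h1, h1] at h2
    rw [← h2]
    have h3 : ∀ w, m x w + B x * κ x w = Real.exp (F x / 2) * fderiv ℝ G x w := by
      intro w
      have := congrArg (fun T => T w) hdGx.self_of_nhds
      simpa using this.symm
    rw [h3, h3]
    ring
  have hdFv : ∀ v, fderiv ℝ F x v = 2 * lam * (l x v + A x * κ x v) := fun v => by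
    rw [hdFx.self_of_nhds]
    simp [mul_add]
  -- From `d(l + Aκ) = 0`: `(α + dA + 2λA l) ∧ κ = 0`.
  obtain ⟨s, hs⟩ := exists_eq_smul_of_wedge_eq_zero
    (σ := α + fderiv ℝ A x + (2 * lam * A x) • l x) hne (by
    intro v w
    have h1 := hl2 v w
    rw [(hx v w).1, (hx v w).2.1] at h1
    simp only [add_apply, smul_apply, smul_eq_mul]
    linear_combination -h1)
  -- From `d(m + Bκ) = (1/2) dF ∧ (m + Bκ)`, with `dF = 2λ(l + Aκ)`.
  obtain ⟨t, ht⟩ := exists_eq_smul_of_wedge_eq_zero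
    (σ := β + fderiv ℝ B x + (lam * B x) • l x + (lam * A x) • m x) hne (by
    intro v w
    have h1 := hm2 v w
    rw [(hx v w).1, (hx v w).2.2.1, hdFv, hdFv] at h1
    simp only [add_apply, smul_apply, smul_eq_mul]
    linear_combination -h1)
  have hα : ∀ v, α v = s * κ x v - fderiv ℝ A x v - 2 * lam * A x * l x v := fun v => by
    have := congrArg (fun T => T v) hs
    simp only [add_apply, smul_apply, smul_eq_mul] at this
    linarith
  have hβ : ∀ v, β v = t * κ x v - fderiv ℝ B x v - lam * B x * l x v - lam * A x * m x v :=
    fun v => by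
    have := congrArg (fun T => T v) ht
    simp only [add_apply, smul_apply, smul_eq_mul] at this
    linarith
  -- The coefficients left in `dn'` after `α` and `β` are eliminated.
  refine ⟨-s - lam * A x ^ 2, -t - lam * A x * B x, fun v w => ?_⟩
  have hq : HasFDerivAt (fun z => -(A z ^ 2 + B z ^ 2) / 2)
      (-(A x • fderiv ℝ A x + B x • fderiv ℝ B x)) x := by
    have h1 := (((hAx.hasFDerivAt.pow 2).add (hBx.hasFDerivAt.pow 2)).neg.const_mul (2 : ℝ)⁻¹)
    refine (h1.congr_fderiv ?_).congr_of_eventuallyEq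
      (Eventually.of_forall fun z => by simp [div_eq_inv_mul])
    ext v
    simp
    ring
  have hnA : ∀ v, fderiv ℝ (fun z => -A z) x v = -fderiv ℝ A x v := fun v => by
    rw [fderiv_fun_neg]; rfl
  have hnB : ∀ v, fderiv ℝ (fun z => -B z) x v = -fderiv ℝ B x v := fun v => by
    rw [fderiv_fun_neg]; rfl
  have e1 : extD (rotatedNull A B κ l m n) x v w = extD n x v w
      + (-fderiv ℝ A x v * l x w + fderiv ℝ A x w * l x v - A x * extD l x v w)
      + (-fderiv ℝ B x v * m x w + fderiv ℝ B x w * m x v - B x * extD m x v w)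
      + (-(A x * fderiv ℝ A x v + B x * fderiv ℝ B x v) * κ x w
        + (A x * fderiv ℝ A x w + B x * fderiv ℝ B x w) * κ x v
        - (A x ^ 2 + B x ^ 2) / 2 * extD κ x v w) := by
    unfold rotatedNull
    have d1 : DifferentiableAt ℝ (fun z => (-A z) • l z) x := hAx.neg.smul hlx
    have d2 : DifferentiableAt ℝ (fun z => (-B z) • m z) x := hBx.neg.smul hmx
    rw [extD_add ((hnx.fun_add d1).fun_add d2) (hq.differentiableAt.fun_smul hκx),
      extD_add (hnx.fun_add d1) d2,
      extD_add hnx d1, extD_smul hAx.fun_neg hlx, extD_smul hBx.fun_neg hmx,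
      extD_smul hq.differentiableAt hκx, hq.fderiv, hnA, hnA, hnB, hnB]
    simp only [neg_apply, add_apply, smul_apply, smul_eq_mul]
    ring
  rw [e1, (hx v w).2.2.2, (hx v w).2.2.1, (hx v w).2.1, (hx v w).1, hα, hα, hβ, hβ]
  ring

/-- Integration of the structure equations: coordinates in which the metric is of Siklos form. -/
theorem exists_siklos_coordinates [FiniteDimensional ℝ E] (hlam : lam ≠ 0)
    (hκ : SmoothNear κ p) (hl : SmoothNear l p)
    (hm : SmoothNear m p) (hn : SmoothNear n p)
    (hinj : ∀ v, κ p v = 0 → l p v = 0 → m p v = 0 → n p v = 0 → v = 0) (h0 : κ p ≠ 0)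
    (hE : ∀ᶠ x in 𝓝 p, AdaptedCoframe lam κ l m n x) :
    ∃ u v F G H : E → ℝ, SmoothNear u p ∧ SmoothNear v p ∧ SmoothNear F p ∧ SmoothNear G p ∧
      SmoothNear H p ∧
      (∀ a, fderiv ℝ u p a = 0 → fderiv ℝ v p a = 0 → fderiv ℝ F p a = 0 →
        fderiv ℝ G p a = 0 → a = 0) ∧
      (∀ᶠ x in 𝓝 p, ∀ a, fderiv ℝ u x a = 0 → fderiv ℝ F x a = 0 → fderiv ℝ G x a = 0 →
        fderiv ℝ H x a = 0) ∧
      ∀ᶠ x in 𝓝 p, ∀ a b, κ x a * n x b + n x a * κ x b + l x a * l x b + m x a * m x b =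
        Real.exp (F x) * (fderiv ℝ u x a * (fderiv ℝ v x b + H x * fderiv ℝ u x b)
          + (fderiv ℝ v x a + H x * fderiv ℝ u x a) * fderiv ℝ u x b)
        + 1 / (4 * lam ^ 2) * (fderiv ℝ F x a * fderiv ℝ F x b)
        + Real.exp (F x) * (fderiv ℝ G x a * fderiv ℝ G x b) := by
  obtain ⟨u, F, A, hu, hF, hA, hκu, hdF⟩ := exists_null_coordinate hlam hκ hl h0 (by
    filter_upwards [hE] with x ⟨α, β, hx⟩ v w using (hx v w).1)
  obtain ⟨G, B, hG, hB, hdG⟩ := exists_screen_coordinate hκ hm hF h0 hdF hE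
  have hdn := extD_rotatedNull hκ hl hm hn hF hG hA hB hlam h0 hdF hdG hE
  have hn' := SmoothNear.rotatedNull hA hB hκ hl hm hn
  set N := rotatedNull A B κ l m n with hN
  obtain ⟨-, v, -, hv, -, hdv⟩ := exists_leaf_primitive hκ hn' h0
    (by
      filter_upwards [hE] with x ⟨α, β, hx⟩ v w hv hw
      rw [(hx v w).1, hv, hw]
      ring)
    (by
      filter_upwards [hdn] with x ⟨c, d, hx⟩ v w hv hw
      rw [hx, hv, hw]
      ring)
  have hu0 : fderiv ℝ u p ≠ 0 := fun h => h0 (by rw [hκu.self_of_nhds, h, smul_zero])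
  -- `n' - dv` is a multiple of `κ`, hence of `du` for the `u` fixed earlier; the leaf label
  -- supplied with `v` is not needed.
  obtain ⟨H, hH, hHeq⟩ := exists_smooth_factor (hn'.sub hv.fderiv) hu.fderiv hu0 (by
    filter_upwards [hdv, hκu] with x ⟨f, hf⟩ hx
    refine ⟨-(f * Real.exp (F x)), ?_⟩
    rw [hf, hx, smul_smul]
    ext a
    simp)
  have hexp2 : ∀ x, Real.exp (F x) = Real.exp (F x / 2) * Real.exp (F x / 2) := fun x => by
    rw [← Real.exp_add]; ring_nf
  refine ⟨u, v, F, G, H, hu, hv, hF, hG, hH, ?_, ?_, ?_⟩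
  · intro a h1 h2 h3 h4
    have k1 : κ p a = 0 := by rw [hκu.self_of_nhds]; simp [h1]
    have k2 : l p a = 0 := by
      rw [hdF.self_of_nhds] at h3
      simpa [k1, hlam] using h3
    have k3 : m p a = 0 := by
      have := congrArg (fun T => T a) hdG.self_of_nhds
      simpa [h4, k1] using this.symm
    have k4 : N p a = 0 := by
      have := congrArg (fun T => T a) hHeq.self_of_nhds
      simpa [h1, h2] using this
    refine hinj a k1 k2 k3 ?_
    simpa [hN, rotatedNull, k1, k2, k3] using k4
  · filter_upwards [hκu, hdF, hdG, hdn, eventually_eventually_nhds.2 hHeq, hu, hv,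
      hH.eventually_differentiableAt, hu.fderiv.eventually_differentiableAt,
      hv.fderiv.eventually_differentiableAt, hu.fderiv.continuousAt.eventually_ne hu0]
      with x hκx hdFx hdGx ⟨c, d, hcd⟩ hHx hux hvx hHd hud hvd hune a h1 h3 h4
    obtain ⟨e, he⟩ : ∃ e, fderiv ℝ u x e ≠ 0 := by
      by_contra! h
      exact hune (ContinuousLinearMap.ext h)
    have k1 : κ x a = 0 := by rw [hκx]; simp [h1]
    have k2 : l x a = 0 := by
      rw [hdFx] at h3
      simpa [k1, hlam] using h3
    have k3 : m x a = 0 := by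
      have := congrArg (fun T => T a) hdGx
      simpa [h4, k1] using this.symm
    -- Here `dn' = dH ∧ du`. On a vector annihilated by `κ`, `l` and `m` the left side vanishes, so
    -- `dH` vanishes there too.
    have h5 : N =ᶠ[𝓝 x] fun z => fderiv ℝ v z + H z • fderiv ℝ u z := by
      filter_upwards [hHx] with z hz
      rw [← hz, add_sub_cancel]
    have h6 := hcd a e
    rw [extD_congr h5, extD_add hvd (hHd.fun_smul hud), extD_smul hHd hud, extD_fderiv hux,
      extD_fderiv hvx, k1, k2, k3, h1] at h6
    have h7 : fderiv ℝ H x a * fderiv ℝ u x e = 0 := by linarith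
    exact (mul_eq_zero.1 h7).resolve_right he
  · filter_upwards [hκu, hdF, hdG, hHeq] with x hκx hdFx hdGx hHx a b
    have k1 : ∀ a, κ x a = Real.exp (F x) * fderiv ℝ u x a := fun a => by rw [hκx]; simp
    have k2 : ∀ a, fderiv ℝ F x a = 2 * lam * (l x a + A x * κ x a) := fun a => by
      rw [hdFx]; simp [mul_add]
    have k3 : ∀ a, Real.exp (F x / 2) * fderiv ℝ G x a = m x a + B x * κ x a := fun a => by
      simpa using congrArg (fun T => T a) hdGx
    have k4 : ∀ a, fderiv ℝ v x a + H x * fderiv ℝ u x a = n x a - A x * l x a - B x * m x a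
        - (A x ^ 2 + B x ^ 2) / 2 * κ x a := fun a => by
      have := congrArg (fun T => T a) hHx
      simp only [hN, rotatedNull, sub_apply, add_apply, smul_apply, smul_eq_mul] at this
      linarith
    rw [k4, k4]
    -- The last two summands of the metric are the squares of the rotated forms `m + Bκ` and `l +
    -- Aκ`; their cross terms cancel against those of the rotated `n`.
    have k5 : Real.exp (F x) * (fderiv ℝ G x a * fderiv ℝ G x b)
        = (m x a + B x * κ x a) * (m x b + B x * κ x b) := by
      rw [← k3, ← k3, hexp2]; ring
    have k6 : 1 / (4 * lam ^ 2) * (fderiv ℝ F x a * fderiv ℝ F x b)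
        = (l x a + A x * κ x a) * (l x b + A x * κ x b) := by
      rw [k2, k2]; field_simp; ring
    rw [k5, k6, mul_add, ← mul_assoc, ← k1, mul_comm _ (fderiv ℝ u x b), ← mul_assoc, ← k1]
    ring

end Coframe

end SusyKundt

end

noncomputable section

open Filter Topology Set

namespace SusyKundt

/-! ### The chart in which the metric takes the Kundt form -/

section KundtChart

theorem dX_coord (j : Fin 2) (y : Fin 2 → ℝ) :
    dX (fun z => z j) y = Pi.single j 1 := by
  ext i
  have : HasFDerivAt (fun z : Fin 2 → ℝ => z j) (ContinuousLinearMap.proj (R := ℝ) j) y :=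
    (ContinuousLinearMap.proj (R := ℝ) (φ := fun _ : Fin 2 => ℝ) j).hasFDerivAt
  rw [dX, this.fderiv]
  simp [Pi.single_apply, eq_comm]

theorem kundtMetric_coord (lam : ℝ) (H : ℝ → (Fin 2 → ℝ) → ℝ) (p v w : EuclideanSpace ℝ (Fin 4)) :
    kundtMetric lam H (fun _ y => y 0) (fun _ y => y 1) (fun _ _ => 0) p v w =
      H (p 0) ![p 2, p 3] * (v 0 * w 0) + Real.exp (p 2) * (v 0 * w 1 + v 1 * w 0)
        + 1 / (4 * lam ^ 2) * (v 2 * w 2) + Real.exp (p 2) * (v 3 * w 3) := by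
  simp only [kundtMetric, dX_coord]
  simp

theorem linearIndependent_dX_coord (y : Fin 2 → ℝ) :
    LinearIndependent ℝ ![dX (fun z => z 0) y, dX (fun z => z 1) y] := by
  rw [dX_coord, dX_coord, LinearIndependent.pair_iff]
  intro s t h
  exact ⟨by simpa using congrFun h 0, by simpa using congrFun h 1⟩

/-- With `F` and `G` the coordinate functions, neither `dF` nor the plane metric depends on `u`, so
both `u`-derivatives on the right vanish, while `β = 0` makes the left side zero. -/
theorem betaEquation_coord (lam : ℝ) :
    BetaEquation lam (fun _ y => y 0) (fun _ y => y 1) (fun _ _ => 0) := by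
  intro u y
  have h1 : ∀ i : Fin 2, dX (fun _ => (0 : ℝ)) y i = 0 := fun i => by simp [dX]
  have h2 : ∀ q : Matrix (Fin 2) (Fin 2) ℝ, hodge q 0 = 0 := fun q => by
    ext i
    fin_cases i <;> simp [hodge]
  simp only [dXOneForm, planeMetric, deriv_const, h2]
  simp [h1, coInner]

/-- A function whose derivative vanishes along a segment has equal values at its ends. -/
theorem eq_of_fderiv_segment_eq_zero {E : Type*} [NormedAddCommGroup E] [NormedSpace ℝ E]
    {K : E → ℝ} {a d : E}
    (h : ∀ t ∈ Icc (0 : ℝ) 1, DifferentiableAt ℝ K (a + t • d) ∧ fderiv ℝ K (a + t • d) d = 0) :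
    K (a + d) = K a := by
  have hd : ∀ t ∈ Icc (0 : ℝ) 1, HasDerivAt (fun t : ℝ => K (a + t • d)) 0 t := by
    intro t ht
    have h1 : HasDerivAt (fun t : ℝ => a + t • d) d t := by
      simpa using ((hasDerivAt_id t).smul_const d).const_add a
    have h2 := (h t ht).1.hasFDerivAt.comp_hasDerivAt t h1
    rwa [(h t ht).2] at h2
  have := constant_of_has_deriv_right_zero
    (fun t ht => (hd t ht).continuousAt.continuousWithinAt)
    (fun t ht => (hd t (Ico_subset_Icc_self ht)).hasDerivWithinAt) 1 (by simp)
  simpa using this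

/-- The map with the given coordinate functions. -/
def coordMap {E : Type*} (f : Fin 4 → E → ℝ) (x : E) : EuclideanSpace ℝ (Fin 4) :=
  WithLp.toLp 2 fun i => f i x

@[simp] theorem coordMap_apply {E : Type*} (f : Fin 4 → E → ℝ) (x : E) (i : Fin 4) :
    coordMap f x i = f i x := rfl

theorem contDiffAt_coordMap {E : Type*} [NormedAddCommGroup E] [NormedSpace ℝ E]
    {f : Fin 4 → E → ℝ} {x : E} (h : ∀ i, ContDiffAt ℝ ∞ (f i) x) :
    ContDiffAt ℝ ∞ (coordMap f) x :=
  contDiffAt_euclidean.2 h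

theorem fderiv_coordMap_apply {E : Type*} [NormedAddCommGroup E] [NormedSpace ℝ E]
    {f : Fin 4 → E → ℝ} {x : E} (h : ∀ i, ContDiffAt ℝ ∞ (f i) x) (v : E) (i : Fin 4) :
    fderiv ℝ (coordMap f) x v i = fderiv ℝ (f i) x v := by
  have h1 : DifferentiableAt ℝ (coordMap f) x :=
    (contDiffAt_coordMap h).differentiableAt (by simp)
  have h2 := ((EuclideanSpace.proj (𝕜 := ℝ) i).hasFDerivAt.comp x h1.hasFDerivAt).fderiv
  have h3 : (⇑(EuclideanSpace.proj (𝕜 := ℝ) i) ∘ coordMap f) = f i := rfl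
  rw [h3] at h2
  rw [h2]
  rfl

/-- The model space of a four-manifold. -/
abbrev E4 := EuclideanSpace ℝ (Fin 4)

/-- `(u, v, F, G)` is a chart by the inverse function theorem. In it `H` is constant along the
second coordinate, so it descends to a function of `u` and the plane coordinates, and a cutoff makes
that function globally smooth. -/
theorem exists_kundt_chart {lam : ℝ} {q : E4 → E4 → E4 → ℝ}
    {u v F G H : E4 → ℝ} {p : E4}
    (hu : SmoothNear u p) (hv : SmoothNear v p) (hF : SmoothNear F p) (hG : SmoothNear G p)
    (hH : SmoothNear H p)
    (hinj : ∀ a, fderiv ℝ u p a = 0 → fderiv ℝ v p a = 0 → fderiv ℝ F p a = 0 →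
        fderiv ℝ G p a = 0 → a = 0)
    (hHd : ∀ᶠ x in 𝓝 p, ∀ a, fderiv ℝ u x a = 0 → fderiv ℝ F x a = 0 → fderiv ℝ G x a = 0 →
        fderiv ℝ H x a = 0)
    (hq : ∀ᶠ x in 𝓝 p, ∀ a b, q x a b =
        Real.exp (F x) * (fderiv ℝ u x a * (fderiv ℝ v x b + H x * fderiv ℝ u x b)
          + (fderiv ℝ v x a + H x * fderiv ℝ u x a) * fderiv ℝ u x b)
        + 1 / (4 * lam ^ 2) * (fderiv ℝ F x a * fderiv ℝ F x b)
        + Real.exp (F x) * (fderiv ℝ G x a * fderiv ℝ G x b)) :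
    ∃ H₀ : ℝ → (Fin 2 → ℝ) → ℝ, ContDiff ℝ ∞ (fun z : ℝ × (Fin 2 → ℝ) => H₀ z.1 z.2) ∧
      ∃ Θ : OpenPartialHomeomorph E4 E4, p ∈ Θ.source ∧
        (∀ x ∈ Θ.source, ContDiffAt ℝ ∞ Θ x) ∧ (∀ y ∈ Θ.target, ContDiffAt ℝ ∞ Θ.symm y) ∧
        ∀ x ∈ Θ.source, ∀ a b, q x a b =
          kundtMetric lam H₀ (fun _ y => y 0) (fun _ y => y 1) (fun _ _ => 0) (Θ x)
            (fderiv ℝ Θ x a) (fderiv ℝ Θ x b) := by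
  let f : Fin 4 → E4 → ℝ := ![u, v, F, G]
  have hf : ∀ᶠ x in 𝓝 p, ∀ i, ContDiffAt ℝ ∞ (f i) x := by
    filter_upwards [hu, hv, hF, hG] with x h0 h1 h2 h3 i
    fin_cases i
    exacts [h0, h1, h2, h3]
  have hΨ : SmoothNear (coordMap f) p := by
    filter_upwards [hf] with x hx using contDiffAt_coordMap hx
  have hd : ∀ᶠ x in 𝓝 p, ∀ a i, fderiv ℝ (coordMap f) x a i = fderiv ℝ (f i) x a := by
    filter_upwards [hf] with x hx a i using fderiv_coordMap_apply hx a i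
  have hinj' : Function.Injective (fderiv ℝ (coordMap f) p) := by
    rw [injective_iff_map_eq_zero]
    intro a ha
    have h1 : ∀ i, fderiv ℝ (f i) p a = 0 := fun i => by
      rw [← hd.self_of_nhds, ha]; rfl
    exact hinj a (h1 0) (h1 1) (h1 2) (h1 3)
  let T : E4 ≃L[ℝ] E4 := (LinearEquiv.ofInjectiveEndo
    (fderiv ℝ (coordMap f) p : E4 →ₗ[ℝ] E4) hinj').toContinuousLinearEquiv
  have hT : HasFDerivAt (coordMap f) (T : E4 →L[ℝ] E4) p := by
    have : (T : E4 →L[ℝ] E4) = fderiv ℝ (coordMap f) p := by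
      ext a : 1
      rfl
    rw [this]
    exact hΨ.differentiableAt.hasFDerivAt
  obtain ⟨Θ₀, hcoe, hp, hsm, hsm'⟩ := hΨ.exists_openPartialHomeomorph T hT
  have hΘp : coordMap f p ∈ Θ₀.target := hcoe ▸ Θ₀.map_source hp
  have hinv : Θ₀.symm (coordMap f p) = p := by rw [← hcoe]; exact Θ₀.left_inv hp
  set c : E4 := coordMap f p with hc
  have hsymmt : Tendsto Θ₀.symm (𝓝 c) (𝓝 p) := by
    have := (hsm' c hΘp).continuousAt.tendsto
    rwa [hinv] at this
  let K : E4 → ℝ := fun y => H (Θ₀.symm y)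
  -- The preimage under the chart of the second basis vector is annihilated by `du`, `dF` and `dG`,
  -- hence by `dH`.
  have hgood : ∀ᶠ y in 𝓝 c, ContDiffAt ℝ ∞ K y ∧
      fderiv ℝ K y (EuclideanSpace.single 1 1) = 0 := by
    filter_upwards [hsymmt.eventually hH, hsymmt.eventually hHd, hsymmt.eventually hd,
      Θ₀.open_target.mem_nhds hΘp] with y h1 h2 h3 h4
    have hx := Θ₀.map_target h4
    refine ⟨h1.comp y (hsm' y h4), ?_⟩
    have d1 : HasFDerivAt Θ₀.symm (fderiv ℝ Θ₀.symm y) y :=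
      ((hsm' y h4).differentiableAt (by simp)).hasFDerivAt
    have d2 : HasFDerivAt (coordMap f) (fderiv ℝ (coordMap f) (Θ₀.symm y)) (Θ₀.symm y) :=
      ((hsm _ hx).differentiableAt (by simp)).hasFDerivAt
    have d3 : HasFDerivAt K ((fderiv ℝ H (Θ₀.symm y)).comp (fderiv ℝ Θ₀.symm y)) y :=
      (h1.differentiableAt (by simp)).hasFDerivAt.comp y d1
    have d4 : HasFDerivAt (coordMap f ∘ Θ₀.symm) (ContinuousLinearMap.id ℝ E4) y := by
      refine (hasFDerivAt_id y).congr_of_eventuallyEq ?_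
      filter_upwards [Θ₀.open_target.mem_nhds h4] with z hz
      have := Θ₀.right_inv hz
      rwa [hcoe] at this
    have d5 := (d2.comp y d1).unique d4
    set a := fderiv ℝ Θ₀.symm y (EuclideanSpace.single 1 1) with ha
    have d6 : fderiv ℝ (coordMap f) (Θ₀.symm y) a = EuclideanSpace.single 1 1 :=
      congrArg (fun T => T (EuclideanSpace.single 1 1)) d5
    have d7 : ∀ i, fderiv ℝ (f i) (Θ₀.symm y) a = (EuclideanSpace.single 1 1 : E4) i :=
        fun i => by
      rw [← h3, d6]
    rw [d3.fderiv]
    exact h2 a (by simpa [f] using d7 0) (by simpa [f] using d7 2) (by simpa [f] using d7 3)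
  obtain ⟨r, hr, hball⟩ := Metric.eventually_nhds_iff_ball.1 hgood
  -- the slice `v = const`
  let S : ℝ × (Fin 2 → ℝ) → E4 := coordMap ![fun z => z.1, fun _ => c 1, fun z => z.2 0,
    fun z => z.2 1]
  have hS : ContDiff ℝ ∞ S := by
    refine contDiff_iff_contDiffAt.2 fun z => contDiffAt_coordMap fun i => ?_
    fin_cases i
    · exact contDiffAt_fst
    · exact contDiffAt_const
    · exact (contDiff_apply ℝ ℝ (0 : Fin 2)).contDiffAt.comp z contDiffAt_snd
    · exact (contDiff_apply ℝ ℝ (1 : Fin 2)).contDiffAt.comp z contDiffAt_snd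
  let π : E4 → ℝ × (Fin 2 → ℝ) := fun y => (y 0, ![y 2, y 3])
  have hπ : Continuous π := by
    refine Continuous.prodMk (by fun_prop) (continuous_pi fun i => ?_)
    fin_cases i <;> simp <;> fun_prop
  have hSπ : ∀ y, y = S (π y) + (y 1 - c 1) • (EuclideanSpace.single 1 1 : E4) := by
    intro y
    ext i
    fin_cases i <;> simp [S, π]
  have hSc : S (π c) = c := by
    have := hSπ c
    simpa using this.symm
  -- The segment from `y` to the slice changes only the coordinate `v` and moves it towards that of
  -- `c`, so it does not leave the ball.
  have hKball : ∀ y ∈ Metric.ball c r, K y = K (S (π y)) := by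
    intro y hy
    have hmem : ∀ t ∈ Icc (0 : ℝ) 1,
        S (π y) + t • ((y 1 - c 1) • (EuclideanSpace.single 1 1 : E4)) ∈ Metric.ball c r := by
      intro t ht
      refine lt_of_le_of_lt ?_ (Metric.mem_ball.1 hy)
      rw [EuclideanSpace.dist_eq, EuclideanSpace.dist_eq]
      refine Real.sqrt_le_sqrt (Finset.sum_le_sum fun i _ => ?_)
      refine pow_le_pow_left₀ dist_nonneg ?_ 2
      fin_cases i <;> simp [S, π, Real.dist_eq]
      rw [abs_of_nonneg ht.1]
      exact mul_le_of_le_one_left (abs_nonneg _) ht.2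
    conv_lhs => rw [hSπ y]
    refine eq_of_fderiv_segment_eq_zero fun t ht => ?_
    obtain ⟨g1, g2⟩ := hball _ (hmem t ht)
    exact ⟨g1.differentiableAt (by simp), by rw [map_smul, g2, smul_zero]⟩
  -- The symmetric product `e^F du ⊙ (dv + H du)` contributes `2 e^F H` to the coefficient of `du ⊗
  -- du`.
  let k₀ : ℝ × (Fin 2 → ℝ) → ℝ := fun z => 2 * Real.exp (z.2 0) * K (S z)
  have hk₀ : SmoothNear k₀ (π c) := by
    have h1 : SmoothNear (fun z => K (S z)) (π c) := by
      refine SmoothNear.comp (g := K) ?_ (ContDiff.smoothNear hS _)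
      rw [hSc]
      filter_upwards [hgood] with y hy using hy.1
    refine SmoothNear.mul (ContDiff.smoothNear ?_ _) h1
    have h2 : ContDiff ℝ ∞ (fun z : ℝ × (Fin 2 → ℝ) => z.2 0) :=
      (contDiff_apply ℝ ℝ (0 : Fin 2)).comp contDiff_snd
    exact contDiff_const.mul h2.exp
  obtain ⟨g, hg, hgk⟩ := hk₀.exists_contDiff
  have hfin : ∀ᶠ x in 𝓝 p, (∀ a i, fderiv ℝ (coordMap f) x a i = fderiv ℝ (f i) x a) ∧
      coordMap f x ∈ Metric.ball c r ∧ g (π (coordMap f x)) = k₀ (π (coordMap f x)) ∧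
      ∀ a b, q x a b =
        Real.exp (F x) * (fderiv ℝ u x a * (fderiv ℝ v x b + H x * fderiv ℝ u x b)
          + (fderiv ℝ v x a + H x * fderiv ℝ u x a) * fderiv ℝ u x b)
        + 1 / (4 * lam ^ 2) * (fderiv ℝ F x a * fderiv ℝ F x b)
        + Real.exp (F x) * (fderiv ℝ G x a * fderiv ℝ G x b) :=
    hd.and ((hΨ.continuousAt.eventually (Metric.ball_mem_nhds c hr)).and
      (((hπ.continuousAt.comp hΨ.continuousAt).eventually hgk).and hq))
  obtain ⟨W, hW, hWo, hpW⟩ := eventually_nhds_iff.1 hfin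
  refine ⟨fun t y => g (t, y), hg, Θ₀.restrOpen W hWo, ?_, ?_, ?_, ?_⟩
  · rw [Θ₀.restrOpen_source]
    exact ⟨hp, hpW⟩
  · intro x hx
    rw [Θ₀.restrOpen_source] at hx
    exact hcoe ▸ hsm x hx.1
  · intro y hy
    exact hsm' y (by
      have := (Θ₀.restrOpen W hWo).map_target hy
      rw [Θ₀.restrOpen_source] at this
      have h2 := Θ₀.map_source this.1
      have h3 := (Θ₀.restrOpen W hWo).right_inv hy
      exact h3 ▸ h2)
  · intro x hx a b
    rw [Θ₀.restrOpen_source] at hx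
    obtain ⟨w1, w2, w3, w4⟩ := hW x hx.2
    have e0 : ((Θ₀.restrOpen W hWo : OpenPartialHomeomorph E4 E4) : E4 → E4) = coordMap f := hcoe
    have e1 : K (coordMap f x) = H x := by
      simp only [K]
      rw [← hcoe, Θ₀.left_inv hx.1]
    rw [w4 a b, kundtMetric_coord, e0]
    have e2 : g ((coordMap f x) 0, ![(coordMap f x) 2, (coordMap f x) 3])
        = 2 * Real.exp (F x) * H x := by
      have : g (π (coordMap f x)) = 2 * Real.exp (F x) * H x := by
        rw [w3, ← e1, hKball _ w2]
        rfl
      exact this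
    rw [e2]
    simp only [w1]
    simp only [f, coordMap_apply, Matrix.cons_val]
    ring

end KundtChart

end SusyKundt

end

noncomputable section

open Filter Topology Set

namespace SusyKundt

/-! ### Spinor bilinears -/

section Bilinears

/-- The quadratic form of a matrix. -/
def quad (A : Matrix (Fin 4) (Fin 4) ℝ) (s : Fin 4 → ℝ) : ℝ := ∑ i, ∑ j, A i j * (s i * s j)

/-- The derivative of `quad A` at `s` in the direction `d`. -/
def polar (A : Matrix (Fin 4) (Fin 4) ℝ) (s d : Fin 4 → ℝ) : ℝ :=
  ∑ i, ∑ j, A i j * (d i * s j + s i * d j)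

/-- The squared norm of a spinor, which is the time component of its Dirac current. -/
def normSq (s : Fin 4 → ℝ) : ℝ := quad 1 s

/-- The matrices `γ₀ γ_a` of the Dirac current. -/
def currentMat : Fin 4 → Matrix (Fin 4) (Fin 4) ℝ :=
  ![-1, !![0, 0, 0, 1; 0, 0, -1, 0; 0, -1, 0, 0; 1, 0, 0, 0],
    !![1, 0, 0, 0; 0, -1, 0, 0; 0, 0, 1, 0; 0, 0, 0, -1],
    !![0, -1, 0, 0; -1, 0, 0, 0; 0, 0, 0, -1; 0, 0, -1, 0]]

/-- The matrices of the null direction opposite to the Dirac current. -/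
def oppositeMat : Fin 4 → Matrix (Fin 4) (Fin 4) ℝ :=
  ![1, currentMat 1, currentMat 2, currentMat 3]

/-- The matrices `0, γ₁, γ₂, γ₃` of the first screen direction. -/
def screenMat : Fin 4 → Matrix (Fin 4) (Fin 4) ℝ := ![0, gammaMat 1, gammaMat 2, gammaMat 3]

/-- The matrices `0, γ₅γ₁, γ₅γ₂, γ₅γ₃` of the second screen direction. -/
def dualScreenMat : Fin 4 → Matrix (Fin 4) (Fin 4) ℝ :=
  ![0, !![1, 0, 0, 0; 0, 1, 0, 0; 0, 0, -1, 0; 0, 0, 0, -1],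
    !![0, 0, 0, -1; 0, 0, -1, 0; 0, -1, 0, 0; -1, 0, 0, 0],
    !![0, 0, -1, 0; 0, 0, 0, 1; -1, 0, 0, 0; 0, 1, 0, 0]]

theorem normSq_eq (s : Fin 4 → ℝ) : normSq s = s 0 ^ 2 + s 1 ^ 2 + s 2 ^ 2 + s 3 ^ 2 := by
  simp [normSq, quad, Fin.sum_univ_four, Matrix.one_apply]
  ring

theorem normSq_pos {s : Fin 4 → ℝ} (hs : s ≠ 0) : 0 < normSq s := by
  rw [normSq_eq]
  by_contra h
  apply hs
  have h0 : s 0 = 0 := by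
    nlinarith [sq_nonneg (s 0), sq_nonneg (s 1), sq_nonneg (s 2), sq_nonneg (s 3)]
  have h1 : s 1 = 0 := by
    nlinarith [sq_nonneg (s 0), sq_nonneg (s 1), sq_nonneg (s 2), sq_nonneg (s 3)]
  have h2 : s 2 = 0 := by
    nlinarith [sq_nonneg (s 0), sq_nonneg (s 1), sq_nonneg (s 2), sq_nonneg (s 3)]
  have h3 : s 3 = 0 := by
    nlinarith [sq_nonneg (s 0), sq_nonneg (s 1), sq_nonneg (s 2), sq_nonneg (s 3)]
  ext i
  fin_cases i
  exacts [h0, h1, h2, h3]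

theorem polar_one (s d : Fin 4 → ℝ) :
    polar 1 s d = 2 * (s 0 * d 0 + s 1 * d 1 + s 2 * d 2 + s 3 * d 3) := by
  simp [polar, Fin.sum_univ_four, Matrix.one_apply]
  ring

/-- Explicit components, here and for the other bilinears below, reduce the covariant derivative
formulas to polynomial identities in the spinor components. -/
theorem quad_currentMat (s : Fin 4 → ℝ) (b : Fin 4) : quad (currentMat b) s =
    ![-(s 0 ^ 2 + s 1 ^ 2 + s 2 ^ 2 + s 3 ^ 2), 2 * (s 0 * s 3 - s 1 * s 2),
      s 0 ^ 2 - s 1 ^ 2 + s 2 ^ 2 - s 3 ^ 2, -2 * (s 0 * s 1 + s 2 * s 3)] b := by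
  fin_cases b <;> simp [quad, currentMat, Fin.sum_univ_four, Matrix.one_apply] <;> ring

theorem quad_oppositeMat (s : Fin 4 → ℝ) (b : Fin 4) : quad (oppositeMat b) s =
    ![s 0 ^ 2 + s 1 ^ 2 + s 2 ^ 2 + s 3 ^ 2, 2 * (s 0 * s 3 - s 1 * s 2),
      s 0 ^ 2 - s 1 ^ 2 + s 2 ^ 2 - s 3 ^ 2, -2 * (s 0 * s 1 + s 2 * s 3)] b := by
  fin_cases b <;>
    simp [quad, oppositeMat, currentMat, Fin.sum_univ_four, Matrix.one_apply] <;> ring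

theorem quad_screenMat (s : Fin 4 → ℝ) (b : Fin 4) : quad (screenMat b) s =
    ![0, 2 * (s 0 * s 2 + s 1 * s 3), 2 * (s 0 * s 1 - s 2 * s 3),
      s 0 ^ 2 - s 1 ^ 2 - s 2 ^ 2 + s 3 ^ 2] b := by
  fin_cases b <;> simp [quad, screenMat, gammaMat, Fin.sum_univ_four] <;> ring

theorem quad_dualScreenMat (s : Fin 4 → ℝ) (b : Fin 4) : quad (dualScreenMat b) s =
    ![0, s 0 ^ 2 + s 1 ^ 2 - s 2 ^ 2 - s 3 ^ 2, -2 * (s 0 * s 3 + s 1 * s 2),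
      2 * (s 1 * s 3 - s 0 * s 2)] b := by
  fin_cases b <;> simp [quad, dualScreenMat, Fin.sum_univ_four] <;> ring

theorem polar_currentMat (s d : Fin 4 → ℝ) (b : Fin 4) : polar (currentMat b) s d =
    ![-2 * (s 0 * d 0 + s 1 * d 1 + s 2 * d 2 + s 3 * d 3),
      2 * (s 0 * d 3 + d 0 * s 3 - s 1 * d 2 - d 1 * s 2),
      2 * (s 0 * d 0 - s 1 * d 1 + s 2 * d 2 - s 3 * d 3),
      -2 * (s 0 * d 1 + d 0 * s 1 + s 2 * d 3 + d 2 * s 3)] b := by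
  fin_cases b <;> simp [polar, currentMat, Fin.sum_univ_four, Matrix.one_apply] <;> ring

theorem polar_oppositeMat (s d : Fin 4 → ℝ) (b : Fin 4) : polar (oppositeMat b) s d =
    ![2 * (s 0 * d 0 + s 1 * d 1 + s 2 * d 2 + s 3 * d 3),
      2 * (s 0 * d 3 + d 0 * s 3 - s 1 * d 2 - d 1 * s 2),
      2 * (s 0 * d 0 - s 1 * d 1 + s 2 * d 2 - s 3 * d 3),
      -2 * (s 0 * d 1 + d 0 * s 1 + s 2 * d 3 + d 2 * s 3)] b := by
  fin_cases b <;>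
    simp [polar, oppositeMat, currentMat, Fin.sum_univ_four, Matrix.one_apply] <;> ring

theorem polar_screenMat (s d : Fin 4 → ℝ) (b : Fin 4) : polar (screenMat b) s d =
    ![0, 2 * (s 0 * d 2 + d 0 * s 2 + s 1 * d 3 + d 1 * s 3),
      2 * (s 0 * d 1 + d 0 * s 1 - s 2 * d 3 - d 2 * s 3),
      2 * (s 0 * d 0 - s 1 * d 1 - s 2 * d 2 + s 3 * d 3)] b := by
  fin_cases b <;> simp [polar, screenMat, gammaMat, Fin.sum_univ_four] <;> ring

theorem polar_dualScreenMat (s d : Fin 4 → ℝ) (b : Fin 4) : polar (dualScreenMat b) s d =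
    ![0, 2 * (s 0 * d 0 + s 1 * d 1 - s 2 * d 2 - s 3 * d 3),
      -2 * (s 0 * d 3 + d 0 * s 3 + s 1 * d 2 + d 1 * s 2),
      2 * (s 1 * d 3 + d 1 * s 3 - s 0 * d 2 - d 0 * s 2)] b := by
  fin_cases b <;> simp [polar, dualScreenMat, Fin.sum_univ_four] <;> ring

/-- The derivative of a Killing spinor `s` in a frame, in a direction with components `t`, where
`w` are the components of the Levi-Civita connection. -/
def killingDeriv (lam : ℝ) (t : Fin 4 → ℝ) (w : Fin 4 → Fin 4 → ℝ) (s : Fin 4 → ℝ) : Fin 4 → ℝ :=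
  (lam / 2) • (gamma t).mulVec s -
    ((1 / 4 : ℝ) • ∑ a, ∑ b, (w a b * eta a * eta b) • (gammaMat a * gammaMat b)).mulVec s

/-- Antisymmetry leaves six independent connection components, and off-diagonal pairs of gamma
matrices anticommute, so the factor `1 / 4` becomes `1 / 2`. -/
theorem killingDeriv_eq (lam : ℝ) (t : Fin 4 → ℝ) {w : Fin 4 → Fin 4 → ℝ}
    (hw : ∀ a b, w a b = -w b a) (s : Fin 4 → ℝ) : killingDeriv lam t w s =
    ![1 / 2 * (lam * (t 3 * s 0 + t 0 * s 1 + t 2 * s 1 + t 1 * s 2) + s 0 * w 0 2 - s 1 * w 0 3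
        + s 1 * w 2 3 + s 2 * w 1 3 + s 3 * w 0 1 + s 3 * w 1 2),
      1 / 2 * (lam * (-t 0 * s 0 + t 2 * s 0 - t 3 * s 1 + t 1 * s 3) - s 0 * w 0 3 - s 0 * w 2 3
        - s 1 * w 0 2 - s 3 * w 1 3 - s 2 * w 0 1 + s 2 * w 1 2),
      1 / 2 * (lam * (t 1 * s 0 - t 3 * s 2 - t 0 * s 3 - t 2 * s 3) - s 0 * w 1 3 + s 2 * w 0 2
        - s 3 * w 0 3 + s 3 * w 2 3 - s 1 * w 0 1 - s 1 * w 1 2),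
      1 / 2 * (lam * (t 1 * s 1 + t 0 * s 2 - t 2 * s 2 + t 3 * s 3) + s 1 * w 1 3 - s 2 * w 0 3
        - s 2 * w 2 3 - s 3 * w 0 2 + s 0 * w 0 1 - s 0 * w 1 2)] := by
  have h0 : ∀ a, w a a = 0 := fun a => by linarith [hw a a]
  have h10 := hw 1 0
  have h20 := hw 2 0
  have h30 := hw 3 0
  have h21 := hw 2 1
  have h31 := hw 3 1
  have h32 := hw 3 2
  ext i
  fin_cases i <;>
    simp [killingDeriv, gamma, Fintype.linearCombination_apply, gammaMat, eta,
      Fin.sum_univ_four, dotProduct, h0, h10, h20, h30, h21, h31,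
      h32] <;> ring

/-! ### Covariant derivatives of the spinor bilinears. -/

section Identities

variable (lam : ℝ) (t : Fin 4 → ℝ) {w : Fin 4 → Fin 4 → ℝ} (s : Fin 4 → ℝ)

/-- Cleared of the denominator, this is `∇_v κ = λ (l(v) κ - κ(v) l)`. The right side is
antisymmetric, so the Dirac current is Killing and `dκ = 2λ l ∧ κ`. -/
theorem nabla_current (hw : ∀ a b, w a b = -w b a) (b : Fin 4) :
    normSq s * (polar (currentMat b) s (killingDeriv lam t w s)
      - ∑ a, quad (currentMat a) s * eta a * w a b) =
    lam * ((∑ c, quad (screenMat c) s * t c) * quad (currentMat b) s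
      - (∑ c, quad (currentMat c) s * t c) * quad (screenMat b) s) := by
  have h0 : ∀ a, w a a = 0 := fun a => by linarith [hw a a]
  have h10 := hw 1 0
  have h20 := hw 2 0
  have h30 := hw 3 0
  have h21 := hw 2 1
  have h31 := hw 3 1
  have h32 := hw 3 2
  simp only [killingDeriv_eq lam t hw, normSq_eq, quad_currentMat, quad_screenMat,
    polar_currentMat, Fin.sum_univ_four, eta]
  fin_cases b <;> simp [h0, h10, h20, h30, h21, h31, h32] <;> ring

/-- After division by `normSq s ^ 2` this is `∇_v l = A(v) κ + λ (κ(v) n + m(v) m)`. The form `A`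
depends on the frame because `l` is normalized to have no `e₀` component. -/
theorem nabla_screen (hw : ∀ a b, w a b = -w b a) (b : Fin 4) :
    polar (screenMat b) s (killingDeriv lam t w s) * normSq s
      - quad (screenMat b) s * polar 1 s (killingDeriv lam t w s)
      - normSq s * ∑ a, quad (screenMat a) s * eta a * w a b =
    (-(∑ c, w 0 c * quad (screenMat c) s) + lam * (∑ c, quad (currentMat c) s * t c) / 2)
        * quad (currentMat b) s
      + lam * ((∑ c, quad (currentMat c) s * t c) * quad (oppositeMat b) s / 2
        + (∑ c, quad (dualScreenMat c) s * t c) * quad (dualScreenMat b) s) := by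
  have h0 : ∀ a, w a a = 0 := fun a => by linarith [hw a a]
  have h10 := hw 1 0
  have h20 := hw 2 0
  have h30 := hw 3 0
  have h21 := hw 2 1
  have h31 := hw 3 1
  have h32 := hw 3 2
  simp only [killingDeriv_eq lam t hw, normSq_eq, quad_currentMat, quad_screenMat,
    quad_oppositeMat, quad_dualScreenMat, polar_screenMat, polar_one, Fin.sum_univ_four, eta]
  fin_cases b <;> simp [h0, h10, h20, h30, h21, h31, h32] <;> ring

/-- After division by `normSq s ^ 2` this is `∇_v m = B(v) κ - λ m(v) l`. -/
theorem nabla_dualScreen (hw : ∀ a b, w a b = -w b a) (b : Fin 4) :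
    polar (dualScreenMat b) s (killingDeriv lam t w s) * normSq s
      - quad (dualScreenMat b) s * polar 1 s (killingDeriv lam t w s)
      - normSq s * ∑ a, quad (dualScreenMat a) s * eta a * w a b =
    -(∑ c, w 0 c * quad (dualScreenMat c) s) * quad (currentMat b) s
      - lam * (∑ c, quad (dualScreenMat c) s * t c) * quad (screenMat b) s := by
  have h0 : ∀ a, w a a = 0 := fun a => by linarith [hw a a]
  have h10 := hw 1 0
  have h20 := hw 2 0
  have h30 := hw 3 0
  have h21 := hw 2 1
  have h31 := hw 3 1
  have h32 := hw 3 2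
  simp only [killingDeriv_eq lam t hw, normSq_eq, quad_currentMat, quad_screenMat,
    quad_dualScreenMat, polar_dualScreenMat, polar_one, Fin.sum_univ_four, eta]
  fin_cases b <;> simp [h0, h10, h20, h30, h21, h31, h32] <;> ring

/-- In terms of the normalized forms this is `∇_v n = -A(v) l - B(v) m - λ l(v) n`, with the same
`A` and `B` as for the two screen forms. -/
theorem nabla_opposite (hw : ∀ a b, w a b = -w b a) (b : Fin 4) :
    polar (oppositeMat b) s (killingDeriv lam t w s) * normSq s
      - 2 * quad (oppositeMat b) s * polar 1 s (killingDeriv lam t w s)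
      - normSq s * ∑ a, quad (oppositeMat a) s * eta a * w a b =
    -2 * (-(∑ c, w 0 c * quad (screenMat c) s) + lam * (∑ c, quad (currentMat c) s * t c) / 2)
        * quad (screenMat b) s
      - 2 * -(∑ c, w 0 c * quad (dualScreenMat c) s) * quad (dualScreenMat b) s
      - lam * (∑ c, quad (screenMat c) s * t c) * quad (oppositeMat b) s := by
  have h0 : ∀ a, w a a = 0 := fun a => by linarith [hw a a]
  have h10 := hw 1 0
  have h20 := hw 2 0
  have h30 := hw 3 0
  have h21 := hw 2 1
  have h31 := hw 3 1
  have h32 := hw 3 2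
  simp only [killingDeriv_eq lam t hw, normSq_eq, quad_currentMat, quad_screenMat,
    quad_oppositeMat, quad_dualScreenMat, polar_oppositeMat, polar_one, Fin.sum_univ_four, eta]
  fin_cases b <;> simp [h0, h10, h20, h30, h21, h31, h32] <;> ring

end Identities

/-- The Minkowski form in terms of the null frame of a spinor. -/
theorem minkowski_eq_bilinears (s t t' : Fin 4 → ℝ) :
    2 * normSq s ^ 2 * ∑ a, eta a * (t a * t' a) =
    (∑ c, quad (currentMat c) s * t c) * (∑ c, quad (oppositeMat c) s * t' c)
      + (∑ c, quad (oppositeMat c) s * t c) * (∑ c, quad (currentMat c) s * t' c)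
      + 2 * ((∑ c, quad (screenMat c) s * t c) * (∑ c, quad (screenMat c) s * t' c))
      + 2 * ((∑ c, quad (dualScreenMat c) s * t c) * (∑ c, quad (dualScreenMat c) s * t' c)) := by
  simp only [normSq_eq, quad_currentMat, quad_screenMat, quad_oppositeMat, quad_dualScreenMat,
    Fin.sum_univ_four, eta]
  simp
  ring

end Bilinears

end SusyKundt

end

noncomputable section

open Filter Topology Set

namespace SusyKundt

/-! ### The null coframe of a Killing spinor -/

section KillingFrame

variable {E : Type} [NormedAddCommGroup E] [NormedSpace ℝ E]

/-- The one-form with components `c` in the coframe `θ`. -/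
def frameForm (θ : Fin 4 → E → E →L[ℝ] ℝ) (c : Fin 4 → E → ℝ) (x : E) : E →L[ℝ] ℝ :=
  ∑ a, c a x • θ a x

theorem frameForm_apply (θ : Fin 4 → E → E →L[ℝ] ℝ) (c : Fin 4 → E → ℝ) (x v : E) :
    frameForm θ c x v = ∑ a, c a x * θ a x v := by
  simp [frameForm]

theorem SmoothNear.frameForm {θ : Fin 4 → E → E →L[ℝ] ℝ} {c : Fin 4 → E → ℝ} {p : E}
    (hθ : ∀ a, SmoothNear (θ a) p) (hc : ∀ a, SmoothNear (c a) p) :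
    SmoothNear (frameForm θ c) p := by
  have h : ∀ a, SmoothNear (fun x => c a x • θ a x) p := fun a => (hc a).smul (hθ a)
  filter_upwards [eventually_all.2 h] with x hx
  exact ContDiffAt.sum fun a _ => hx a

/-- The coframe `θ` at `x` admits a metric torsion-free connection for which `s` satisfies the
Killing spinor equation. -/
def IsKillingFrame (lam : ℝ) (θ : Fin 4 → E → E →L[ℝ] ℝ) (s : E → Fin 4 → ℝ) (x : E) : Prop :=
  ∃ w : Fin 4 → Fin 4 → E →L[ℝ] ℝ, (∀ a b v, w a b v = -w b a v) ∧
    (∀ a v v', extD (θ a) x v v'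
      = -(eta a * ∑ b, (w a b v * θ b x v' - w a b v' * θ b x v))) ∧
    ∀ v, fderiv ℝ s x v = killingDeriv lam (fun c => θ c x v) (fun a b => w a b v) (s x)

/-- For a torsion-free connection the exterior derivative is the antisymmetrized covariant
derivative; `R` holds the components of the latter. -/
theorem extD_frameForm {θ : Fin 4 → E → E →L[ℝ] ℝ} {c : Fin 4 → E → ℝ} {x : E}
    (hθ : ∀ a, DifferentiableAt ℝ (θ a) x) (hc : ∀ a, DifferentiableAt ℝ (c a) x)
    {w : Fin 4 → Fin 4 → E →L[ℝ] ℝ}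
    (hw : ∀ a v v', extD (θ a) x v v'
      = -(eta a * ∑ b, (w a b v * θ b x v' - w a b v' * θ b x v)))
    {R : Fin 4 → E → ℝ}
    (hR : ∀ b v, fderiv ℝ (c b) x v - ∑ a, c a x * eta a * w a b v = R b v) (v v' : E) :
    extD (frameForm θ c) x v v' = ∑ b, (R b v * θ b x v' - R b v' * θ b x v) := by
  have h1 : frameForm θ c = fun x => c 0 x • θ 0 x + c 1 x • θ 1 x + c 2 x • θ 2 x
      + c 3 x • θ 3 x := by
    funext x
    simp [frameForm, Fin.sum_univ_four]
  have hd : ∀ a, DifferentiableAt ℝ (fun x => c a x • θ a x) x := fun a =>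
    (hc a).fun_smul (hθ a)
  rw [h1, extD_add (((hd 0).fun_add (hd 1)).fun_add (hd 2)) (hd 3),
    extD_add ((hd 0).fun_add (hd 1)) (hd 2), extD_add (hd 0) (hd 1),
    extD_smul (hc 0) (hθ 0), extD_smul (hc 1) (hθ 1), extD_smul (hc 2) (hθ 2),
    extD_smul (hc 3) (hθ 3), hw, hw, hw, hw]
  simp only [← hR, Fin.sum_univ_four]
  ring

theorem fderiv_quad {s : E → Fin 4 → ℝ} {x : E} (hs : DifferentiableAt ℝ s x)
    (A : Matrix (Fin 4) (Fin 4) ℝ) (v : E) :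
    fderiv ℝ (fun x => quad A (s x)) x v = polar A (s x) (fderiv ℝ s x v) := by
  have hsi : ∀ i, HasFDerivAt (fun x => s x i)
      ((ContinuousLinearMap.proj (R := ℝ) (φ := fun _ : Fin 4 => ℝ) i).comp (fderiv ℝ s x)) x :=
    fun i => (ContinuousLinearMap.proj (R := ℝ) (φ := fun _ : Fin 4 => ℝ) i).hasFDerivAt.comp x
      hs.hasFDerivAt
  have h : HasFDerivAt (fun x => quad A (s x)) _ x :=
    HasFDerivAt.fun_sum (u := Finset.univ) fun i _ => HasFDerivAt.fun_sum (u := Finset.univ)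
      fun j _ => ((hsi i).mul (hsi j)).const_mul (A i j)
  rw [h.fderiv]
  simp only [sum_apply, smul_apply, add_apply, ContinuousLinearMap.comp_apply,
    ContinuousLinearMap.proj_apply, smul_eq_mul, polar]
  refine Finset.sum_congr rfl fun i _ => Finset.sum_congr rfl fun j _ => ?_
  ring

theorem contDiffAt_quad {s : E → Fin 4 → ℝ} {x : E} (hs : ContDiffAt ℝ ∞ s x)
    (A : Matrix (Fin 4) (Fin 4) ℝ) : ContDiffAt ℝ ∞ (fun x => quad A (s x)) x := by
  have hsi := contDiffAt_pi.1 hs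
  exact ContDiffAt.sum fun i _ => ContDiffAt.sum fun j _ =>
    contDiffAt_const.mul ((hsi i).mul (hsi j))

theorem fderiv_div_apply {f g : E → ℝ} {x : E} (hf : DifferentiableAt ℝ f x)
    (hg : DifferentiableAt ℝ g x) (h0 : g x ≠ 0) (v : E) :
    fderiv ℝ (fun x => f x / g x) x v
      = (fderiv ℝ f x v * g x - f x * fderiv ℝ g x v) / g x ^ 2 := by
  have h1 : DifferentiableAt ℝ (fun x => f x / g x) x := by
    simpa only [div_eq_mul_inv] using hf.fun_mul (hg.fun_inv h0)
  have h2 : (fun y => (f y / g y) * g y) =ᶠ[𝓝 x] f := by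
    filter_upwards [hg.continuousAt.eventually_ne h0] with y hy
    field_simp
  have h3 := congrArg (fun T => T v) ((h1.hasFDerivAt.mul hg.hasFDerivAt).fderiv)
  have h4 : fderiv ℝ ((fun y => f y / g y) * g) x = fderiv ℝ f x := h2.fderiv_eq
  rw [h4] at h3
  simp only [add_apply, smul_apply, smul_eq_mul] at h3
  rw [h3]
  field_simp
  ring

variable (θ : Fin 4 → E → E →L[ℝ] ℝ) (s : E → Fin 4 → ℝ)

/-- The Dirac current of the spinor `s`, as a one-form. -/
def currentForm : E → E →L[ℝ] ℝ := frameForm θ fun a x => quad (currentMat a) (s x)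

/-- The first screen form of the spinor `s`. -/
def screenForm : E → E →L[ℝ] ℝ := frameForm θ fun a x => quad (screenMat a) (s x) / normSq (s x)

/-- The second screen form of the spinor `s`. -/
def dualScreenForm : E → E →L[ℝ] ℝ :=
  frameForm θ fun a x => quad (dualScreenMat a) (s x) / normSq (s x)

/-- The null form transverse to the Dirac current of `s`. -/
def oppositeForm : E → E →L[ℝ] ℝ :=
  frameForm θ fun a x => quad (oppositeMat a) (s x) / (2 * normSq (s x) ^ 2)

variable {θ s}

/-- The weights `1 / normSq` and `1 / (2 * normSq ^ 2)` make the screen forms unit and the two null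
forms dual to each other. -/
theorem minkowski_eq_forms {x : E} (hs : s x ≠ 0) (v v' : E) :
    ∑ a, eta a * (θ a x v * θ a x v') =
      currentForm θ s x v * oppositeForm θ s x v' + oppositeForm θ s x v * currentForm θ s x v'
      + screenForm θ s x v * screenForm θ s x v'
      + dualScreenForm θ s x v * dualScreenForm θ s x v' := by
  have hN := (normSq_pos hs).ne'
  have key := minkowski_eq_bilinears (s x) (fun a => θ a x v) (fun a => θ a x v')
  have h1 : ∀ v, currentForm θ s x v = ∑ c, quad (currentMat c) (s x) * θ c x v :=
    fun v => frameForm_apply _ _ _ _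
  have h2 : ∀ v, screenForm θ s x v = (∑ c, quad (screenMat c) (s x) * θ c x v) / normSq (s x) :=
    fun v => by rw [screenForm, frameForm_apply, Finset.sum_div]; congr 1; ext; ring
  have h3 : ∀ v, dualScreenForm θ s x v
      = (∑ c, quad (dualScreenMat c) (s x) * θ c x v) / normSq (s x) :=
    fun v => by rw [dualScreenForm, frameForm_apply, Finset.sum_div]; congr 1; ext; ring
  have h4 : ∀ v, oppositeForm θ s x v
      = (∑ c, quad (oppositeMat c) (s x) * θ c x v) / (2 * normSq (s x) ^ 2) :=
    fun v => by rw [oppositeForm, frameForm_apply, Finset.sum_div]; congr 1; ext; ring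
  rw [h1, h1, h2, h2, h3, h3, h4, h4]
  refine mul_left_cancel₀ (mul_ne_zero two_ne_zero (pow_ne_zero 2 hN)) ?_
  generalize ∑ a, eta a * (θ a x v * θ a x v') = Q at key ⊢
  field_simp
  linear_combination key

/-- The pointwise formulas for `∇κ`, `∇l`, `∇m` and `∇n`, divided by the normalizing powers of
`normSq`, are antisymmetrized with the help of `extD_frameForm`. -/
theorem adaptedCoframe_of_isKillingFrame {lam : ℝ} {x : E}
    (hθ : ∀ a, DifferentiableAt ℝ (θ a) x) (hs : DifferentiableAt ℝ s x) (hs0 : s x ≠ 0)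
    (h : IsKillingFrame lam θ s x) :
    AdaptedCoframe lam (currentForm θ s) (screenForm θ s) (dualScreenForm θ s)
      (oppositeForm θ s) x := by
  obtain ⟨w, hw, htor, hkill⟩ := h
  have hN : normSq (s x) ≠ 0 := (normSq_pos hs0).ne'
  have hquad : ∀ A, DifferentiableAt ℝ (fun x => quad A (s x)) x := fun A => by
    have hsi := differentiableAt_pi.1 hs
    unfold quad
    fun_prop
  have hNd : DifferentiableAt ℝ (fun x => normSq (s x)) x := hquad 1
  have hN2d : DifferentiableAt ℝ (fun x => 2 * normSq (s x) ^ 2) x := by fun_prop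
  have hdN : ∀ v, fderiv ℝ (fun x => normSq (s x)) x v = polar 1 (s x) (fderiv ℝ s x v) :=
    fderiv_quad hs 1
  have hdN2 : ∀ v, fderiv ℝ (fun x => 2 * normSq (s x) ^ 2) x v
      = 4 * normSq (s x) * polar 1 (s x) (fderiv ℝ s x v) := fun v => by
    rw [((hNd.hasFDerivAt.pow 2).const_mul 2).fderiv]
    simp [hdN]
    ring
  have hdiv : ∀ A, DifferentiableAt ℝ (fun x => quad A (s x) / normSq (s x)) x := fun A => by
    simpa only [div_eq_mul_inv] using (hquad A).fun_mul (hNd.fun_inv hN)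
  have hdiv2 : ∀ A, DifferentiableAt ℝ (fun x => quad A (s x) / (2 * normSq (s x) ^ 2)) x :=
    fun A => by
    simpa only [div_eq_mul_inv] using (hquad A).fun_mul (hN2d.fun_inv (by positivity))
  have e1 : ∀ v, ∑ c, quad (currentMat c) (s x) * θ c x v = currentForm θ s x v :=
    fun v => by rw [currentForm, frameForm_apply]
  have e2 : ∀ v, ∑ c, quad (screenMat c) (s x) * θ c x v = normSq (s x) * screenForm θ s x v :=
    fun v => by
      rw [screenForm, frameForm_apply, Finset.mul_sum]; congr 1; ext; field_simp
  have e3 : ∀ v, ∑ c, quad (dualScreenMat c) (s x) * θ c x v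
      = normSq (s x) * dualScreenForm θ s x v :=
    fun v => by
      rw [dualScreenForm, frameForm_apply, Finset.mul_sum]; congr 1; ext; field_simp
  have e4 : ∀ v, ∑ c, quad (oppositeMat c) (s x) * θ c x v
      = 2 * normSq (s x) ^ 2 * oppositeForm θ s x v :=
    fun v => by
      rw [oppositeForm, frameForm_apply, Finset.mul_sum]; congr 1; ext; field_simp
  -- Coefficients of `κ` in `∇l` and `∇m`, read off from the `e₀` components: `l` and `m` have none,
  -- while `κ` has `-normSq`.
  let A : E →L[ℝ] ℝ := (1 / normSq (s x) ^ 2) •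
    (-(∑ c, quad (screenMat c) (s x) • w 0 c) + (lam / 2) • currentForm θ s x)
  let B : E →L[ℝ] ℝ := (1 / normSq (s x) ^ 2) • -(∑ c, quad (dualScreenMat c) (s x) • w 0 c)
  have hA : ∀ v, -(∑ c, w 0 c v * quad (screenMat c) (s x)) + lam * currentForm θ s x v / 2
      = normSq (s x) ^ 2 * A v := fun v => by
    simp only [A, smul_apply, add_apply, neg_apply, sum_apply, smul_eq_mul]
    field_simp
    simp only [mul_comm]
  have hB : ∀ v, -(∑ c, w 0 c v * quad (dualScreenMat c) (s x)) = normSq (s x) ^ 2 * B v :=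
    fun v => by
    simp only [B, smul_apply, neg_apply, sum_apply, smul_eq_mul]
    field_simp
    simp only [mul_comm]
  have hwv : ∀ v a b, w a b v = -w b a v := fun v a b => hw a b v
  have c1 : ∀ b v, fderiv ℝ (fun x => quad (currentMat b) (s x)) x v
      - ∑ a, quad (currentMat a) (s x) * eta a * w a b v =
      lam * (screenForm θ s x v * quad (currentMat b) (s x)
        - currentForm θ s x v * (quad (screenMat b) (s x) / normSq (s x))) := fun b v => by
    have key := nabla_current lam (fun c => θ c x v) (s x) (hwv v) b
    simp only [e1, e2] at key
    rw [fderiv_quad hs, hkill]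
    refine mul_left_cancel₀ hN ?_
    rw [key]
    field_simp
  have c2 : ∀ b v, fderiv ℝ (fun x => quad (screenMat b) (s x) / normSq (s x)) x v
      - ∑ a, quad (screenMat a) (s x) / normSq (s x) * eta a * w a b v =
      A v * quad (currentMat b) (s x)
        + lam * (currentForm θ s x v * (quad (oppositeMat b) (s x) / (2 * normSq (s x) ^ 2))
          + dualScreenForm θ s x v * (quad (dualScreenMat b) (s x) / normSq (s x))) :=
    fun b v => by
    have key := nabla_screen lam (fun c => θ c x v) (s x) (hwv v) b
    simp only [e1, e3, hA] at key
    have hsum : ∑ a, quad (screenMat a) (s x) / normSq (s x) * eta a * w a b v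
        = (∑ a, quad (screenMat a) (s x) * eta a * w a b v) / normSq (s x) := by
      rw [Finset.sum_div]; congr 1; ext; ring
    rw [fderiv_div_apply (hquad _) hNd hN, fderiv_quad hs, hdN, hkill, hsum]
    generalize ∑ a, quad (screenMat a) (s x) * eta a * w a b v = S at key ⊢
    field_simp
    linear_combination 2 * key
  have c3 : ∀ b v, fderiv ℝ (fun x => quad (dualScreenMat b) (s x) / normSq (s x)) x v
      - ∑ a, quad (dualScreenMat a) (s x) / normSq (s x) * eta a * w a b v =
      B v * quad (currentMat b) (s x)
        - lam * (dualScreenForm θ s x v * (quad (screenMat b) (s x) / normSq (s x))) :=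
    fun b v => by
    have key := nabla_dualScreen lam (fun c => θ c x v) (s x) (hwv v) b
    simp only [e3, hB] at key
    have hsum : ∑ a, quad (dualScreenMat a) (s x) / normSq (s x) * eta a * w a b v
        = (∑ a, quad (dualScreenMat a) (s x) * eta a * w a b v) / normSq (s x) := by
      rw [Finset.sum_div]; congr 1; ext; ring
    rw [fderiv_div_apply (hquad _) hNd hN, fderiv_quad hs, hdN, hkill, hsum]
    generalize ∑ a, quad (dualScreenMat a) (s x) * eta a * w a b v = S at key ⊢
    field_simp
    linear_combination key
  have c4 : ∀ b v, fderiv ℝ (fun x => quad (oppositeMat b) (s x) / (2 * normSq (s x) ^ 2)) x v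
      - ∑ a, quad (oppositeMat a) (s x) / (2 * normSq (s x) ^ 2) * eta a * w a b v =
      -(A v * (quad (screenMat b) (s x) / normSq (s x)))
        - B v * (quad (dualScreenMat b) (s x) / normSq (s x))
        - lam * (screenForm θ s x v * (quad (oppositeMat b) (s x) / (2 * normSq (s x) ^ 2))) :=
    fun b v => by
    have key := nabla_opposite lam (fun c => θ c x v) (s x) (hwv v) b
    simp only [e1, e2, hA, hB] at key
    have hsum : ∑ a, quad (oppositeMat a) (s x) / (2 * normSq (s x) ^ 2) * eta a * w a b v
        = (∑ a, quad (oppositeMat a) (s x) * eta a * w a b v) / (2 * normSq (s x) ^ 2) := by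
      rw [Finset.sum_div]; congr 1; ext; ring
    rw [fderiv_div_apply (hquad _) hN2d (by positivity), fderiv_quad hs, hdN2, hkill, hsum]
    generalize ∑ a, quad (oppositeMat a) (s x) * eta a * w a b v = S at key ⊢
    field_simp
    linear_combination 2 * key
  have f1 : ∀ v, currentForm θ s x v = ∑ c, quad (currentMat c) (s x) * θ c x v :=
    fun v => (e1 v).symm
  have f2 : ∀ v, screenForm θ s x v = ∑ c, quad (screenMat c) (s x) / normSq (s x) * θ c x v :=
    fun v => frameForm_apply ..
  have f3 : ∀ v, dualScreenForm θ s x v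
      = ∑ c, quad (dualScreenMat c) (s x) / normSq (s x) * θ c x v := fun v => frameForm_apply ..
  have f4 : ∀ v, oppositeForm θ s x v
      = ∑ c, quad (oppositeMat c) (s x) / (2 * normSq (s x) ^ 2) * θ c x v :=
    fun v => frameForm_apply ..
  have g1 : ∀ v v', extD (currentForm θ s) x v v' = _ :=
    extD_frameForm hθ (fun _ => hquad _) htor c1
  have g2 : ∀ v v', extD (screenForm θ s) x v v' = _ :=
    extD_frameForm hθ (fun _ => hdiv _) htor c2
  have g3 : ∀ v v', extD (dualScreenForm θ s) x v v' = _ :=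
    extD_frameForm hθ (fun _ => hdiv _) htor c3
  have g4 : ∀ v v', extD (oppositeForm θ s) x v v' = _ :=
    extD_frameForm hθ (fun _ => hdiv2 _) htor c4
  simp only [Fin.sum_univ_four] at f1 f2 f3 f4 g1 g2 g3 g4
  -- The shift by `-λ n` absorbs the term `λ κ ∧ n` of `dl` into `α ∧ κ`, and at the same time the
  -- term `-λ l ∧ n` of `dn` into `-α ∧ l`.
  refine ⟨A - lam • oppositeForm θ s x, B, fun v v' => ⟨?_, ?_, ?_, ?_⟩⟩
  · linear_combination g1 v v' - lam * screenForm θ s x v * f1 v' + lam * screenForm θ s x v' * f1 v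
      + lam * currentForm θ s x v * f2 v' - lam * currentForm θ s x v' * f2 v
  · simp only [sub_apply, smul_apply, smul_eq_mul]
    linear_combination g2 v v' - A v * f1 v' + A v' * f1 v
      - lam * currentForm θ s x v * f4 v' + lam * currentForm θ s x v' * f4 v
      - lam * dualScreenForm θ s x v * f3 v' + lam * dualScreenForm θ s x v' * f3 v
  · linear_combination g3 v v' - B v * f1 v' + B v' * f1 v
      + lam * dualScreenForm θ s x v * f2 v' - lam * dualScreenForm θ s x v' * f2 v
  · simp only [sub_apply, smul_apply, smul_eq_mul]
    linear_combination g4 v v' + A v * f2 v' - A v' * f2 v + B v * f3 v' - B v' * f3 v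
      + lam * screenForm θ s x v * f4 v' - lam * screenForm θ s x v' * f4 v

theorem SmoothNear.quad {p : E} (hs : SmoothNear s p) (A : Matrix (Fin 4) (Fin 4) ℝ) :
    SmoothNear (fun x => quad A (s x)) p :=
  hs.mono fun _ hx => contDiffAt_quad hx _

theorem SmoothNear.div {f g : E → ℝ} {p : E} (hf : SmoothNear f p) (hg : SmoothNear g p)
    (h0 : g p ≠ 0) : SmoothNear (fun x => f x / g x) p := by
  simpa only [div_eq_mul_inv] using hf.mul (hg.inv h0)

/-- The structure equations of the null coframe of a Killing spinor integrate to coordinates of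
Siklos form. -/
theorem exists_kundt_chart_of_isKillingFrame {lam : ℝ}
    {θ : Fin 4 → EuclideanSpace ℝ (Fin 4) → EuclideanSpace ℝ (Fin 4) →L[ℝ] ℝ}
    {s : EuclideanSpace ℝ (Fin 4) → Fin 4 → ℝ} {p : EuclideanSpace ℝ (Fin 4)} (hlam : lam ≠ 0)
    (hθ : ∀ a, SmoothNear (θ a) p) (hs : SmoothNear s p) (hs0 : s p ≠ 0)
    (hinj : ∀ v, (∀ a, θ a p v = 0) → v = 0) (hsurj : ∀ t : Fin 4 → ℝ, ∃ v, ∀ a, θ a p v = t a)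
    (hK : ∀ᶠ x in 𝓝 p, IsKillingFrame lam θ s x) :
    ∃ H₀ : ℝ → (Fin 2 → ℝ) → ℝ, ContDiff ℝ ∞ (fun z : ℝ × (Fin 2 → ℝ) => H₀ z.1 z.2) ∧
      ∃ Θ : OpenPartialHomeomorph (EuclideanSpace ℝ (Fin 4)) (EuclideanSpace ℝ (Fin 4)),
        p ∈ Θ.source ∧
        (∀ x ∈ Θ.source, ContDiffAt ℝ ∞ Θ x) ∧ (∀ y ∈ Θ.target, ContDiffAt ℝ ∞ Θ.symm y) ∧
        ∀ x ∈ Θ.source, ∀ v v', ∑ a, eta a * (θ a x v * θ a x v') =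
          kundtMetric lam H₀ (fun _ y => y 0) (fun _ y => y 1) (fun _ _ => 0) (Θ x)
            (fderiv ℝ Θ x v) (fderiv ℝ Θ x v') := by
  have hN : normSq (s p) ≠ 0 := (normSq_pos hs0).ne'
  have hNs : SmoothNear (fun x => normSq (s x)) p := hs.quad 1
  have hN2s : SmoothNear (fun x => 2 * normSq (s x) ^ 2) p := by
    simpa only [sq] using (smoothNear_const (2 : ℝ) p).mul (hNs.mul hNs)
  have h1 : SmoothNear (currentForm θ s) p := .frameForm hθ fun _ => hs.quad _
  have h2 : SmoothNear (screenForm θ s) p := .frameForm hθ fun _ => (hs.quad _).div hNs hN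
  have h3 : SmoothNear (dualScreenForm θ s) p := .frameForm hθ fun _ => (hs.quad _).div hNs hN
  have h4 : SmoothNear (oppositeForm θ s) p :=
    .frameForm hθ fun _ => (hs.quad _).div hN2s (by positivity)
  have hs0' : ∀ᶠ x in 𝓝 p, s x ≠ 0 := hs.continuousAt.eventually_ne hs0
  have hE : ∀ᶠ x in 𝓝 p, AdaptedCoframe lam (currentForm θ s) (screenForm θ s)
      (dualScreenForm θ s) (oppositeForm θ s) x := by
    filter_upwards [eventually_all.2 fun a => (hθ a).eventually_differentiableAt,
      hs.eventually_differentiableAt, hs0', hK] with x hx hx' hx0 hxK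
    exact adaptedCoframe_of_isKillingFrame hx hx' hx0 hxK
  have h0 : currentForm θ s p ≠ 0 := by
    -- On the timelike frame vector the current takes the value `-normSq`, which is nonzero.
    obtain ⟨e, he⟩ := hsurj (Pi.single 0 1)
    intro hz
    have := congrArg (fun T => T e) hz
    simp only [currentForm, frameForm_apply, he, Fin.sum_univ_four, zero_apply] at this
    apply hN
    simp [quad_currentMat] at this
    rw [normSq_eq]
    linarith
  obtain ⟨u, v, F, G, H, hu, hv, hF, hG, hH, hli, hHd, hq⟩ :=
    exists_siklos_coordinates hlam h1 h2 h3 h4 (by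
      -- A vector annihilated by all four null forms is orthogonal to every frame vector, and the
      -- metric is nondegenerate.
      intro v e1 e2 e3 e4
      refine hinj v fun a => ?_
      obtain ⟨e, he⟩ := hsurj (Pi.single a 1)
      have := minkowski_eq_forms (θ := θ) hs0 v e
      simp only [e1, e2, e3, e4, he] at this
      have ha : eta a ≠ 0 := by unfold eta; split_ifs <;> norm_num
      simpa [Pi.single_apply, ha] using this) h0 hE
  refine exists_kundt_chart hu hv hF hG hH hli hHd ?_
  filter_upwards [hq, hs0'] with x hx hx0 a b
  rw [minkowski_eq_forms hx0, hx]

end KillingFrame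

end SusyKundt

end

noncomputable section

open Filter Topology Set

namespace SusyKundt

/-! ### The Levi-Civita connection of an orthonormal frame -/

section MovingFrame

variable {E : Type} [NormedAddCommGroup E] [NormedSpace ℝ E] (e : Fin 4 → E → E)

/-- The linear combinations of a frame at a point. -/
def frameMap (y : E) : (Fin 4 → ℝ) →L[ℝ] E :=
  ∑ a, (ContinuousLinearMap.proj (R := ℝ) (φ := fun _ : Fin 4 => ℝ) a).smulRight (e a y)

/-- The coframe dual to a frame. -/
def coframe (a : Fin 4) (y : E) : E →L[ℝ] ℝ :=
  (ContinuousLinearMap.proj (R := ℝ) (φ := fun _ : Fin 4 => ℝ) a).comp (frameMap e y).inverse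

/-- The scalar products `⟨[e_c, e_b], e_a⟩` in an orthonormal frame. -/
def structureCoeff (c b a : Fin 4) (y : E) : ℝ :=
  eta a * coframe e a y (VectorField.lieBracket ℝ (e c) (e b) y)

/-- The components of the Levi-Civita connection of an orthonormal frame. -/
def koszulCoeff (c b a : Fin 4) (y : E) : ℝ :=
  (1 / 2) * (structureCoeff e c b a y - structureCoeff e c a b y - structureCoeff e b a c y)

/-- The connection forms of an orthonormal frame. -/
def connForm (a b : Fin 4) (y : E) : E →L[ℝ] ℝ := ∑ c, koszulCoeff e c b a y • coframe e c y

variable {e}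

theorem frameMap_apply (y : E) (c : Fin 4 → ℝ) : frameMap e y c = ∑ a, c a • e a y := by
  simp [frameMap, sum_apply]

theorem frameMap_single (y : E) (b : Fin 4) : frameMap e y (Pi.single b 1) = e b y := by
  simp [frameMap_apply, Pi.single_apply]

theorem coframe_apply_frame {y : E} (h : (frameMap e y).IsInvertible) (a b : Fin 4) :
    coframe e a y (e b y) = if a = b then 1 else 0 := by
  rw [coframe, ContinuousLinearMap.comp_apply, ← frameMap_single (e := e) y b, h.inverse_apply_self]
  simp [Pi.single_apply]

theorem sum_coframe_smul {y : E} (h : (frameMap e y).IsInvertible) (v : E) :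
    ∑ a, coframe e a y v • e a y = v := by
  have := h.self_apply_inverse v
  rwa [frameMap_apply] at this

theorem smoothNear_coframe {p : E} (he : ∀ a, SmoothNear (e a) p)
    (h : ∀ᶠ y in 𝓝 p, (frameMap e y).IsInvertible) (a : Fin 4) : SmoothNear (coframe e a) p := by
  filter_upwards [eventually_all.2 he, h] with y hy hi
  have h1 : ContDiffAt ℝ ∞ (frameMap e) y :=
    ContDiffAt.sum fun a _ => contDiffAt_const.smulRight (hy a)
  exact contDiffAt_const.clm_comp (hi.contDiffAt_map_inverse.comp y h1)

theorem smoothNear_structureCoeff {p : E} (he : ∀ a, SmoothNear (e a) p)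
    (h : ∀ᶠ y in 𝓝 p, (frameMap e y).IsInvertible) (c b a : Fin 4) :
    SmoothNear (structureCoeff e c b a) p :=
  (smoothNear_const (eta a) p).mul ((smoothNear_coframe he h a).clm_apply
    (((he b).fderiv.clm_apply (he c)).sub ((he c).fderiv.clm_apply (he b))))

theorem smoothNear_connForm {p : E} (he : ∀ a, SmoothNear (e a) p)
    (h : ∀ᶠ y in 𝓝 p, (frameMap e y).IsInvertible) (a b : Fin 4) :
    SmoothNear (connForm e a b) p := by
  have hk : ∀ c, SmoothNear (koszulCoeff e c b a) p := fun c =>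
    (smoothNear_const _ p).mul (((smoothNear_structureCoeff he h c b a).sub
      (smoothNear_structureCoeff he h c a b)).sub (smoothNear_structureCoeff he h b a c))
  exact SmoothNear.frameForm (smoothNear_coframe he h) hk

theorem structureCoeff_swap (c b a : Fin 4) (y : E) :
    structureCoeff e c b a y = -structureCoeff e b c a y := by
  rw [structureCoeff, structureCoeff, VectorField.lieBracket_swap, map_neg]
  ring

/-- Metric compatibility of the connection; it follows from the antisymmetry of the bracket alone,
since the scalar products of the frame are constant. -/
theorem koszulCoeff_antisymm (c b a : Fin 4) (y : E) :
    koszulCoeff e c b a y = -koszulCoeff e c a b y := by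
  rw [koszulCoeff, koszulCoeff, structureCoeff_swap b a]
  ring

theorem connForm_antisymm (a b : Fin 4) (y v : E) : connForm e a b y v = -connForm e b a y v := by
  simp only [connForm, sum_apply, smul_apply, smul_eq_mul, ← Finset.sum_neg_distrib]
  refine Finset.sum_congr rfl fun c _ => ?_
  rw [koszulCoeff_antisymm]
  ring

theorem eta_mul_self (a : Fin 4) : eta a * eta a = 1 := by
  unfold eta
  split_ifs <;> norm_num

/-- Differentiating the constant pairings of coframe and frame moves the derivative from the coframe
to the frame, where the antisymmetrization is the Lie bracket. -/
theorem extD_coframe_frame {y : E} (he : ∀ a, DifferentiableAt ℝ (e a) y)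
    (hθ : ∀ a, DifferentiableAt ℝ (coframe e a) y)
    (h : ∀ᶠ y in 𝓝 y, (frameMap e y).IsInvertible) (a c d : Fin 4) :
    extD (coframe e a) y (e c y) (e d y) = -(eta a * structureCoeff e c d a y) := by
  have key : ∀ b v, fderiv ℝ (coframe e a) y v (e b y)
      = -coframe e a y (fderiv ℝ (e b) y v) := fun b v => by
    have h1 : (fun y => coframe e a y (e b y)) =ᶠ[𝓝 y] fun _ => if a = b then 1 else 0 :=
      h.mono fun y hy => coframe_apply_frame hy a b
    have h2 := ((hθ a).hasFDerivAt.clm_apply (he b).hasFDerivAt).fderiv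
    rw [h1.fderiv_eq] at h2
    have h3 := congrArg (fun T => T v) h2
    simp at h3
    linarith
  rw [extD, key, key, structureCoeff, VectorField.lieBracket, map_sub, ← mul_assoc, eta_mul_self]
  ring

/-- The first structure equation. -/
theorem extD_coframe {y : E} (he : ∀ a, DifferentiableAt ℝ (e a) y)
    (hθ : ∀ a, DifferentiableAt ℝ (coframe e a) y)
    (h : ∀ᶠ y in 𝓝 y, (frameMap e y).IsInvertible) (a : Fin 4) (v v' : E) :
    extD (coframe e a) y v v' = -(eta a * ∑ b, (connForm e a b y v * coframe e b y v'
      - connForm e a b y v' * coframe e b y v)) := by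
  have hy := h.self_of_nhds
  have h1 : extD (coframe e a) y v v' = ∑ c, ∑ d, coframe e c y v * coframe e d y v' *
      extD (coframe e a) y (e c y) (e d y) := by
    conv_lhs => rw [← sum_coframe_smul hy v, ← sum_coframe_smul hy v']
    simp only [extD, map_add, map_smul, add_apply, smul_apply, smul_eq_mul, Fin.sum_univ_four]
    ring
  -- The connection is torsion-free: `⟨[e_c, e_d], e_a⟩` is the antisymmetrization of its
  -- coefficients.
  have hk : ∀ c d, structureCoeff e c d a y = koszulCoeff e c d a y - koszulCoeff e d c a y :=
    fun c d => by
    rw [koszulCoeff, koszulCoeff, structureCoeff_swap d c a]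
    ring
  simp only [h1, extD_coframe_frame he hθ h, hk, connForm, add_apply, smul_apply, smul_eq_mul,
    Fin.sum_univ_four]
  ring

end MovingFrame

/-! ### Unique continuation -/

section UniqueContinuation

variable {E : Type} [NormedAddCommGroup E] [NormedSpace ℝ E]

/-- A function whose differential is bounded by a multiple of its norm vanishes near each of its
zeros. -/
theorem eventually_eq_zero_of_norm_fderiv_le {F : Type*} [NormedAddCommGroup F] [NormedSpace ℝ F]
    {s : E → F} {p : E} {K : ℝ} (hs : ∀ᶠ y in 𝓝 p, DifferentiableAt ℝ s y)
    (hK : ∀ᶠ y in 𝓝 p, ∀ v, ‖fderiv ℝ s y v‖ ≤ K * ‖v‖ * ‖s y‖) (h0 : s p = 0) :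
    ∀ᶠ y in 𝓝 p, s y = 0 := by
  obtain ⟨r, hr, hball⟩ := Metric.eventually_nhds_iff_ball.1 (hs.and hK)
  filter_upwards [Metric.ball_mem_nhds p hr] with y hy
  have hmem : ∀ t ∈ Icc (0 : ℝ) 1, p + t • (y - p) ∈ Metric.ball p r := fun t ht =>
    (convex_ball p r).add_smul_sub_mem (Metric.mem_ball_self hr) hy ht
  have hd : ∀ t ∈ Icc (0 : ℝ) 1, HasDerivAt (fun t : ℝ => s (p + t • (y - p)))
      (fderiv ℝ s (p + t • (y - p)) (y - p)) t := fun t ht => by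
    have h1 : HasDerivAt (fun t : ℝ => p + t • (y - p)) (y - p) t := by
      simpa using ((hasDerivAt_id t).smul_const (y - p)).const_add p
    exact (hball _ (hmem t ht)).1.hasFDerivAt.comp_hasDerivAt t h1
  have := eq_zero_of_abs_deriv_le_mul_abs_self_of_eq_zero_right
    (K := K * ‖y - p‖) (fun t ht => (hd t ht).continuousAt.continuousWithinAt)
    (fun t ht => (hd t (Ico_subset_Icc_self ht)).hasDerivWithinAt) (by simpa using h0)
    (fun t ht => (hball _ (hmem t (Ico_subset_Icc_self ht))).2 _) 1 (by simp)
  simpa using this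

/-- The expression is linear in the spinor and in the pair `(t, w)`, so the constant depends only on
`lam` and the gamma matrices. -/
theorem norm_killingDeriv_le (lam : ℝ) : ∃ C, 0 ≤ C ∧ ∀ (t : Fin 4 → ℝ) (w : Fin 4 → Fin 4 → ℝ)
    (s : Fin 4 → ℝ) (B : ℝ), (∀ a, ‖t a‖ ≤ B) → (∀ a b, ‖w a b‖ ≤ B) →
      ‖killingDeriv lam t w s‖ ≤ C * B * ‖s‖ := by
  let N : Matrix (Fin 4) (Fin 4) ℝ → (Fin 4 → ℝ) →L[ℝ] (Fin 4 → ℝ) :=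
    fun A => A.mulVecLin.toContinuousLinearMap
  have hN : ∀ A s, ‖A.mulVec s‖ ≤ ‖N A‖ * ‖s‖ := fun A s => (N A).le_opNorm s
  refine ⟨|lam / 2| * (∑ a, ‖N (gammaMat a)‖)
    + ‖(1 / 4 : ℝ)‖ * ∑ a, ∑ b, ‖N (gammaMat a * gammaMat b)‖, by positivity,
    fun t w s B ht hw => ?_⟩
  have heta : ∀ a, ‖eta a‖ = 1 := fun a => by unfold eta; split_ifs <;> simp
  have h1 : ‖(gamma t).mulVec s‖ ≤ (∑ a, ‖N (gammaMat a)‖) * B * ‖s‖ := by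
    rw [gamma, Fintype.linearCombination_apply, Matrix.sum_mulVec, Finset.sum_mul, Finset.sum_mul]
    refine norm_sum_le_of_le _ fun a _ => ?_
    rw [Matrix.smul_mulVec, norm_smul]
    calc ‖t a‖ * ‖(gammaMat a).mulVec s‖ ≤ B * (‖N (gammaMat a)‖ * ‖s‖) :=
          mul_le_mul (ht a) (hN _ _) (norm_nonneg _) ((norm_nonneg _).trans (ht a))
      _ = _ := by ring
  have h2 : ‖(∑ a, ∑ b, (w a b * eta a * eta b) • (gammaMat a * gammaMat b)).mulVec s‖
      ≤ (∑ a, ∑ b, ‖N (gammaMat a * gammaMat b)‖) * B * ‖s‖ := by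
    simp only [Matrix.sum_mulVec, Finset.sum_mul]
    refine norm_sum_le_of_le _ fun a _ => norm_sum_le_of_le _ fun b _ => ?_
    rw [Matrix.smul_mulVec, norm_smul, norm_mul, norm_mul, heta, heta, mul_one, mul_one]
    calc ‖w a b‖ * ‖(gammaMat a * gammaMat b).mulVec s‖
        ≤ B * (‖N (gammaMat a * gammaMat b)‖ * ‖s‖) :=
          mul_le_mul (hw a b) (hN _ _) (norm_nonneg _) ((norm_nonneg _).trans (hw a b))
      _ = _ := by ring
  calc ‖killingDeriv lam t w s‖ ≤ |lam / 2| * ((∑ a, ‖N (gammaMat a)‖) * B * ‖s‖)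
      + ‖(1 / 4 : ℝ)‖ * ((∑ a, ∑ b, ‖N (gammaMat a * gammaMat b)‖) * B * ‖s‖) := by
        rw [killingDeriv, Matrix.smul_mulVec]
        refine (norm_sub_le _ _).trans (add_le_add ?_ ?_)
        · rw [norm_smul, Real.norm_eq_abs]; gcongr
        · rw [norm_smul]; gcongr
    _ = _ := by ring

/-- Continuity bounds the coframe and the connection forms near `p`, so the Killing equation gives a
differential inequality to which unique continuation along segments applies. -/
theorem eventually_eq_zero_of_killing {lam : ℝ} {θ : Fin 4 → E → E →L[ℝ] ℝ}
    {w : Fin 4 → Fin 4 → E → E →L[ℝ] ℝ} {s : E → Fin 4 → ℝ} {p : E}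
    (hθ : ∀ a, SmoothNear (θ a) p) (hw : ∀ a b, SmoothNear (w a b) p) (hs : SmoothNear s p)
    (hk : ∀ᶠ y in 𝓝 p, ∀ v, fderiv ℝ s y v
      = killingDeriv lam (fun c => θ c y v) (fun a b => w a b y v) (s y)) (h0 : s p = 0) :
    ∀ᶠ y in 𝓝 p, s y = 0 := by
  obtain ⟨C, hC, hbound⟩ := norm_killingDeriv_le lam
  have hθc : ContinuousAt (fun y a => θ a y) p := continuousAt_pi.2 fun a => (hθ a).continuousAt
  have hwc : ContinuousAt (fun y a b => w a b y) p :=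
    continuousAt_pi.2 fun a => continuousAt_pi.2 fun b => (hw a b).continuousAt
  obtain ⟨B₁, hB₁⟩ : ∃ B, ∀ᶠ y in 𝓝 p, ‖fun a => θ a y‖ < B :=
    ⟨_, hθc.norm.eventually_lt_const (lt_add_one _)⟩
  obtain ⟨B₂, hB₂⟩ : ∃ B, ∀ᶠ y in 𝓝 p, ‖fun a b => w a b y‖ < B :=
    ⟨_, hwc.norm.eventually_lt_const (lt_add_one _)⟩
  refine eventually_eq_zero_of_norm_fderiv_le (K := C * max B₁ B₂) hs.eventually_differentiableAt
    ?_ h0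
  filter_upwards [hk, hB₁, hB₂] with y hy h1 h2 v
  rw [hy v, mul_assoc C]
  refine hbound _ _ _ _ (fun a => (θ a y).le_of_opNorm_le ?_ v)
    fun a b => (w a b y).le_of_opNorm_le ?_ v
  · exact (norm_le_pi_norm (fun a => θ a y) a).trans (h1.le.trans (le_max_left _ _))
  · exact (norm_le_pi_norm (w a · y) b).trans
      ((norm_le_pi_norm (fun a b => w a b y) a).trans (h2.le.trans (le_max_right _ _)))

end UniqueContinuation

end SusyKundt

end

noncomputable section

open Filter Topology Set

namespace SusyKundt

/-! ### Orthonormal frames in a chart -/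

section Chart

variable {M : Type*} [TopologicalSpace M] [ChartedSpace (EuclideanSpace ℝ (Fin 4)) M]
  [IsManifold (𝓡 4) ∞ M] {g : LorentzianMetric M} {ι : Type*}

/-- A smooth chart whose domain lies in the `i`-th member of the cover of a spin structure. -/
structure IsFrameChart (P : SpinStructure g ι) (i : ι)
    (e : OpenPartialHomeomorph M (EuclideanSpace ℝ (Fin 4))) : Prop where
  subset : e.source ⊆ P.dom i
  smooth : ContMDiffOn (𝓡 4) (𝓡 4) ∞ e e.source
  smooth_symm : ContMDiffOn (𝓡 4) (𝓡 4) ∞ e.symm e.target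

theorem exists_isFrameChart (P : SpinStructure g ι) {i : ι} {p : M} (hp : p ∈ P.dom i) :
    ∃ e, IsFrameChart P i e ∧ p ∈ e.source := by
  refine ⟨(chartAt (EuclideanSpace ℝ (Fin 4)) p).restrOpen (P.dom i) (P.isOpen_dom i),
    ⟨?_, ?_, ?_⟩, ?_⟩
  · simp
  · exact (contMDiffOn_chart (I := 𝓡 4)).mono (by simp)
  · exact (contMDiffOn_chart_symm (I := 𝓡 4)).mono (by
      simp)
  · simp [hp]

theorem mlieBracket_eq_lieBracket {E : Type*} [NormedAddCommGroup E] [NormedSpace ℝ E]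
    (X Y : E → E) (y : E) :
    VectorField.mlieBracket 𝓘(ℝ, E) (M := E) X Y y = VectorField.lieBracket ℝ X Y y := by
  have h := congrFun (VectorField.mlieBracketWithin_eq_lieBracketWithin (𝕜 := ℝ) (E := E)
    (V := X) (W := Y) (s := univ)) y
  exact h.trans (congrFun VectorField.lieBracketWithin_univ y)

variable (P : SpinStructure g ι) (i : ι) (e : OpenPartialHomeomorph M (EuclideanSpace ℝ (Fin 4)))

/-- The differential of the inverse of a chart. -/
def chartDeriv (e : OpenPartialHomeomorph M (EuclideanSpace ℝ (Fin 4)))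
    (y : EuclideanSpace ℝ (Fin 4)) :
    EuclideanSpace ℝ (Fin 4) →L[ℝ] TangentSpace (𝓡 4) (e.symm y) :=
  mfderiv (𝓡 4) (𝓡 4) e.symm y

/-- The `i`-th frame of a spin structure in a chart. -/
def chartFrame (a : Fin 4) (y : EuclideanSpace ℝ (Fin 4)) : EuclideanSpace ℝ (Fin 4) :=
  VectorField.mpullback (𝓡 4) (𝓡 4) e.symm (P.frame i a) y

variable {P i e}

namespace IsFrameChart

theorem mdifferentiable (he : IsFrameChart P i e) : e.MDifferentiable (𝓡 4) (𝓡 4) :=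
  ⟨he.smooth.mdifferentiableOn (by simp), he.smooth_symm.mdifferentiableOn (by simp)⟩

variable {y : EuclideanSpace ℝ (Fin 4)}

theorem isInvertible (he : IsFrameChart P i e) (hy : y ∈ e.target) :
    (mfderiv (𝓡 4) (𝓡 4) e.symm y).IsInvertible :=
  ⟨he.mdifferentiable.symm.mfderiv hy, rfl⟩

theorem mem_dom (he : IsFrameChart P i e) (hy : y ∈ e.target) : e.symm y ∈ P.dom i :=
  he.subset (e.map_target hy)

theorem contMDiffAt_symm (he : IsFrameChart P i e) (hy : y ∈ e.target) :
    ContMDiffAt (𝓡 4) (𝓡 4) ∞ e.symm y :=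
  he.smooth_symm.contMDiffAt (e.open_target.mem_nhds hy)

theorem contMDiffAt_frame (he : IsFrameChart P i e) (hy : y ∈ e.target) (a : Fin 4) :
    ContMDiffAt (𝓡 4) (𝓡 4).tangent ∞
      (fun x ↦ (⟨x, P.frame i a x⟩ : TangentBundle (𝓡 4) M)) (e.symm y) :=
  (P.frame_smooth i a).contMDiffAt ((P.isOpen_dom i).mem_nhds (he.mem_dom hy))

theorem contDiffAt_chartFrame (he : IsFrameChart P i e) (hy : y ∈ e.target) (a : Fin 4) :
    ContDiffAt ℝ ∞ (chartFrame P i e a) y := by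
  refine contMDiffAt_vectorSpace_iff_contDiffAt.1 ?_
  exact ContMDiffAt.mpullback_vectorField_preimage (he.contMDiffAt_frame hy a)
    (he.contMDiffAt_symm hy) (he.isInvertible hy) (by simp)

theorem mfderiv_chartFrame (he : IsFrameChart P i e) (hy : y ∈ e.target) (a : Fin 4) :
    chartDeriv e y (chartFrame P i e a y) = P.frame i a (e.symm y) :=
  (he.isInvertible hy).self_apply_inverse _

theorem inner_frame (he : IsFrameChart P i e) (hy : y ∈ e.target) (a b : Fin 4) :
    g.inner (e.symm y) (P.frame i a (e.symm y)) (P.frame i b (e.symm y))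
      = if a = b then eta a else 0 :=
  P.frame_orthonormal i _ (he.mem_dom hy) a b

/-- Orthonormality makes the components in the frame on the manifold agree with those in its
pullback to the chart; the invertibility of `frameMap` is deduced from this. -/
theorem coord_mfderiv_frameMap (he : IsFrameChart P i e) (hy : y ∈ e.target) (c : Fin 4 → ℝ)
    (a : Fin 4) : P.coord i (e.symm y)
      (chartDeriv e y (frameMap (chartFrame P i e) y c)) a = c a := by
  rw [SpinStructure.coord, frameMap_apply, map_sum, map_sum]
  have h : ∀ b, g.inner (e.symm y) (P.frame i a (e.symm y))
      (chartDeriv e y (c b • chartFrame P i e b y)) =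
      c b * if a = b then eta a else 0 := fun b => by
    rw [map_smul, map_smul, he.mfderiv_chartFrame hy, he.inner_frame hy, smul_eq_mul]
  rw [Finset.sum_congr rfl fun b _ => h b]
  simp only [mul_ite, mul_zero, Finset.sum_ite_eq, Finset.mem_univ, if_true]
  rw [mul_comm (c a), ← mul_assoc, eta_mul_self, one_mul]

theorem isInvertible_frameMap (he : IsFrameChart P i e) (hy : y ∈ e.target) :
    (frameMap (chartFrame P i e) y).IsInvertible := by
  have hinj : Function.Injective (frameMap (chartFrame P i e) y) := fun c c' h => by
    ext a
    rw [← he.coord_mfderiv_frameMap hy c a, ← he.coord_mfderiv_frameMap hy c' a, h]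
  exact ⟨(LinearEquiv.ofInjectiveOfFinrankEq
    (frameMap (chartFrame P i e) y).toLinearMap hinj (by simp)).toContinuousLinearEquiv, rfl⟩

theorem coord_mfderiv (he : IsFrameChart P i e) (hy : y ∈ e.target)
    (v : EuclideanSpace ℝ (Fin 4)) (a : Fin 4) :
    P.coord i (e.symm y) (chartDeriv e y v) a
      = coframe (chartFrame P i e) a y v := by
  obtain ⟨c, rfl⟩ := (he.isInvertible_frameMap hy).surjective v
  rw [he.coord_mfderiv_frameMap hy, coframe, ContinuousLinearMap.comp_apply,
    (he.isInvertible_frameMap hy).inverse_apply_self]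
  rfl

theorem inner_mfderiv_frame (he : IsFrameChart P i e) (hy : y ∈ e.target)
    (v : EuclideanSpace ℝ (Fin 4)) (a : Fin 4) :
    g.inner (e.symm y) (chartDeriv e y v) (P.frame i a (e.symm y))
      = eta a * coframe (chartFrame P i e) a y v := by
  rw [← he.coord_mfderiv hy, SpinStructure.coord, ← mul_assoc, eta_mul_self, one_mul, g.symm]

theorem inner_mfderiv (he : IsFrameChart P i e) (hy : y ∈ e.target)
    (v w : EuclideanSpace ℝ (Fin 4)) :
    g.inner (e.symm y) (chartDeriv e y v) (chartDeriv e y w)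
      = ∑ a, eta a * (coframe (chartFrame P i e) a y v * coframe (chartFrame P i e) a y w) := by
  have h : chartDeriv e y w
      = ∑ a, coframe (chartFrame P i e) a y w • P.frame i a (e.symm y) := by
    conv_lhs => rw [← sum_coframe_smul (he.isInvertible_frameMap hy) w]
    rw [map_sum]
    refine Finset.sum_congr rfl fun a _ => ?_
    rw [map_smul, he.mfderiv_chartFrame hy]
  rw [h, map_sum]
  refine Finset.sum_congr rfl fun a _ => ?_
  rw [map_smul, he.inner_mfderiv_frame hy, smul_eq_mul]
  ring

theorem mlieBracket_frame (he : IsFrameChart P i e) (hy : y ∈ e.target) (a b : Fin 4) :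
    VectorField.mlieBracket (𝓡 4) (P.frame i a) (P.frame i b) (e.symm y) =
      chartDeriv e y
        (VectorField.lieBracket ℝ (chartFrame P i e a) (chartFrame P i e b) y) := by
  have h2 : minSmoothness ℝ 2 ≤ ∞ := by
    simp only [minSmoothness_of_isRCLikeNormedField]
    exact WithTop.coe_le_coe.2 le_top
  have : IsManifold (𝓡 4) (minSmoothness ℝ 2) M := IsManifold.of_le h2
  have h : VectorField.mpullback (𝓡 4) (𝓡 4) e.symm
        (VectorField.mlieBracket (𝓡 4) (P.frame i a) (P.frame i b)) y =
      VectorField.mlieBracket (𝓡 4) (M := EuclideanSpace ℝ (Fin 4)) (chartFrame P i e a)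
        (chartFrame P i e b) y :=
    VectorField.mpullback_mlieBracket (n := ∞)
      ((he.contMDiffAt_frame hy a).mdifferentiableAt (by simp))
      ((he.contMDiffAt_frame hy b).mdifferentiableAt (by simp)) (he.contMDiffAt_symm hy) h2
  rw [mlieBracket_eq_lieBracket] at h
  exact ((he.isInvertible hy).self_apply_inverse _).symm.trans (congrArg (chartDeriv e y) h)

theorem dirDeriv_inner_frame (he : IsFrameChart P i e) (hy : y ∈ e.target) (a b : Fin 4)
    (v : TangentSpace (𝓡 4) (e.symm y)) :
    dirDeriv (fun x ↦ g.inner x (P.frame i a x) (P.frame i b x)) (e.symm y) v = 0 := by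
  have h : (fun x ↦ g.inner x (P.frame i a x) (P.frame i b x)) =ᶠ[𝓝 (e.symm y)]
      fun _ => if a = b then eta a else 0 := by
    filter_upwards [(P.isOpen_dom i).mem_nhds (he.mem_dom hy)] with x hx
    exact P.frame_orthonormal i x hx a b
  rw [dirDeriv, h.mfderiv_eq, mfderiv_const]
  rfl

/-- The three derivative terms of the Koszul formula vanish because the frame is orthonormal, and
the brackets are natural under the chart. So the connection is computed from Lie brackets in
Euclidean space. -/
theorem koszul_frame (he : IsFrameChart P i e) (hy : y ∈ e.target) (c b a : Fin 4) :
    koszul g (P.frame i c) (P.frame i b) (P.frame i a) (e.symm y)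
      = koszulCoeff (chartFrame P i e) c b a y := by
  simp only [koszul, he.dirDeriv_inner_frame hy, he.mlieBracket_frame hy,
    he.inner_mfderiv_frame hy, koszulCoeff, structureCoeff]
  ring

theorem connection_mfderiv (he : IsFrameChart P i e) (hy : y ∈ e.target)
    (v : EuclideanSpace ℝ (Fin 4)) (a b : Fin 4) :
    P.connection i (e.symm y) (chartDeriv e y v) a b
      = connForm (chartFrame P i e) a b y v := by
  simp only [SpinStructure.connection, he.coord_mfderiv hy, he.koszul_frame hy, connForm,
    sum_apply, smul_apply, smul_eq_mul, mul_comm]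

theorem contDiffAt_comp (he : IsFrameChart P i e) (hy : y ∈ e.target) (ε : P.Spinor) :
    ContDiffAt ℝ ∞ (fun y => ε.comp i (e.symm y)) y := by
  rw [← contMDiffAt_iff_contDiffAt]
  exact ((ε.smooth i).contMDiffAt ((P.isOpen_dom i).mem_nhds (he.mem_dom hy))).comp y
    (he.contMDiffAt_symm hy)

/-- The Killing equation solved for the ordinary derivative: this is the passage from the spin
bundle to a first-order system on an open subset of Euclidean space. -/
theorem fderiv_comp (he : IsFrameChart P i e) (hy : y ∈ e.target) {ε : P.Spinor} {lam : ℝ}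
    (hε : ε.IsKilling lam) (v : EuclideanSpace ℝ (Fin 4)) :
    fderiv ℝ (fun y => ε.comp i (e.symm y)) y v =
      killingDeriv lam (fun c => coframe (chartFrame P i e) c y v)
        (fun a b => connForm (chartFrame P i e) a b y v) (ε.comp i (e.symm y)) := by
  have h1 : fderiv ℝ (fun y => ε.comp i (e.symm y)) y v =
      mfderiv (𝓡 4) 𝓘(ℝ, Fin 4 → ℝ) (ε.comp i) (e.symm y)
        (chartDeriv e y v) := by
    rw [← mfderiv_eq_fderiv]
    exact mfderiv_comp_apply y (((ε.smooth i).contMDiffAt ((P.isOpen_dom i).mem_nhds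
      (he.mem_dom hy))).mdifferentiableAt (by simp))
      ((he.contMDiffAt_symm hy).mdifferentiableAt (by simp)) v
  have h2 := hε.killing i _ (he.mem_dom hy) (chartDeriv e y v)
  simp only [SpinStructure.Spinor.covDeriv, SpinStructure.Spinor.cliffordMul,
    he.connection_mfderiv hy] at h2
  have h3 : P.coord i (e.symm y) (chartDeriv e y v)
      = fun c => coframe (chartFrame P i e) c y v := funext fun c => he.coord_mfderiv hy v c
  rw [h3] at h2
  rw [h1, killingDeriv]
  exact eq_sub_of_add_eq h2

theorem smoothNear_chartFrame (he : IsFrameChart P i e) (hy : y ∈ e.target) (a : Fin 4) :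
    SmoothNear (chartFrame P i e a) y :=
  (e.open_target.eventually_mem hy).mono fun _ hx => he.contDiffAt_chartFrame hx a

end IsFrameChart

end Chart

end SusyKundt

end

noncomputable section

open Filter Topology Set

namespace SusyKundt

/-! ### Killing spinors in a chart -/

section KillingSpinor

variable {M : Type*} [TopologicalSpace M] [ChartedSpace (EuclideanSpace ℝ (Fin 4)) M]
  [IsManifold (𝓡 4) ∞ M] {g : LorentzianMetric M} {ι : Type*} {P : SpinStructure g ι} {i : ι}
  {e : OpenPartialHomeomorph M (EuclideanSpace ℝ (Fin 4))} {ε : P.Spinor} {lam : ℝ}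

namespace IsFrameChart

variable {y : EuclideanSpace ℝ (Fin 4)}

theorem eventually_isInvertible_frameMap (he : IsFrameChart P i e) (hy : y ∈ e.target) :
    ∀ᶠ z in 𝓝 y, (frameMap (chartFrame P i e) z).IsInvertible :=
  (e.open_target.eventually_mem hy).mono fun _ hz => he.isInvertible_frameMap hz

theorem smoothNear_coframe (he : IsFrameChart P i e) (hy : y ∈ e.target) (a : Fin 4) :
    SmoothNear (coframe (chartFrame P i e) a) y :=
  SusyKundt.smoothNear_coframe (he.smoothNear_chartFrame hy)
    (he.eventually_isInvertible_frameMap hy) a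

theorem smoothNear_comp (he : IsFrameChart P i e) (hy : y ∈ e.target) (ε : P.Spinor) :
    SmoothNear (fun y => ε.comp i (e.symm y)) y :=
  (e.open_target.eventually_mem hy).mono fun _ hz => he.contDiffAt_comp hz ε

theorem isKillingFrame (he : IsFrameChart P i e) (hy : y ∈ e.target) (hε : ε.IsKilling lam) :
    IsKillingFrame lam (coframe (chartFrame P i e)) (fun y => ε.comp i (e.symm y)) y :=
  ⟨fun a b => connForm (chartFrame P i e) a b y, fun a b v => connForm_antisymm a b y v,
    extD_coframe (fun a => (he.smoothNear_chartFrame hy a).differentiableAt)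
      (fun a => (he.smoothNear_coframe hy a).differentiableAt)
      (he.eventually_isInvertible_frameMap hy), fun v => he.fderiv_comp hy hε v⟩

end IsFrameChart

theorem SpinStructure.Spinor.comp_eq_zero (ε : P.Spinor) {i j : ι} {x : M} (hi : x ∈ P.dom i)
    (hj : x ∈ P.dom j) (h : ε.comp j x = 0) : ε.comp i x = 0 := by
  rw [ε.compat i j x ⟨hi, hj⟩, h, Matrix.mulVec_zero]

/-- A Killing spinor vanishes near each of its zeros. -/
theorem SpinStructure.Spinor.IsKilling.eventually_comp_eq_zero (hε : ε.IsKilling lam) {x : M}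
    (hx : x ∈ P.dom i) (h0 : ε.comp i x = 0) : ∀ᶠ z in 𝓝 x, ε.comp i z = 0 := by
  obtain ⟨e, he, hxe⟩ := exists_isFrameChart P hx
  have hy := e.map_source hxe
  have h := eventually_eq_zero_of_killing (lam := lam) (he.smoothNear_coframe hy)
    (smoothNear_connForm (he.smoothNear_chartFrame hy) (he.eventually_isInvertible_frameMap hy))
    (he.smoothNear_comp hy ε)
    ((e.open_target.eventually_mem hy).mono fun z hz v => he.fderiv_comp hz hε v)
    (by simpa only [e.left_inv hxe] using h0)
  filter_upwards [(e.continuousAt hxe).eventually h, e.open_source.mem_nhds hxe] with z hz hze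
  rwa [e.left_inv hze] at hz

/-- A Killing spinor on a connected manifold has no zeros. -/
theorem SpinStructure.Spinor.IsKilling.comp_ne_zero [ConnectedSpace M] (hε : ε.IsKilling lam)
    {x : M} (hx : x ∈ P.dom i) : ε.comp i x ≠ 0 := by
  -- Vanishing does not depend on the member of the cover, since the transition matrices are linear.
  -- `Z` is open by unique continuation and closed by continuity.
  let Z : Set M := {x | ∀ j, x ∈ P.dom j → ε.comp j x = 0}
  have hZ : ∀ {j x}, x ∈ P.dom j → ε.comp j x = 0 → x ∈ Z := fun hj h _ hk =>
    ε.comp_eq_zero hk hj h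
  have hopen : IsOpen Z := isOpen_iff_mem_nhds.2 fun x hxZ => by
    obtain ⟨j, hj⟩ := P.cover x
    filter_upwards [hε.eventually_comp_eq_zero hj (hxZ j hj), (P.isOpen_dom j).mem_nhds hj]
      with z hz hzj using hZ hzj hz
  have hopen' : IsOpen Zᶜ := isOpen_iff_mem_nhds.2 fun x hxZ => by
    obtain ⟨j, hj⟩ := P.cover x
    have h0 : ε.comp j x ≠ 0 := fun h => hxZ (hZ hj h)
    have hc : ContinuousAt (ε.comp j) x :=
      (ε.smooth j).continuousOn.continuousAt ((P.isOpen_dom j).mem_nhds hj)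
    filter_upwards [hc.eventually_ne h0, (P.isOpen_dom j).mem_nhds hj] with z hz hzj hzZ
    exact hz (hzZ j hzj)
  intro h
  have huniv : Z = univ := IsClopen.eq_univ ⟨isOpen_compl_iff.1 hopen', hopen⟩ ⟨x, hZ hx h⟩
  obtain ⟨j, z, hz, hne⟩ := hε.nontrivial
  exact hne ((huniv ▸ mem_univ z : z ∈ Z) j hz)

/-- The local form of a Lorentzian metric with a Killing spinor. -/
theorem SpinStructure.Spinor.IsKilling.exists_kundt_chart [ConnectedSpace M]
    (hε : ε.IsKilling lam) (p : M) :
    ∃ H : ℝ → (Fin 2 → ℝ) → ℝ, ContDiff ℝ ∞ (fun z : ℝ × (Fin 2 → ℝ) => H z.1 z.2) ∧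
      ∃ φ : OpenPartialHomeomorph M (EuclideanSpace ℝ (Fin 4)), p ∈ φ.source ∧
        ContMDiffOn (𝓡 4) (𝓡 4) ∞ φ φ.source ∧ ContMDiffOn (𝓡 4) (𝓡 4) ∞ φ.symm φ.target ∧
        ∀ x ∈ φ.source, ∀ v w : TangentSpace (𝓡 4) x,
          g.inner x v w =
            kundtMetric lam H (fun _ y => y 0) (fun _ y => y 1) (fun _ _ => 0) (φ x)
              (mfderiv (𝓡 4) (𝓡 4) φ x v) (mfderiv (𝓡 4) (𝓡 4) φ x w) := by
  obtain ⟨i, hi⟩ := P.cover p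
  obtain ⟨e, he, hpe⟩ := exists_isFrameChart P hi
  have hy := e.map_source hpe
  have hinv := he.isInvertible_frameMap hy
  obtain ⟨H, hH, Θ, hpΘ, hΘ, hΘs, hq⟩ :=
    exists_kundt_chart_of_isKillingFrame (p := e p) hε.const_ne_zero (he.smoothNear_coframe hy)
    (he.smoothNear_comp hy ε) (by simpa only [e.left_inv hpe] using hε.comp_ne_zero hi)
    (fun v hv => by simpa [hv] using (sum_coframe_smul hinv v).symm)
    (fun t => ⟨frameMap (chartFrame P i e) (e p) t, fun a => by
      rw [coframe, ContinuousLinearMap.comp_apply, hinv.inverse_apply_self]; rfl⟩)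
    ((e.open_target.eventually_mem hy).mono fun z hz => he.isKillingFrame hz hε)
  have hΘm : ContMDiffOn (𝓡 4) (𝓡 4) ∞ Θ Θ.source := fun x hx =>
    (hΘ x hx).contMDiffAt.contMDiffWithinAt
  have hΘm' : ContMDiffOn (𝓡 4) (𝓡 4) ∞ Θ.symm Θ.target := fun x hx =>
    (hΘs x hx).contMDiffAt.contMDiffWithinAt
  refine ⟨H, hH, e.trans Θ, ?_, ?_, ?_, fun x hx v w => ?_⟩
  · simp [hpe, hpΘ]
  · rw [e.coe_trans, e.trans_source]
    exact hΘm.comp (he.smooth.mono inter_subset_left) fun x hx => hx.2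
  · rw [e.coe_trans_symm, e.trans_target]
    exact he.smooth_symm.comp (hΘm'.mono inter_subset_left) fun x hx => hx.2
  · rw [e.trans_source] at hx
    have hD : ∀ v : TangentSpace (𝓡 4) x, mfderiv (𝓡 4) (𝓡 4) (e.trans Θ) x v
        = fderiv ℝ Θ (e x) (mfderiv (𝓡 4) (𝓡 4) e x v) := fun v => by
      rw [← mfderiv_eq_fderiv]
      exact mfderiv_comp_apply x ((hΘ _ hx.2).contMDiffAt.mdifferentiableAt (by simp))
        (he.mdifferentiable.mdifferentiableAt hx.1) v
    have hg := he.inner_mfderiv (e.map_source hx.1) (mfderiv (𝓡 4) (𝓡 4) e x v)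
      (mfderiv (𝓡 4) (𝓡 4) e x w)
    have hback : ∀ v : TangentSpace (𝓡 4) x,
        chartDeriv e (e x) (mfderiv (𝓡 4) (𝓡 4) e x v) = v := fun v =>
      congrArg (fun T => T v) (he.mdifferentiable.symm_comp_deriv hx.1)
    rw [hback, hback] at hg
    -- The points `e.symm (e x)` and `x` are equal but not definitionally so; all tangent spaces
    -- share one model space, which allows the metric to be transported.
    have hx' : ∀ z, z = x → ∀ v w : EuclideanSpace ℝ (Fin 4),
        g.inner z v w = g.inner x v w := by
      rintro _ rfl v w
      rfl
    rw [hD, hD]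
    exact (hx' _ (e.left_inv hx.1) v w).symm.trans (hg.trans (hq _ hx.2 _ _))

end KillingSpinor

end SusyKundt

end

/-! ### The local form of the metric. -/

theorem mainTheorem2 {M : Type*} [TopologicalSpace M] [T2Space M] [SecondCountableTopology M]
    [ConnectedSpace M] [ChartedSpace (EuclideanSpace ℝ (Fin 4)) M] [IsManifold (𝓡 4) ∞ M]
    (g : LorentzianMetric M) {ι : Type*} (P : SpinStructure g ι) (ε : P.Spinor) (lam : ℝ)
    (hε : ε.IsKilling lam) (p : M) :
    ∃ (H F G : ℝ → (Fin 2 → ℝ) → ℝ) (β : ℝ → (Fin 2 → ℝ) → (Fin 2 → ℝ)),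
      ContDiff ℝ ∞ (fun z : ℝ × (Fin 2 → ℝ) ↦ H z.1 z.2) ∧
      ContDiff ℝ ∞ (fun z : ℝ × (Fin 2 → ℝ) ↦ F z.1 z.2) ∧
      ContDiff ℝ ∞ (fun z : ℝ × (Fin 2 → ℝ) ↦ G z.1 z.2) ∧
      ContDiff ℝ ∞ (fun z : ℝ × (Fin 2 → ℝ) ↦ β z.1 z.2) ∧
      (∀ u y, LinearIndependent ℝ ![dX (F u) y, dX (G u) y]) ∧
      BetaEquation lam F G β ∧
      ∃ φ : OpenPartialHomeomorph M (EuclideanSpace ℝ (Fin 4)),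
        p ∈ φ.source ∧
        ContMDiffOn (𝓡 4) (𝓡 4) ∞ φ φ.source ∧
        ContMDiffOn (𝓡 4) (𝓡 4) ∞ φ.symm φ.target ∧
        ∀ x ∈ φ.source, ∀ v w : TangentSpace (𝓡 4) x,
          g.inner x v w =
            kundtMetric lam H F G β (φ x)
              (mfderiv (𝓡 4) (𝓡 4) φ x v) (mfderiv (𝓡 4) (𝓡 4) φ x w) := by
  obtain ⟨H, hH, hφ⟩ := hε.exists_kundt_chart p
  -- The logarithm of the factor of the Dirac current and the screen function have become the two
  -- coordinates of the plane; only `H` depends on the manifold.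
  refine ⟨H, fun _ y => y 0, fun _ y => y 1, fun _ _ => 0, hH, ?_, ?_, contDiff_const,
    fun _ => linearIndependent_dX_coord, betaEquation_coord lam, hφ⟩
  · exact (contDiff_apply ℝ ℝ (0 : Fin 2)).comp contDiff_snd
  · exact (contDiff_apply ℝ ℝ (1 : Fin 2)).comp contDiff_snd
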